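/- **Theorem (Basic comparison principle).** Let $\Omega\subset\mathbb R^n$ ($n\ge 1$) be a bounded Lipschitz domain with exterior $\Omega_e=\mathbb R^n\setminus\overline\Omega$, let $T>0$, $0<s<1$, $m>1$, and write $A_T=A\times(0,T)$ and $\Phi^m(t)=|t|^{m-1}t$. Let $K\colon\mathbb R^n\times\mathbb R^n\to\mathbb R$ be measurable with $K(x,y)=K(y,x)$ and $\lambda\le K(x,y)\le\Lambda$ for all $x,y$ and some constants $0<\lambda\le\Lambda<\infty$; let $L_K$ be the associated integro-differential operator of order $2s$, with bilinear form $$B_K(u,v)=\int_{\mathbb R^{2n}}K(x,y)\frac{(u(x)-u(y))(v(x)-v(y))}{|x-y|^{n+2s}}\,dx\,dy .$$ Let $H^s(\mathbb R^n)$ be the fractional Sobolev space with its Gagliardo norm and $\widetilde H^s(\Omega)$ the closure of $C_c^\infty(\Omega)$ in it. Functions in $C_c([0,T]\times\Omega_e)$ are extended by zero to $[0,T]\times\mathbb R^n$. For $\Phi\colon\mathbb R\to\mathbb R$, *data* for $\Phi$ are a triple $(F,\varphi,u_0)$ with $F\in L^2(\Omega_T)$, $\varphi\in C_c([0,T]\times\Omega_e)$,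 $\Phi(\varphi)\in L^2(0,T;H^s(\mathbb R^n))$ and $u_0\in L^\infty(\Omega)\cap\widetilde H^s(\Omega)$. A function $u\colon\mathbb R^n\times(0,T)\to\mathbb R$ is a (weak) solution of $$\partial_tu+L_K(\Phi(u))=F\ \text{in }\Omega_T,\qquad u=\varphi\ \text{in }(\Omega_e)_T,\qquad u(0)=u_0\ \text{in }\Omega \tag{$P_\Phi(F,\varphi,u_0)$}$$ if $\Phi(u)\in L^2(0,T;H^s(\mathbb R^n))$, $\Phi(u-\varphi)\in L^2(0,T;\widetilde H^s(\Omega))$ and, for all $\psi\in C_c^\infty([0,T)\times\Omega)$, $$-\int_{\Omega_T}u\,\partial_t\psi\,dx\,dt+\int_0^TB_K(\Phi(u),\psi)\,dt=\int_{\Omega_T}F\psi\,dx\,dt+\int_\Omega u_0\psi(0)\,dx .$$ Then there is a constant $C>0$, depending only on $n,\Omega,T,s,m,K$, such that the following holds. Let $\Phi_\varepsilon^m\colon\mathbb R\to\mathbb R$ ($\varepsilon>0$ small) be any family of odd $C^1$ functions with $c_\varepsilon\le(\Phi_\varepsilon^m)'\le C_\varepsilon$ for some constants $0<c_\varepsilon\le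 C_\varepsilon<\infty$ and with $\Phi_\varepsilon^m\to\Phi^m$ uniformly on compact sets as $\varepsilon\to0$. For $j=1,2$ let $(F_j,\varphi_j,u_{0,j})$ be data for $\Phi^m$ and let $u_j$ be a solution of $P_{\Phi^m}(F_j,\varphi_j,u_{0,j})$. Suppose that for all small $\varepsilon>0$ there are data $(F_j^\varepsilon,\varphi_j^\varepsilon,u_{0,j}^\varepsilon)$ for $\Phi_\varepsilon^m$ and functions $u_{j,\varepsilon}\in H^1(0,T;L^2(\Omega))\cap L^2(0,T;H^s(\mathbb R^n))$, $j=1,2$, such that 1. $\liminf_{\varepsilon\to0}\int_{\Omega_T}(F_1^\varepsilon-F_2^\varepsilon)_+\,dx\,dt\le\int_{\Omega_T}(F_1-F_2)_+\,dx\,dt$; 2. $\displaystyle\liminf_{\varepsilon\to0}\int_0^T\!\!\int_{\Omega}\int_{\Omega_e}\frac{(\Phi_\varepsilon^m(\varphi_1^\varepsilon)-\Phi_\varepsilon^m(\varphi_2^\varepsilon))_+(x,t)}{|x-y|^{n+2s}}\,dx\,dy\,dt\le\int_0^T\!\!\int_{\Omega}\int_{\Omega_e}\frac{(\Phi^m(\varphi_1)-\Phi^m(\varphi_2))_+(x,t)}{|x-y|^{n+2s}}\,dx\,dy\,dt$;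 3. $u_{0,j}^\varepsilon\to u_{0,j}$ in $L^1(\Omega)$ as $\varepsilon\to0$; 4. $u_{j,\varepsilon}\rightharpoonup u_j$ weakly in $L^1(\Omega_T)$ as $\varepsilon\to0$; 5. $u_{j,\varepsilon}$ is a solution of $P_{\Phi_\varepsilon^m}(F_j^\varepsilon,\varphi_j^\varepsilon,u_{0,j}^\varepsilon)$. Then, for almost every $t_0\in(0,T)$, $$\int_\Omega(u_1-u_2)_+(x,t_0)\,dx\le C\left(\int_{\Omega_T}(F_1-F_2)_+\,dx\,dt+\int_\Omega(u_{0,1}-u_{0,2})_+\,dx+\int_0^T\!\!\int_{\Omega}\int_{\Omega_e}\frac{(\Phi^m(\varphi_1)-\Phi^m(\varphi_2))_+(x,t)}{|x-y|^{n+2s}}\,dx\,dy\,dt\right).$$ -/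

import Mathlib

open MeasureTheory Set Filter Topology
open scoped ContDiff ENNReal NNReal

namespace NPME

/-- The Euclidean space `ℝⁿ`. -/
abbrev Rn (n : ℕ) : Type := EuclideanSpace ℝ (Fin n)

/-- A bounded open set whose boundary is locally the graph of a Lipschitz function: near every
boundary point there is a direction `e` such that, in a ball around that point, the set is the
strict epigraph in direction `e` of a Lipschitz function of the component orthogonal to `e`. -/
structure IsBoundedLipschitz {n : ℕ} (Ω : Set (Rn n)) : Prop where
  isOpen : IsOpen Ω
  isBounded : Bornology.IsBounded Ω
  lipschitz_boundary : ∀ x₀ ∈ frontier Ω, ∃ e : Rn n, ‖e‖ = 1 ∧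
    ∃ (γ : Rn n → ℝ) (M : ℝ≥0), LipschitzWith M γ ∧
      ∃ r : ℝ, 0 < r ∧ ∀ x ∈ Metric.ball x₀ r,
        (x ∈ Ω ↔ γ (x - (inner ℝ e x : ℝ) • e) < (inner ℝ e x : ℝ))

/-- The exterior `Ω_e = ℝⁿ \ closure Ω`. -/
def exterior {n : ℕ} (Ω : Set (Rn n)) : Set (Rn n) := (closure Ω)ᶜ

/-- Lebesgue measure on the cylinder `(0,T) × A`. -/
noncomputable def cylMeasure {n : ℕ} (T : ℝ) (A : Set (Rn n)) : Measure (ℝ × Rn n) :=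
  (volume.restrict (Ioo 0 T)).prod (volume.restrict A)

/-! ### Fractional Sobolev spaces -/

/-- The square `[u]²` of the Gagliardo seminorm of order `s` on `ℝⁿ`. -/
noncomputable def gagliardoSq {n : ℕ} (s : ℝ) (u : Rn n → ℝ) : ℝ≥0∞ :=
  ∫⁻ x, ∫⁻ y, ENNReal.ofReal (|u x - u y| ^ 2 / ‖x - y‖ ^ ((n : ℝ) + 2 * s))

/-- The square of the norm of `H^s(ℝⁿ)`. -/
noncomputable def hsNormSq {n : ℕ} (s : ℝ) (u : Rn n → ℝ) : ℝ≥0∞ :=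
  (∫⁻ x, ENNReal.ofReal (|u x| ^ 2)) + gagliardoSq s u

/-- `u ∈ H^s(ℝⁿ)`. -/
def MemHs {n : ℕ} (s : ℝ) (u : Rn n → ℝ) : Prop :=
  AEStronglyMeasurable u volume ∧ hsNormSq s u < ⊤

/-- `u ∈ H̃^s(Ω)`, the closure of `C_c^∞(Ω)` in `H^s(ℝⁿ)`. -/
def MemHsTilde {n : ℕ} (s : ℝ) (Ω : Set (Rn n)) (u : Rn n → ℝ) : Prop :=
  MemHs s u ∧ ∀ δ : ℝ≥0∞, 0 < δ → ∃ ψ : Rn n → ℝ,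
    ContDiff ℝ ∞ ψ ∧ HasCompactSupport ψ ∧ tsupport ψ ⊆ Ω ∧ hsNormSq s (fun x => u x - ψ x) < δ

/-- `w ∈ L²(0,T; H^s(ℝⁿ))`, for `w` given as a function of `(t, x)`. -/
def MemL2Hs {n : ℕ} (s T : ℝ) (w : ℝ → Rn n → ℝ) : Prop :=
  AEStronglyMeasurable (Function.uncurry w) (cylMeasure T univ) ∧
    (∀ᵐ t ∂(volume.restrict (Ioo 0 T)), MemHs s (w t)) ∧
    ∫⁻ t in Ioo 0 T, hsNormSq s (w t) < ⊤

/-- `w ∈ L²(0,T; H̃^s(Ω))`. -/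
def MemL2HsTilde {n : ℕ} (s T : ℝ) (Ω : Set (Rn n)) (w : ℝ → Rn n → ℝ) : Prop :=
  MemL2Hs s T w ∧ ∀ᵐ t ∂(volume.restrict (Ioo 0 T)), MemHsTilde s Ω (w t)

/-- `F ∈ L²(Ω_T)`. -/
def MemL2Cyl {n : ℕ} (T : ℝ) (Ω : Set (Rn n)) (F : ℝ → Rn n → ℝ) : Prop :=
  MemLp (Function.uncurry F) 2 (cylMeasure T Ω)

/-- `u ∈ H¹(0,T; L²(Ω))`: `u` and its distributional time derivative `w` are in
`L²(0,T; L²(Ω)) = L²(Ω_T)`. The identity `∫ η' u dt = - ∫ η w dt` is one in `L²(Ω)`. -/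
def MemH1L2 {n : ℕ} (T : ℝ) (Ω : Set (Rn n)) (u : ℝ → Rn n → ℝ) : Prop :=
  MemL2Cyl T Ω u ∧ ∃ w : ℝ → Rn n → ℝ, MemL2Cyl T Ω w ∧
    ∀ η : ℝ → ℝ, ContDiff ℝ ∞ η → HasCompactSupport η → tsupport η ⊆ Ioo 0 T →
      ∀ᵐ x ∂(volume.restrict Ω),
        ∫ t in Ioo 0 T, deriv η t * u t x = - ∫ t in Ioo 0 T, η t * w t x

/-- `φ ∈ C_c([0,T] × Ω_e)`, extended by zero to `[0,T] × ℝⁿ`. -/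
def MemCcExterior {n : ℕ} (T : ℝ) (Ω : Set (Rn n)) (φ : ℝ → Rn n → ℝ) : Prop :=
  ContinuousOn (Function.uncurry φ) (Icc 0 T ×ˢ univ) ∧
    ∃ S : Set (Rn n), IsCompact S ∧ S ⊆ exterior Ω ∧ ∀ t ∈ Icc 0 T, ∀ x ∉ S, φ t x = 0

/-- Weak convergence `v_ε ⇀ v` in `L¹(Ω_T)` as `ε → 0`, `ε > 0`. -/
def TendstoWeakL1 {n : ℕ} (T : ℝ) (Ω : Set (Rn n)) (vε : ℝ → ℝ → Rn n → ℝ)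
    (v : ℝ → Rn n → ℝ) : Prop :=
  (∀ᶠ ε in 𝓝[>] (0 : ℝ), Integrable (Function.uncurry (vε ε)) (cylMeasure T Ω)) ∧
    Integrable (Function.uncurry v) (cylMeasure T Ω) ∧
    ∀ g : ℝ × Rn n → ℝ, MemLp g ⊤ (cylMeasure T Ω) →
      Tendsto (fun ε => ∫ p, vε ε p.1 p.2 * g p ∂(cylMeasure T Ω)) (𝓝[>] 0)
        (𝓝 (∫ p, v p.1 p.2 * g p ∂(cylMeasure T Ω)))

/-! ### Nonlocal operators, the nonlinearity and weak solutions -/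

/-- The kernels of the operators in the class `𝓛₀`: measurable, symmetric, uniformly elliptic. -/
structure IsKernel {n : ℕ} (K : Rn n → Rn n → ℝ) : Prop where
  aemeasurable : AEMeasurable (Function.uncurry K) (volume : Measure (Rn n × Rn n))
  symm : ∀ x y, K x y = K y x
  elliptic : ∃ lam Lam : ℝ, 0 < lam ∧ lam ≤ Lam ∧ ∀ x y, lam ≤ K x y ∧ K x y ≤ Lam

/-- The bilinear form `B_K` of the operator `L_K` of order `2s`. -/
noncomputable def bilin {n : ℕ} (s : ℝ) (K : Rn n → Rn n → ℝ) (u v : Rn n → ℝ) : ℝ :=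
  ∫ p : Rn n × Rn n,
    K p.1 p.2 * ((u p.1 - u p.2) * (v p.1 - v p.2) / ‖p.1 - p.2‖ ^ ((n : ℝ) + 2 * s))

/-- `Φ^m(t) = |t|^{m-1} t`. -/
noncomputable def Phi (m t : ℝ) : ℝ := |t| ^ (m - 1) * t

/-- A family of regularizations `Φ_ε`, for small `ε > 0`, of the nonlinearity `Φ^m`. -/
def IsRegularization (m : ℝ) (Φε : ℝ → ℝ → ℝ) : Prop :=
  (∀ᶠ ε in 𝓝[>] (0 : ℝ), ContDiff ℝ 1 (Φε ε) ∧ (∀ t, Φε ε t = - Φε ε (-t)) ∧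
    ∃ c C : ℝ, 0 < c ∧ c ≤ C ∧ ∀ t, c ≤ deriv (Φε ε) t ∧ deriv (Φε ε) t ≤ C) ∧
  ∀ S : Set ℝ, IsCompact S → TendstoUniformlyOn Φε (Phi m) (𝓝[>] 0) S

/-- Admissible source, exterior value and initial value for the problem with nonlinearity `Φ`:
`F ∈ L²(Ω_T)`, `φ ∈ C_c([0,T] × Ω_e)` with `Φ(φ) ∈ L²(0,T; H^s(ℝⁿ))`,
`u₀ ∈ L^∞(Ω) ∩ H̃^s(Ω)`. -/
structure IsAdmissibleData {n : ℕ} (s T : ℝ) (Ω : Set (Rn n)) (Φ : ℝ → ℝ)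
    (F φ : ℝ → Rn n → ℝ) (u₀ : Rn n → ℝ) : Prop where
  source : MemL2Cyl T Ω F
  ext_cont : MemCcExterior T Ω φ
  ext_sobolev : MemL2Hs s T (fun t x => Φ (φ t x))
  init_bounded : MemLp u₀ ⊤ (volume.restrict Ω)
  init_sobolev : MemHsTilde s Ω u₀

/-- `u : (0,T) × ℝⁿ → ℝ` is a weak solution of `∂ₜu + L_K(Φ(u)) = F` in `Ω_T`, `u = φ` in
`(Ω_e)_T`, `u(0) = u₀` in `Ω`. The functions `ψ` restricted to `[0,T) × Ω` are exactly those of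
`C_c^∞([0,T) × Ω)`. -/
structure IsWeakSolution {n : ℕ} (s T : ℝ) (Ω : Set (Rn n)) (K : Rn n → Rn n → ℝ) (Φ : ℝ → ℝ)
    (F φ : ℝ → Rn n → ℝ) (u₀ : Rn n → ℝ) (u : ℝ → Rn n → ℝ) : Prop where
  sobolev : MemL2Hs s T (fun t x => Φ (u t x))
  exterior_value : MemL2HsTilde s T Ω (fun t x => Φ (u t x - φ t x))
  equation : ∀ ψ : ℝ → Rn n → ℝ, ContDiff ℝ ∞ (Function.uncurry ψ) →
    HasCompactSupport (Function.uncurry ψ) → tsupport (Function.uncurry ψ) ⊆ Iio T ×ˢ Ω →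
      - (∫ p, u p.1 p.2 * deriv (fun τ => ψ τ p.2) p.1 ∂(cylMeasure T Ω))
          + ∫ t in Ioo 0 T, bilin s K (fun x => Φ (u t x)) (ψ t)
        = (∫ p, F p.1 p.2 * ψ p.1 p.2 ∂(cylMeasure T Ω)) + ∫ x in Ω, u₀ x * ψ 0 x

/-! ### The quantities in the comparison estimate

For a real number `a`, `ENNReal.ofReal a` is the positive part `a₊`, as an element of `[0,∞]`. -/

/-- `∫_Ω (v - w)₊ dx`. -/
noncomputable def posPartInt {n : ℕ} (Ω : Set (Rn n)) (v w : Rn n → ℝ) : ℝ≥0∞ :=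
  ∫⁻ x in Ω, ENNReal.ofReal (v x - w x)

/-- `∫_{Ω_T} (F - G)₊ dx dt`. -/
noncomputable def posPartIntCyl {n : ℕ} (T : ℝ) (Ω : Set (Rn n)) (F G : ℝ → Rn n → ℝ) : ℝ≥0∞ :=
  ∫⁻ t in Ioo 0 T, posPartInt Ω (F t) (G t)

/-- `∫_{Ω_T} ∫_{Ω_e} (v - w)₊(x,t) / |x - y|^{n+2s} dx dy dt`, with `x ∈ Ω_e` and `y ∈ Ω`. -/
noncomputable def exteriorPosPartInt {n : ℕ} (s T : ℝ) (Ω : Set (Rn n))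
    (v w : ℝ → Rn n → ℝ) : ℝ≥0∞ :=
  ∫⁻ t in Ioo 0 T, ∫⁻ y in Ω, ∫⁻ x in exterior Ω,
    ENNReal.ofReal (v t x - w t x) / ENNReal.ofReal (‖x - y‖ ^ ((n : ℝ) + 2 * s))

end NPME

namespace NPME

/-! ### Elliptic problems in Hilbert spaces and the implicit Euler scheme -/

section Hilbert

variable {H Y : Type*} [NormedAddCommGroup H] [InnerProductSpace ℝ H]
  [NormedAddCommGroup Y] [InnerProductSpace ℝ Y]

/-! Put `w = Φ^m(u - φ)`, which lies in `H̃^s(Ω)` for a.e. time, and let `β = Φ^{1/m}` be the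
inverse of `Φ^m`. In `Ω` the exterior value vanishes, so `u = β(w)`; outside `Ω`, `u = φ` almost
everywhere. Hence `Φ^m(u) = w + Φ^m(φ)`, and the problem becomes `∂ₜβ(w) + L_K w = F - L_K Φ^m(φ)`
in `Ω` with zero exterior value. Since `φ` is supported at positive distance from `Ω`, the term
`-L_K Φ^m(φ)` is a bounded function on `Ω`, namely `2 ∫_{Ω_e} K Φ^m(φ) / |x-y|^{n+2s}`. It is
monotone in `φ` because `K > 0`, and it produces the exterior integral in the estimate, with
constant `2Λ`.

Formally one subtracts two such equations and tests with `sign⁺(w₁ - w₂)`. This is not justified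
directly, since `∂ₜu` is only controlled in a dual space. Each solution is therefore compared with
an implicit Euler scheme. One step solves `β(ϑ) + h L_K ϑ = g` by minimizing a convex energy
(`exists_resolvent`). There the formal argument is legitimate with smooth approximations of the
sign, because the form is nonnegative on pairs `(a, G(a))` with `G` monotone. So each step contracts
`∫ (·)₊` (`IsMarkov.posL1_superpose_sub_le`), and the discrete comparison follows by adding up the
steps.

A weak solution satisfies the scheme up to the consistency errors `∫ Dw dτ - h Dw(t_{k+1})` over the
cells, with `D` the nonlocal gradient. Monotonicity of `β` bounds the distance to the scheme, in the
norm dual to the energy, by the sum of these errors (`implicit_euler_error`). That sum is a Riemann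
sum error of an integrable function of time, and for a.e. `t₀` it is arbitrarily small on suitable
grids ending at `t₀` (`exists_grid`). Convergence in the dual norm suffices: it gives the bound for
all pairings of `u₁ - u₂` with test functions `0 ≤ ζ ≤ 1` (`IsMarkov.comparison`), and the supremum
of these pairings is `∫ (u₁ - u₂)₊` (`posL1_le_of_forall_isTest`). -/

theorem continuous_of_sub_le_inner {β : H → H} (hβ : Continuous β) {P : H → ℝ}
    (hP : ∀ x y, P x - P y ≤ inner ℝ (β x) (x - y)) : Continuous P := by
  rw [continuous_iff_continuousAt]
  intro y
  -- The subgradient inequality, used at `y` and at `x`, squeezes `P x` between two expressions that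
  -- tend to `P y`.
  have h1 : Tendsto (fun x => P y + inner ℝ (β y) (x - y)) (𝓝 y) (𝓝 (P y)) := by
    have : ContinuousAt (fun x => P y + inner ℝ (β y) (x - y)) y := by fun_prop
    simpa [ContinuousAt] using this
  have h2 : Tendsto (fun x => P y + inner ℝ (β x) (x - y)) (𝓝 y) (𝓝 (P y)) := by
    have : ContinuousAt (fun x => P y + inner ℝ (β x) (x - y)) y := by fun_prop
    simpa [ContinuousAt] using this
  refine tendsto_of_tendsto_of_tendsto_of_le_of_le h1 h2 (fun x => ?_) (fun x => ?_)
  · have := hP y x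
    rw [← neg_sub x y, inner_neg_right] at this
    simp only; linarith
  · have := hP x y
    simp only; linarith

/-- `β z` is a subgradient of `P` at the midpoint `z`, and the linear terms towards `x` and `y`
cancel. -/
theorem midpoint_le_of_sub_le_inner {β : H → H} {P : H → ℝ}
    (hP : ∀ x y, P x - P y ≤ inner ℝ (β x) (x - y)) (x y : H) :
    P ((1 / 2 : ℝ) • (x + y)) ≤ (P x + P y) / 2 := by
  set z := (1 / 2 : ℝ) • (x + y)
  have h1 := hP z x
  have h2 := hP z y
  have h3 : (z - x) + (z - y) = 0 := by simp only [z]; module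
  have h4 : inner ℝ (β z) (z - x) + inner ℝ (β z) (z - y) = 0 := by
    rw [← inner_add_right, h3, inner_zero_right]
  linarith

/-- The energy whose minimizers solve `β(ϑ) + h L ϑ = g`. -/
noncomputable def energy (P : H → ℝ) (h : ℝ) (g : H) (a : H × Y) : ℝ :=
  P a.1 + h / 2 * ‖a.2‖ ^ 2 - inner ℝ g a.1

/-- The parallelogram law gives a convexity gap in the second component only. It is what makes
minimizing sequences Cauchy there without any weak compactness. -/
theorem energy_midpoint_le {β : H → H} {P : H → ℝ}
    (hP : ∀ x y, P x - P y ≤ inner ℝ (β x) (x - y)) (h : ℝ) (g : H) (a b : H × Y) :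
    energy P h g ((1 / 2 : ℝ) • (a + b)) + h / 8 * ‖a.2 - b.2‖ ^ 2
      ≤ (energy P h g a + energy P h g b) / 2 := by
  have h1 := midpoint_le_of_sub_le_inner hP a.1 b.1
  have h2 := parallelogram_law_with_norm ℝ a.2 b.2
  have h3 : ‖(1 / 2 : ℝ) • (a.2 + b.2)‖ ^ 2 = ‖a.2 + b.2‖ ^ 2 / 4 := by
    rw [norm_smul, mul_pow]; norm_num; ring
  simp only [energy, Prod.smul_fst, Prod.smul_snd, Prod.fst_add, Prod.snd_add, inner_smul_right,
    inner_add_right, h3]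
  have h4 : ‖a.2 - b.2‖ ^ 2 = 2 * (‖a.2‖ ^ 2 + ‖b.2‖ ^ 2) - ‖a.2 + b.2‖ ^ 2 := by
    nlinarith
  rw [h4]
  nlinarith

/-- Direct method: the Poincaré inequality `hC` bounds the energy below and transfers the Cauchy
property from the second component to the first. The minimizer satisfies the Euler–Lagrange equation
because `β` is a continuous subgradient of `P`. -/
theorem exists_resolvent [CompleteSpace H] [CompleteSpace Y] {V : Submodule ℝ (H × Y)}
    (hV : IsClosed (V : Set (H × Y))) {C : ℝ} (hC : ∀ a ∈ V, ‖a.1‖ ≤ C * ‖a.2‖)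
    {β : H → H} (hβ : Continuous β) {P : H → ℝ} (hP0 : ∀ x, 0 ≤ P x)
    (hP : ∀ x y, P x - P y ≤ inner ℝ (β x) (x - y)) {h : ℝ} (hh : 0 < h) (g : H) :
    ∃ ϑ ∈ V, ∀ ψ ∈ V,
      inner ℝ (β ϑ.1) ψ.1 + h * inner ℝ ϑ.2 ψ.2 = inner ℝ g ψ.1 := by
  set J : H × Y → ℝ := energy P h g with hJ
  have hPc := continuous_of_sub_le_inner hβ hP
  have hJc : Continuous J := by
    rw [hJ]; unfold energy; fun_prop
  have hbdd : BddBelow (J '' V) := by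
    -- The minimum over `y` of `h / 2 * y ^ 2 - ‖g‖ * C * y`.
    refine ⟨-(‖g‖ * C) ^ 2 / (2 * h), ?_⟩
    rintro _ ⟨a, ha, rfl⟩
    have h1 := hC a ha
    have h2 : inner ℝ g a.1 ≤ ‖g‖ * (C * ‖a.2‖) :=
      (real_inner_le_norm _ _).trans (mul_le_mul_of_nonneg_left h1 (norm_nonneg _))
    have h3 := hP0 a.1
    have h4 : J a = P a.1 + h / 2 * ‖a.2‖ ^ 2 - inner ℝ g a.1 := rfl
    rw [h4, div_le_iff₀ (by positivity)]
    nlinarith [sq_nonneg (h * ‖a.2‖ - ‖g‖ * C), mul_nonneg hh.le h3,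
      mul_nonneg hh.le (sub_nonneg.2 h2)]
  have hne : (J '' V).Nonempty := ⟨J 0, 0, V.zero_mem, rfl⟩
  set c := sInf (J '' V) with hc
  have hcl : ∀ a ∈ V, c ≤ J a := fun a ha => csInf_le hbdd ⟨a, ha, rfl⟩
  have hex : ∀ k : ℕ, ∃ a ∈ V, J a < c + 1 / ((k : ℝ) + 1) := by
    intro k
    obtain ⟨_, ⟨a, ha, rfl⟩, h1⟩ := exists_lt_of_csInf_lt hne
      (show sInf (J '' V) < c + 1 / ((k : ℝ) + 1) by
        have : (0 : ℝ) < 1 / ((k : ℝ) + 1) := by positivity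
        linarith)
    exact ⟨a, ha, h1⟩
  choose a haV ha using hex
  have hdiff : ∀ x ∈ V, ∀ y ∈ V, h / 8 * ‖x.2 - y.2‖ ^ 2 ≤ (J x + J y) / 2 - c := by
    intro x hx y hy
    have h1 := energy_midpoint_le hP h g x y
    have h2 := hcl _ (V.smul_mem (1 / 2 : ℝ) (V.add_mem hx hy))
    simp only [hJ] at h2 ⊢
    linarith
  have hCa : CauchySeq a := by
    rw [Metric.cauchySeq_iff']
    intro δ hδ
    -- With second components closer than `δ / (|C| + 1)`, `hC` keeps the first components closer
    -- than `δ` as well.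
    obtain ⟨N, hN⟩ := exists_nat_one_div_lt
      (show 0 < h / 8 * (δ / (|C| + 1)) ^ 2 by positivity)
    refine ⟨N, fun k hk => ?_⟩
    have h1 := hdiff _ (haV k) _ (haV N)
    have h2 : (1 : ℝ) / ((k : ℝ) + 1) ≤ 1 / ((N : ℝ) + 1) := by
      gcongr
    have h3 : h / 8 * ‖(a k).2 - (a N).2‖ ^ 2 < h / 8 * (δ / (|C| + 1)) ^ 2 := by
      have := ha k; have := ha N; linarith
    have h4 : ‖(a k).2 - (a N).2‖ < δ / (|C| + 1) :=
      lt_of_pow_lt_pow_left₀ 2 (by positivity) (lt_of_mul_lt_mul_left h3 (by positivity))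
    have h5 := hC _ (V.sub_mem (haV k) (haV N))
    simp only [Prod.fst_sub, Prod.snd_sub] at h5
    rw [lt_div_iff₀ (by positivity)] at h4
    have h6 := norm_nonneg ((a k).2 - (a N).2)
    have h7 := le_abs_self C
    have h8 := abs_nonneg C
    rw [dist_eq_norm, Prod.norm_def, Prod.fst_sub, Prod.snd_sub]
    refine max_lt ?_ ?_ <;> nlinarith
  obtain ⟨ϑ, hϑ⟩ := cauchySeq_tendsto_of_complete hCa
  have hϑV : ϑ ∈ V := hV.mem_of_tendsto hϑ (Eventually.of_forall haV)
  have hϑc : J ϑ ≤ c := by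
    refine le_of_tendsto_of_tendsto ((hJc.tendsto ϑ).comp hϑ)
      (g := fun k : ℕ => c + 1 / ((k : ℝ) + 1)) ?_ (Eventually.of_forall fun k => (ha k).le)
    simpa using tendsto_one_div_add_atTop_nhds_zero_nat.const_add c
  have key : ∀ ψ ∈ V, 0 ≤ inner ℝ (β ϑ.1) ψ.1 + h * inner ℝ ϑ.2 ψ.2 - inner ℝ g ψ.1 := by
    intro ψ hψ
    -- One-sided variation: the increment of `P` is bounded by the subgradient at the perturbed
    -- point, so after division by `t` continuity of `β` replaces differentiability of `P`.
    have hlim : Tendsto (fun t : ℝ => inner ℝ (β (ϑ.1 + t • ψ.1)) ψ.1 + h * inner ℝ ϑ.2 ψ.2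
        + t * (h / 2 * ‖ψ.2‖ ^ 2) - inner ℝ g ψ.1) (𝓝[>] 0)
        (𝓝 (inner ℝ (β ϑ.1) ψ.1 + h * inner ℝ ϑ.2 ψ.2 - inner ℝ g ψ.1)) := by
      have : ContinuousAt (fun t : ℝ => inner ℝ (β (ϑ.1 + t • ψ.1)) ψ.1 + h * inner ℝ ϑ.2 ψ.2
        + t * (h / 2 * ‖ψ.2‖ ^ 2) - inner ℝ g ψ.1) 0 := by fun_prop
      have := this.tendsto.mono_left (nhdsWithin_le_nhds (s := Ioi 0))
      simpa using this
    refine ge_of_tendsto hlim ?_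
    filter_upwards [self_mem_nhdsWithin] with t ht
    have ht : 0 < t := ht
    have h1 := hϑc.trans (hcl _ (V.add_mem hϑV (V.smul_mem t hψ)))
    have h2 := hP (ϑ.1 + t • ψ.1) ϑ.1
    simp only [hJ, energy, Prod.fst_add, Prod.snd_add, Prod.smul_fst, Prod.smul_snd,
      inner_add_right, inner_smul_right, norm_add_sq_real, norm_smul, mul_pow,
      Real.norm_eq_abs, sq_abs] at h1
    rw [add_sub_cancel_left, inner_smul_right] at h2
    have h3 : 0 ≤ t * (inner ℝ (β (ϑ.1 + t • ψ.1)) ψ.1 + h * inner ℝ ϑ.2 ψ.2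
        + t * (h / 2 * ‖ψ.2‖ ^ 2) - inner ℝ g ψ.1) := by nlinarith
    exact nonneg_of_mul_nonneg_right h3 ht
  refine ⟨ϑ, hϑV, fun ψ hψ => ?_⟩
  have h1 := key ψ hψ
  have h2 := key (-ψ) (V.neg_mem hψ)
  simp only [Prod.fst_neg, Prod.snd_neg, inner_neg_right] at h2
  linarith

/-- Error estimate for the implicit Euler scheme `z`, in the norm dual to the energy norm, against
a sequence `x` which satisfies the scheme up to consistency errors. -/
theorem implicit_euler_error {V : Submodule ℝ (H × Y)} {β : H → H}
    (hβ : ∀ x y, 0 ≤ inner ℝ (β x - β y) (x - y)) {x z f : ℕ → H} {a ϑ : ℕ → H × Y} {I : ℕ → Y}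
    {h : ℕ → ℝ} (h0 : x 0 = z 0) (n : ℕ) (hh : ∀ k < n, 0 ≤ h k)
    (hx : ∀ k < n, a (k + 1) ∈ V ∧ x (k + 1) = β (a (k + 1)).1 ∧ ∀ ψ ∈ V,
      inner ℝ (x (k + 1) - x k) ψ.1 + inner ℝ (I k) ψ.2 = inner ℝ (f k) ψ.1)
    (hz : ∀ k < n, ϑ (k + 1) ∈ V ∧ z (k + 1) = β (ϑ (k + 1)).1 ∧ ∀ ψ ∈ V,
      inner ℝ (z (k + 1) - z k) ψ.1 + h k * inner ℝ (ϑ (k + 1)).2 ψ.2 = inner ℝ (f k) ψ.1) :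
    ∃ E : Y, ‖E‖ ≤ ∑ k ∈ Finset.range n, ‖I k - h k • (a (k + 1)).2‖ ∧
      ∀ ψ ∈ V, inner ℝ E ψ.2 = inner ℝ (z n - x n) ψ.1 := by
  induction n with
  | zero => exact ⟨0, by simp, fun ψ _ => by simp [h0]⟩
  | succ n ih =>
    obtain ⟨E, hE, hEV⟩ := ih (fun k hk => hh k (by omega)) (fun k hk => hx k (by omega))
      (fun k hk => hz k (by omega))
    obtain ⟨haV, hxβ, hxe⟩ := hx n (by omega)
    obtain ⟨hϑV, hzβ, hze⟩ := hz n (by omega)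
    have hhn := hh n (by omega)
    -- `r` is the new consistency error; `E'` represents the functional `z - x` at the next index.
    set r := I n - h n • (a (n + 1)).2 with hr
    set E' := E + I n - h n • (ϑ (n + 1)).2 with hE'
    have hEV' : ∀ ψ ∈ V, inner ℝ E' ψ.2 = inner ℝ (z (n + 1) - x (n + 1)) ψ.1 := by
      intro ψ hψ
      have h1 := hEV ψ hψ
      have h2 := hxe ψ hψ
      have h3 := hze ψ hψ
      simp only [hE', inner_add_left, inner_sub_left, real_inner_smul_left] at *
      linarith
    refine ⟨E', ?_, hEV'⟩
    have hdec : E' = E + r + h n • (a (n + 1) - ϑ (n + 1)).2 := by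
      rw [hE', hr, Prod.snd_sub]; module
    -- Tested with `a - ϑ`, the functional `E'` is minus the monotonicity pairing of `β`. So the
    -- implicit term has the good sign, and the error norm grows by at most `‖r‖`.
    have hmono : h n * inner ℝ E' (a (n + 1) - ϑ (n + 1)).2 ≤ 0 := by
      rw [hEV' _ (V.sub_mem haV hϑV), hzβ, hxβ, Prod.fst_sub]
      have := hβ (a (n + 1)).1 (ϑ (n + 1)).1
      rw [← neg_sub, inner_neg_left]
      nlinarith
    have hsq : ‖E'‖ * ‖E'‖ ≤ ‖E'‖ * ‖E + r‖ := by
      calc ‖E'‖ * ‖E'‖ = inner ℝ E' E' := (real_inner_self_eq_norm_mul_norm E').symm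
        _ = inner ℝ E' (E + r) + h n * inner ℝ E' (a (n + 1) - ϑ (n + 1)).2 := by
          rw [← real_inner_smul_right, ← inner_add_right, ← hdec]
        _ ≤ inner ℝ E' (E + r) := by linarith
        _ ≤ ‖E'‖ * ‖E + r‖ := real_inner_le_norm _ _
    have hle : ‖E'‖ ≤ ‖E + r‖ := by
      rcases (norm_nonneg E').eq_or_lt with h | h
      · rw [← h]; positivity
      · exact le_of_mul_le_mul_left hsq h
    rw [Finset.sum_range_succ]
    exact hle.trans ((norm_add_le _ _).trans (by gcongr))

end Hilbert


/-! ### Riemann sums of vector-valued integrable functions -/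

section Grid

variable {E : Type*} [NormedAddCommGroup E]

/-- Continuity of the translation action on `L¹`, evaluated at the zero shift. -/
theorem tendsto_lintegral_translate_sub {g : ℝ → E} (hg : Integrable g) :
    Tendsto (fun a : ℝ => ∫⁻ t, ‖g (a + t) - g t‖ₑ) (𝓝 0) (𝓝 0) := by
  have hg1 : MemLp g 1 volume := memLp_one_iff_integrable.2 hg
  have : Fact ((1 : ℝ≥0∞) ≠ ⊤) := ⟨ENNReal.one_ne_top⟩
  have hc : Tendsto (fun a : ℝ => edist (DomAddAct.mk a +ᵥ hg1.toLp g) (hg1.toLp g)) (𝓝 0)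
      (𝓝 0) := by
    have h1 : Continuous fun a : ℝ => edist (DomAddAct.mk a +ᵥ hg1.toLp g) (hg1.toLp g) := by
      have h2 : Continuous fun a : ℝ => (DomAddAct.mk a : ℝᵈᵃᵃ) := DomAddAct.continuous_mk
      have h3 : Continuous fun a : ℝ => DomAddAct.mk a +ᵥ hg1.toLp g := h2.vadd continuous_const
      exact h3.edist continuous_const
    have h2 := h1.tendsto 0
    simpa using h2
  refine hc.congr fun a => ?_
  rw [DomAddAct.mk_vadd_toLp, Lp.edist_toLp_toLp, eLpNorm_one_eq_lintegral_enorm]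
  rfl

theorem lintegral_Ioc_eq_translate (F : ℝ → ℝ≥0∞) (t h : ℝ) :
    ∫⁻ τ in Ioc (t - h) t, F τ = ∫⁻ a in Ioc (-h) 0, F (a + t) := by
  rw [← lintegral_indicator measurableSet_Ioc, ← lintegral_indicator measurableSet_Ioc,
    ← lintegral_add_right_eq_self _ t]
  congr 1
  ext a
  simp only [indicator, mem_Ioc]
  congr 1
  simp only [eq_iff_iff]
  constructor <;> rintro ⟨h1, h2⟩ <;> constructor <;> linarith

/-- The oscillation of `g` from the right end points of the grid `t - j h`. -/
noncomputable def gridOsc (g : ℝ → E) (h : ℝ) (J : ℕ) (t : ℝ) : ℝ≥0∞ :=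
  ∑ j ∈ Finset.range J, ∫⁻ a in Ioc (-h) 0, ‖g (a + (t - j * h)) - g (t - j * h)‖ₑ

theorem measurable_enorm_translate_sub {g : ℝ → E} (hg : StronglyMeasurable g) (c : ℝ) :
    Measurable fun p : ℝ × ℝ => ‖g (p.2 + (p.1 - c)) - g (p.1 - c)‖ₑ := by
  have h1 : StronglyMeasurable fun p : ℝ × ℝ => g (p.2 + (p.1 - c)) :=
    hg.comp_measurable (by fun_prop)
  have h2 : StronglyMeasurable fun p : ℝ × ℝ => g (p.1 - c) := hg.comp_measurable (by fun_prop)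
  exact (h1.sub h2).enorm

theorem measurable_gridOsc {g : ℝ → E} (hg : StronglyMeasurable g) (h : ℝ) (J : ℕ) :
    Measurable (gridOsc g h J) := by
  unfold gridOsc
  refine Finset.measurable_sum _ fun j _ => ?_
  exact (measurable_enorm_translate_sub hg _).lintegral_prod_right'

/-- Averaging over the final point `t`: by Tonelli and translation invariance every grid point
contributes the same amount. -/
theorem lintegral_gridOsc {g : ℝ → E} (hg : StronglyMeasurable g) (h : ℝ) (J : ℕ) :
    ∫⁻ t, gridOsc g h J t = J * ∫⁻ a in Ioc (-h) 0, ∫⁻ t, ‖g (a + t) - g t‖ₑ := by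
  unfold gridOsc
  rw [lintegral_finsetSum _ fun j _ =>
    (measurable_enorm_translate_sub hg _).lintegral_prod_right']
  have hj : ∀ j ∈ Finset.range J,
      ∫⁻ t, ∫⁻ a in Ioc (-h) 0, ‖g (a + (t - j * h)) - g (t - j * h)‖ₑ
        = ∫⁻ a in Ioc (-h) 0, ∫⁻ t, ‖g (a + t) - g t‖ₑ := by
    intro j _
    rw [lintegral_lintegral_swap (measurable_enorm_translate_sub hg _).aemeasurable]
    refine lintegral_congr fun a => ?_
    exact lintegral_sub_right_eq_self (fun t => ‖g (a + t) - g t‖ₑ) _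
  rw [Finset.sum_congr rfl hj]
  simp

theorem tendsto_lintegral_gridOsc {g : ℝ → E} (hg : StronglyMeasurable g) (hgi : Integrable g)
    {T : ℝ} (hT : 0 < T) :
    Tendsto (fun i : ℕ => ∫⁻ t, gridOsc g (T / ((i : ℝ) + 1)) (i + 1) t) atTop (𝓝 0) := by
  rw [ENNReal.tendsto_nhds_zero]
  intro ε hε
  -- There are `i + 1` cells of length `h = T / (i + 1)`, so a translation error below `ε / T` adds
  -- up to at most `ε`.
  have hε' : 0 < ε / ENNReal.ofReal T := ENNReal.div_pos hε.ne' ENNReal.ofReal_ne_top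
  have h1 := (ENNReal.tendsto_nhds_zero.1 (tendsto_lintegral_translate_sub hgi)) _ hε'
  obtain ⟨δ, hδ, h2⟩ := Metric.eventually_nhds_iff.1 h1
  have h3 : Tendsto (fun i : ℕ => T / ((i : ℝ) + 1)) atTop (𝓝 0) := by
    simpa [div_eq_mul_inv] using tendsto_one_div_add_atTop_nhds_zero_nat.const_mul T
  filter_upwards [h3.eventually (gt_mem_nhds hδ)] with i hi
  rw [lintegral_gridOsc hg]
  set h := T / ((i : ℝ) + 1) with hh
  have hpos : 0 < h := by positivity
  calc ((i + 1 : ℕ) : ℝ≥0∞) * ∫⁻ a in Ioc (-h) 0, ∫⁻ t, ‖g (a + t) - g t‖ₑ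
      ≤ ((i + 1 : ℕ) : ℝ≥0∞) * ∫⁻ a in Ioc (-h) 0, ε / ENNReal.ofReal T := by
        refine mul_le_mul_right ?_ _
        refine setLIntegral_mono measurable_const fun a ha => h2 ?_
        rw [Real.dist_eq, sub_zero, abs_of_nonpos ha.2]
        linarith [ha.1]
    _ = ENNReal.ofReal T * (ε / ENNReal.ofReal T) := by
        rw [lintegral_const, Measure.restrict_apply_univ, Real.volume_Ioc,
          mul_comm (ε / _), ← mul_assoc]
        congr 1
        rw [← ENNReal.ofReal_natCast, ← ENNReal.ofReal_mul (by positivity)]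
        congr 1
        rw [hh]; push_cast; field_simp; ring
    _ ≤ ε := ENNReal.mul_div_le

/-- The grids are anchored at their final point `t₀`. The oscillation averaged over `t₀` tends to
zero, so by Fatou its liminf vanishes for a.e. `t₀`. Only countably many translates `t₀ - j h`
occur, so for a.e. `t₀` all of them avoid the exceptional null set of `p`. -/
theorem exists_grid {g : ℝ → E} (hg : StronglyMeasurable g) (hgi : Integrable g) {p : ℝ → Prop}
    (hp : ∀ᵐ t, p t) {T : ℝ} (hT : 0 < T) :
    ∀ᵐ t₀ ∂(volume.restrict (Ioo 0 T)), ∀ ε : ℝ≥0∞, 0 < ε → ∃ (n : ℕ) (t : ℕ → ℝ),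
      0 < n ∧ t 0 = 0 ∧ t n = t₀ ∧
      (∀ k < n, t k < t (k + 1) ∧ t (k + 1) ∈ Ioc 0 t₀ ∧ p (t (k + 1))) ∧
      ∑ k ∈ Finset.range n, ∫⁻ τ in Ioc (t k) (t (k + 1)), ‖g τ - g (t (k + 1))‖ₑ < ε := by
  have h1 : ∀ᵐ t₀, liminf (fun i : ℕ => gridOsc g (T / ((i : ℝ) + 1)) (i + 1) t₀) atTop = 0 := by
    have hm : Measurable fun t₀ =>
        liminf (fun i : ℕ => gridOsc g (T / ((i : ℝ) + 1)) (i + 1) t₀) atTop :=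
      Measurable.liminf fun i => measurable_gridOsc hg _ _
    refine (lintegral_eq_zero_iff hm).1 (le_antisymm ?_ zero_le)
    refine (lintegral_liminf_le fun i => measurable_gridOsc hg _ _).trans ?_
    rw [(tendsto_lintegral_gridOsc hg hgi hT).liminf_eq]
  have h2 : ∀ᵐ t₀ : ℝ, ∀ i j : ℕ, p (t₀ - j * (T / ((i : ℝ) + 1))) := by
    rw [ae_all_iff]; intro i
    rw [ae_all_iff]; intro j
    exact (measurePreserving_sub_right volume _).quasiMeasurePreserving.ae hp
  rw [ae_restrict_iff' measurableSet_Ioo]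
  filter_upwards [h1, h2] with t₀ h1 h2 ht₀ ε hε
  obtain ⟨i, hi⟩ := (frequently_lt_of_liminf_lt (u := fun i : ℕ =>
    gridOsc g (T / ((i : ℝ) + 1)) (i + 1) t₀) (f := atTop) (by isBoundedDefault)
      (h1 ▸ hε)).exists
  set h := T / ((i : ℝ) + 1) with hh
  have hpos : 0 < h := by positivity
  -- The number of cells needed to go back from `t₀` to a point at or before `0`; it is at most `i +
  -- 1` because `t₀ < T`.
  set n := ⌈t₀ / h⌉₊ with hn
  have hn0 : 0 < n := Nat.ceil_pos.2 (div_pos ht₀.1 hpos)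
  have hn1 : t₀ ≤ n * h := (div_le_iff₀ hpos).1 (Nat.le_ceil _)
  have hn2 : ((n : ℝ) - 1) * h < t₀ := by
    have := Nat.ceil_lt_add_one (div_pos ht₀.1 hpos).le
    rw [← lt_div_iff₀ hpos]; linarith
  have hni : n ≤ i + 1 := by
    refine Nat.ceil_le.2 ?_
    rw [div_le_iff₀ hpos, hh]; push_cast
    rw [mul_div_cancel₀ _ (by positivity)]
    exact ht₀.2.le
  -- The first cell is truncated at `0`. This only shrinks its domain of integration, since the
  -- oscillation is measured from right end points.
  refine ⟨n, fun k => if k = 0 then 0 else t₀ - ((n : ℝ) - k) * h, hn0, by simp, ?_, ?_, ?_⟩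
  · simp [hn0.ne']
  · intro k hk
    have hk' : ((k : ℝ) + 1) ≤ n := by exact_mod_cast hk
    have hk0 : (0 : ℝ) ≤ k := by positivity
    simp only [Nat.add_eq_zero_iff, one_ne_zero, and_false, if_false]
    push_cast
    refine ⟨?_, ⟨?_, ?_⟩, ?_⟩
    · split_ifs with h0
      · subst h0; push_cast; linarith
      · nlinarith
    · nlinarith
    · nlinarith
    · have := h2 i (n - 1 - k)
      rwa [Nat.cast_sub (by omega), Nat.cast_sub (by omega), ← hh,
        show ((n : ℝ) - (1 : ℕ) - k) * h = (n - (k + 1)) * h by push_cast; ring] at this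
  · refine lt_of_le_of_lt ?_ hi
    unfold gridOsc
    calc _ ≤ ∑ k ∈ Finset.range n, ∫⁻ a in Ioc (-h) 0,
          ‖g (a + (t₀ - (n - 1 - k : ℕ) * h)) - g (t₀ - (n - 1 - k : ℕ) * h)‖ₑ := by
          refine Finset.sum_le_sum fun k hk => ?_
          have hk := Finset.mem_range.1 hk
          have e1 : t₀ - ((n : ℝ) - ((k + 1 : ℕ) : ℝ)) * h = t₀ - (n - 1 - k : ℕ) * h := by
            rw [Nat.cast_sub (by omega), Nat.cast_sub (by omega)]; push_cast; ring
          simp only [Nat.add_eq_zero_iff, one_ne_zero, and_false, if_false]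
          rw [e1]
          rw [← lintegral_Ioc_eq_translate
            (fun τ => ‖g τ - g (t₀ - (n - 1 - k : ℕ) * h)‖ₑ)]
          refine lintegral_mono_set (Ioc_subset_Ioc ?_ le_rfl)
          rw [← e1]; push_cast
          split_ifs with h0
          · subst h0; push_cast; linarith
          · linarith
      _ = ∑ k ∈ Finset.range n, ∫⁻ a in Ioc (-h) 0,
          ‖g (a + (t₀ - k * h)) - g (t₀ - k * h)‖ₑ :=
          Finset.sum_range_reflect (fun k => ∫⁻ a in Ioc (-h) 0,
          ‖g (a + (t₀ - k * h)) - g (t₀ - k * h)‖ₑ) n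
      _ ≤ _ := Finset.sum_le_sum_of_subset (Finset.range_mono hni)

end Grid


/-! ### The nonlinearity and the positive part on `L²` -/

section Nonlinearity

/-- A nondecreasing nonlinearity `β` with `β 0 = 0`, a modulus of continuity which is affine up to
arbitrarily small constants, and a nonnegative primitive `j`. -/
structure IsNonlinearity (β j : ℝ → ℝ) : Prop where
  mono : Monotone β
  zero : β 0 = 0
  modulus : ∀ δ : ℝ, 0 < δ → ∃ C : ℝ, 0 ≤ C ∧ ∀ a b, |β a - β b| ≤ δ + C * |a - b|
  measurable_prim : Measurable j
  prim_nonneg : ∀ a, 0 ≤ j a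
  prim_zero : j 0 = 0
  prim_sub_le : ∀ a b, j a - j b ≤ β a * (a - b)

variable {α : Type*} [MeasurableSpace α] {μ : Measure α} {β j : ℝ → ℝ}

theorem inner_eq_integral (f g : Lp ℝ 2 μ) : inner ℝ f g = ∫ x, f x * g x ∂μ := by
  rw [L2.inner_def]
  refine integral_congr_ae (Eventually.of_forall fun x => ?_)
  simp [mul_comm]

theorem integrable_mul_Lp (f g : Lp ℝ 2 μ) : Integrable (fun x => f x * g x) μ :=
  MemLp.integrable_mul (Lp.memLp f) (Lp.memLp g)

theorem ofReal_integral_le {γ : Type*} [MeasurableSpace γ] {ν : Measure γ} (f : γ → ℝ) :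
    ENNReal.ofReal (∫ x, f x ∂ν) ≤ ∫⁻ x, ENNReal.ofReal (f x) ∂ν := by
  by_cases hf : Integrable f ν
  · have h1 : ∫ x, f x ∂ν ≤ ∫ x, max (f x) 0 ∂ν :=
      integral_mono hf hf.pos_part fun x => le_max_left _ _
    refine (ENNReal.ofReal_le_ofReal h1).trans ?_
    rw [ofReal_integral_eq_lintegral_ofReal hf.pos_part
      (Eventually.of_forall fun x => le_max_right _ _)]
    refine lintegral_mono fun x => ?_
    simp [ENNReal.ofReal_max]
  -- Without integrability the integral has the default value `0`.
  · simp [integral_undef hf]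

/-- `∫ f₊`. -/
noncomputable def posL1 (f : Lp ℝ 2 μ) : ℝ≥0∞ := ∫⁻ x, ENNReal.ofReal (f x) ∂μ

theorem posL1_add_le (f g : Lp ℝ 2 μ) : posL1 (f + g) ≤ posL1 f + posL1 g := by
  unfold posL1
  rw [← lintegral_add_left' (Lp.aestronglyMeasurable f).aemeasurable.ennreal_ofReal]
  refine lintegral_mono_ae ?_
  filter_upwards [Lp.coeFn_add f g] with x hx
  rw [hx]
  exact ENNReal.ofReal_add_le

theorem ofReal_inner_le_posL1 (f ζ : Lp ℝ 2 μ) (hζ : ∀ᵐ x ∂μ, 0 ≤ ζ x ∧ ζ x ≤ 1) :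
    ENNReal.ofReal (inner ℝ f ζ) ≤ posL1 f := by
  rw [inner_eq_integral]
  refine (ofReal_integral_le _).trans (lintegral_mono_ae ?_)
  filter_upwards [hζ] with x hx
  rcases le_total (f x) 0 with h | h
  · rw [ENNReal.ofReal_of_nonpos (mul_nonpos_of_nonpos_of_nonneg h hx.1)]
    exact zero_le
  · exact ENNReal.ofReal_le_ofReal (mul_le_of_le_one_right h hx.2)

variable [IsFiniteMeasure μ]

theorem IsNonlinearity.memLp_comp (hβ : IsNonlinearity β j) {f : α → ℝ} (hf : MemLp f 2 μ) :
    MemLp (fun x => β (f x)) 2 μ := by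
  obtain ⟨C, hC, h⟩ := hβ.modulus 1 one_pos
  have h1 : MemLp (fun x => 1 + C * |f x|) 2 μ :=
    (memLp_const (1 : ℝ)).add (hf.norm.const_mul C)
  refine h1.of_le (hβ.mono.measurable.comp_aemeasurable hf.1.aemeasurable).aestronglyMeasurable
    (Eventually.of_forall fun x => ?_)
  have := h (f x) 0
  rw [hβ.zero, sub_zero, sub_zero] at this
  rw [Real.norm_eq_abs, Real.norm_eq_abs]
  exact this.trans (le_abs_self _)

/-- The superposition operator of `β` on `L²`. -/
noncomputable def superpose (hβ : IsNonlinearity β j) (f : Lp ℝ 2 μ) : Lp ℝ 2 μ :=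
  (hβ.memLp_comp (Lp.memLp f)).toLp _

theorem coeFn_superpose (hβ : IsNonlinearity β j) (f : Lp ℝ 2 μ) :
    superpose hβ f =ᵐ[μ] fun x => β (f x) :=
  MemLp.coeFn_toLp _

theorem superpose_monotone (hβ : IsNonlinearity β j) (f g : Lp ℝ 2 μ) :
    0 ≤ inner ℝ (superpose hβ f - superpose hβ g) (f - g) := by
  rw [inner_eq_integral]
  refine integral_nonneg_of_ae ?_
  filter_upwards [Lp.coeFn_sub (superpose hβ f) (superpose hβ g), Lp.coeFn_sub f g,
    coeFn_superpose hβ f, coeFn_superpose hβ g] with x h1 h2 h3 h4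
  rw [h1, h2, Pi.sub_apply, Pi.sub_apply, h3, h4, Pi.zero_apply]
  rcases le_total (f x) (g x) with h | h
  · exact mul_nonneg_of_nonpos_of_nonpos (sub_nonpos.2 (hβ.mono h)) (sub_nonpos.2 h)
  · exact mul_nonneg (sub_nonneg.2 (hβ.mono h)) (sub_nonneg.2 h)

/-- For `β = Φ^{1/m}` there is no Lipschitz bound. The affine modulus suffices: on a finite measure
space its constant term has small `L²` norm, at most `ε / 2` for the chosen `δ`. -/
theorem continuous_superpose (hβ : IsNonlinearity β j) :
    Continuous (superpose hβ : Lp ℝ 2 μ → Lp ℝ 2 μ) := by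
  rw [Metric.continuous_iff]
  intro f ε hε
  set κ := ‖Lp.const 2 μ (1 : ℝ)‖ with hκ
  have hκ0 : 0 ≤ κ := norm_nonneg _
  obtain ⟨C, hC, h⟩ := hβ.modulus (ε / (2 * (κ + 1))) (by positivity)
  refine ⟨ε / (2 * (C + 1)), by positivity, fun g hg => ?_⟩
  rw [dist_eq_norm] at hg ⊢
  have h1 : ‖superpose hβ g - superpose hβ f‖ ≤
      ‖Lp.const 2 μ (ε / (2 * (κ + 1)))‖ + C * ‖g - f‖ := by
    calc _ ≤ ‖Lp.const 2 μ (ε / (2 * (κ + 1))) + C • |g - f|‖ := by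
          refine Lp.norm_le_norm_of_ae_le ?_
          filter_upwards [Lp.coeFn_sub (superpose hβ g) (superpose hβ f), Lp.coeFn_sub g f,
            coeFn_superpose hβ f, coeFn_superpose hβ g,
            Lp.coeFn_add (Lp.const 2 μ (ε / (2 * (κ + 1)))) (C • |g - f|),
            Lp.coeFn_smul C |g - f|, Lp.coeFn_abs (g - f),
            Lp.coeFn_const (μ := μ) (p := 2) (ε / (2 * (κ + 1)))] with x e1 e2 e3 e4 e5 e6 e7 e8
          rw [e1, e5, Pi.sub_apply, Pi.add_apply, e3, e4, e6, e8, Pi.smul_apply, e7, e2,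
            Pi.sub_apply, Real.norm_eq_abs, Real.norm_eq_abs]
          exact (h (g x) (f x)).trans (le_abs_self _)
      _ ≤ _ := by
          refine (norm_add_le _ _).trans ?_
          rw [norm_smul, norm_abs_eq_norm, Real.norm_eq_abs, abs_of_nonneg hC]
  have h2 : ‖Lp.const 2 μ (ε / (2 * (κ + 1)))‖ = ε / (2 * (κ + 1)) * κ := by
    have : Lp.const 2 μ (ε / (2 * (κ + 1))) = (ε / (2 * (κ + 1))) • Lp.const 2 μ (1 : ℝ) := by
      have := (Lp.constₗ 2 μ ℝ (E := ℝ)).map_smul (ε / (2 * (κ + 1))) 1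
      simpa using this
    rw [this, norm_smul, Real.norm_eq_abs, abs_of_nonneg (by positivity)]
  have h3 : ε / (2 * (κ + 1)) * κ ≤ ε / 2 := by
    rw [div_mul_eq_mul_div, div_le_div_iff₀ (by positivity) (by positivity)]
    nlinarith
  have h4 : C * ‖g - f‖ < ε / 2 := by
    rw [lt_div_iff₀ (by positivity)] at hg
    nlinarith [norm_nonneg (g - f)]
  linarith

/-- The subgradient inequality at `b = 0` gives `0 ≤ j(a) ≤ β(a) a`, a product of two `L²`
functions. -/
theorem IsNonlinearity.integrable_prim (hβ : IsNonlinearity β j) (f : Lp ℝ 2 μ) :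
    Integrable (fun x => j (f x)) μ := by
  refine Integrable.mono' (integrable_mul_Lp (superpose hβ f) f)
    (hβ.measurable_prim.comp_aemeasurable
      (Lp.aestronglyMeasurable f).aemeasurable).aestronglyMeasurable ?_
  filter_upwards [coeFn_superpose hβ f] with x hx
  rw [hx, Real.norm_eq_abs, abs_of_nonneg (hβ.prim_nonneg _)]
  simpa [hβ.prim_zero] using hβ.prim_sub_le (f x) 0

theorem integral_prim_sub_le (hβ : IsNonlinearity β j) (f g : Lp ℝ 2 μ) :
    (∫ x, j (f x) ∂μ) - ∫ x, j (g x) ∂μ ≤ inner ℝ (superpose hβ f) (f - g) := by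
  rw [← integral_sub (hβ.integrable_prim f) (hβ.integrable_prim g), inner_eq_integral]
  refine integral_mono_ae ((hβ.integrable_prim f).sub (hβ.integrable_prim g))
    (integrable_mul_Lp _ _) ?_
  filter_upwards [coeFn_superpose hβ f, Lp.coeFn_sub f g] with x h1 h2
  rw [h1, h2]
  exact hβ.prim_sub_le _ _

/-- Take `ζ` to be the indicator of `{f > 0}`. Representing `∫ f₊` by a pairing reduces Jensen's
inequality for vector-valued integrals to the scalar case. -/
theorem exists_inner_eq_posL1 (f : Lp ℝ 2 μ) : ∃ ζ : Lp ℝ 2 μ,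
    (∀ᵐ x ∂μ, 0 ≤ ζ x ∧ ζ x ≤ 1) ∧ posL1 f = ENNReal.ofReal (inner ℝ f ζ) := by
  set A : Set α := {x | 0 < f x} with hA
  have hAm : MeasurableSet A :=
    measurableSet_lt measurable_const (Lp.stronglyMeasurable f).measurable
  refine ⟨indicatorConstLp 2 hAm (measure_ne_top μ A) 1, ?_, ?_⟩
  · filter_upwards [indicatorConstLp_coeFn (p := 2) (hs := hAm) (hμs := measure_ne_top μ A)
      (c := (1 : ℝ))] with x hx
    rw [hx]
    by_cases h : x ∈ A <;> simp [h]
  · rw [inner_eq_integral]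
    have h1 : (fun x => f x * (indicatorConstLp 2 hAm (measure_ne_top μ A) (1 : ℝ) : Lp ℝ 2 μ) x)
        =ᵐ[μ] fun x => max (f x) 0 := by
      filter_upwards [indicatorConstLp_coeFn (p := 2) (hs := hAm) (hμs := measure_ne_top μ A)
        (c := (1 : ℝ))] with x hx
      rw [hx]
      by_cases h : x ∈ A
      · simp only [indicator_of_mem h, mul_one]; exact (max_eq_left (le_of_lt h)).symm
      · simp only [indicator_of_notMem h, mul_zero]; exact (max_eq_right (not_lt.1 h)).symm
    rw [integral_congr_ae h1, ofReal_integral_eq_lintegral_ofReal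
      (((Lp.memLp f).integrable one_le_two).pos_part)
      (Eventually.of_forall fun x => le_max_right _ _)]
    exact lintegral_congr fun x => by simp [ENNReal.ofReal_max]

theorem posL1_setIntegral_le {F : ℝ → Lp ℝ 2 μ} {s : Set ℝ} (hF : IntegrableOn F s) :
    posL1 (∫ τ in s, F τ) ≤ ∫⁻ τ in s, posL1 (F τ) := by
  obtain ⟨ζ, hζ, h⟩ := exists_inner_eq_posL1 (∫ τ in s, F τ)
  rw [h, real_inner_comm, ← integral_inner hF]
  refine (ofReal_integral_le _).trans (lintegral_mono fun τ => ?_)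
  rw [real_inner_comm]
  exact ofReal_inner_le_posL1 _ _ hζ

theorem exists_lipschitzWith_smoothTransition : ∃ L, LipschitzWith L Real.smoothTransition := by
  have hc : Continuous (deriv Real.smoothTransition) :=
    (Real.smoothTransition.contDiff (n := 1)).continuous_deriv le_rfl
  obtain ⟨L, hL⟩ := isCompact_Icc.exists_bound_of_continuousOn (hc.continuousOn (s := Icc 0 1))
  have h1 : LipschitzOnWith L.toNNReal Real.smoothTransition (Icc 0 1) := by
    refine (convex_Icc 0 1).lipschitzOnWith_of_nnnorm_deriv_le (fun x _ =>
      (Real.smoothTransition.contDiff (n := 1)).differentiable one_ne_zero x) fun x hx => ?_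
    rw [← NNReal.coe_le_coe]
    exact (hL x hx).trans (Real.le_coe_toNNReal L)
  refine ⟨L.toNNReal * 1, ?_⟩
  -- The transition is constant on either side of `[0,1]`, so it factors through the projection onto
  -- that interval.
  have h2 := h1.to_restrict.comp (LipschitzWith.projIcc (zero_le_one (α := ℝ)))
  convert h2 using 1
  ext x
  simp [Function.comp]

/-- The smooth approximations of the positive sign. -/
noncomputable def smoothSign (k : ℕ) (r : ℝ) : ℝ := Real.smoothTransition (k * r)

theorem exists_lipschitzWith_smoothSign (k : ℕ) : ∃ L, LipschitzWith L (smoothSign k) := by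
  obtain ⟨L, hL⟩ := exists_lipschitzWith_smoothTransition
  exact ⟨_, hL.comp (lipschitzWith_smul (k : ℝ))⟩

theorem smoothSign_zero (k : ℕ) : smoothSign k 0 = 0 := by
  simp [smoothSign, Real.smoothTransition.zero]

theorem smoothSign_monotone (k : ℕ) : Monotone (smoothSign k) := fun _ _ h =>
  Real.smoothTransition.monotone (mul_le_mul_of_nonneg_left h (Nat.cast_nonneg k))

theorem contDiff_smoothSign (k : ℕ) : ContDiff ℝ ∞ (smoothSign k) :=
  Real.smoothTransition.contDiff.comp (contDiff_const.mul contDiff_id)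

theorem smoothSign_mem (k : ℕ) (r : ℝ) : 0 ≤ smoothSign k r ∧ smoothSign k r ≤ 1 :=
  ⟨Real.smoothTransition.nonneg _, Real.smoothTransition.le_one _⟩

theorem smoothSign_of_nonpos (k : ℕ) {r : ℝ} (hr : r ≤ 0) : smoothSign k r = 0 :=
  Real.smoothTransition.zero_of_nonpos (mul_nonpos_of_nonneg_of_nonpos (Nat.cast_nonneg k) hr)

theorem tendsto_smoothSign {r : ℝ} (hr : 0 < r) :
    Tendsto (fun k => smoothSign k r) atTop (𝓝 1) := by
  refine tendsto_const_nhds.congr' ?_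
  filter_upwards [eventually_ge_atTop ⌈1 / r⌉₊] with k hk
  refine (Real.smoothTransition.one_of_one_le ?_).symm
  rw [← div_le_iff₀ hr]
  exact (Nat.le_ceil _).trans (by exact_mod_cast hk)

/-- Applied to `z = β(w₁) - β(w₂)` and `a = w₁ - w₂`: the sign of `a` may replace that of `z`, since
where `z = 0` the limit does not depend on `a`. -/
theorem tendsto_mul_smoothSign {z a : ℝ} (h1 : 0 < z → 0 < a) (h2 : z < 0 → a ≤ 0) :
    Tendsto (fun k => z * smoothSign k a) atTop (𝓝 (max z 0)) := by
  rcases lt_trichotomy z 0 with h | h | h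
  · simp [smoothSign_of_nonpos _ (h2 h), max_eq_right h.le]
  · simp [h]
  · simpa [max_eq_left h.le] using (tendsto_smoothSign (h1 h)).const_mul z

end Nonlinearity

/-! ### Markovian forms and contraction of the resolvent in `L¹` -/

section Markov

variable {α : Type*} [MeasurableSpace α] {μ : Measure α}
  {Y : Type*} [NormedAddCommGroup Y] [InnerProductSpace ℝ Y]

/-- The first Beurling–Deny criterion, on a dense set: monotone Lipschitz functions operate on `V`
and the form is nonnegative on `(a, G a)`. -/
def IsMarkov (V : Submodule ℝ (Lp ℝ 2 μ × Y)) : Prop :=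
  ∀ (G : ℝ → ℝ) (L : ℝ≥0) (hL : LipschitzWith L G) (h0 : G 0 = 0), ContDiff ℝ ∞ G → Monotone G →
    ∀ a ∈ V, ∀ η : ℝ, 0 < η → ∃ a' ∈ V, ∃ b ∈ V, ‖a - a'‖ ≤ η ∧ b.1 = hL.compLp h0 a'.1 ∧
      0 ≤ (inner ℝ a'.2 b.2 : ℝ) ∧ ‖b.2‖ ≤ L * ‖a'.2‖

/-- Nonnegativity is known only on a dense set, where `G` operates. Both errors in replacing `a` by
`a'` are controlled by the Lipschitz constant of `G` and vanish with `η`, so `G(a)` itself need not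
be shown to lie in `V`. -/
theorem IsMarkov.inner_compLp_nonneg {V : Submodule ℝ (Lp ℝ 2 μ × Y)} (hV : IsMarkov V)
    {G : ℝ → ℝ} {L : ℝ≥0} (hL : LipschitzWith L G) (h0 : G 0 = 0) (hG : ContDiff ℝ ∞ G)
    (hm : Monotone G) {a : Lp ℝ 2 μ × Y} (ha : a ∈ V) {x : Lp ℝ 2 μ} {h : ℝ} (hh : 0 ≤ h)
    (hx : ∀ ψ ∈ V, inner ℝ x ψ.1 = h * inner ℝ a.2 ψ.2) :
    0 ≤ (inner ℝ x (hL.compLp h0 a.1) : ℝ) := by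
  have key : ∀ η : ℝ, 0 < η →
      -(h * (η * (L * (‖a‖ + η))) + ‖x‖ * (L * η)) ≤ inner ℝ x (hL.compLp h0 a.1) := by
    intro η hη
    obtain ⟨a', ha', b, hb, h1, h2, h3, h4⟩ := hV G L hL h0 hG hm a ha η hη
    have h5 := hx b hb
    have h6 : inner ℝ a.2 b.2 = inner ℝ a'.2 b.2 + inner ℝ (a - a').2 b.2 := by
      rw [← inner_add_left]; simp
    have h7 : ‖a'‖ ≤ ‖a‖ + η := by
      have := norm_sub_norm_le a' a
      rw [norm_sub_rev] at this; linarith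
    have h8 : -(η * (L * (‖a‖ + η))) ≤ inner ℝ (a - a').2 b.2 := by
      refine neg_le_of_abs_le ((abs_real_inner_le_norm _ _).trans ?_)
      gcongr
      · exact (norm_snd_le _).trans h1
      · refine h4.trans ?_
        gcongr
        exact (norm_snd_le _).trans h7
    have h9 : |inner ℝ x (hL.compLp h0 a.1 - b.1)| ≤ ‖x‖ * (L * η) := by
      refine (abs_real_inner_le_norm _ _).trans ?_
      gcongr
      rw [h2]
      refine (hL.norm_compLp_sub_le h0 _ _).trans ?_
      gcongr
      exact (norm_fst_le (a - a')).trans h1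
    rw [inner_sub_right] at h9
    have h10 := neg_le_of_abs_le h9
    have h11 : h * -(η * (L * (‖a‖ + η))) ≤ h * inner ℝ a.2 b.2 := by
      gcongr; linarith
    linarith
  have hlim : Tendsto (fun η : ℝ => -(h * (η * (L * (‖a‖ + η))) + ‖x‖ * (L * η))) (𝓝[>] 0)
      (𝓝 0) := by
    have : ContinuousAt (fun η : ℝ => -(h * (η * (L * (‖a‖ + η))) + ‖x‖ * (L * η))) 0 := by
      fun_prop
    simpa using this.tendsto.mono_left (nhdsWithin_le_nhds (s := Ioi 0))
  refine le_of_tendsto hlim ?_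
  filter_upwards [self_mem_nhdsWithin] with η hη using key η hη

/-- `T`-contraction in `L¹` of the resolvent. -/
theorem IsMarkov.posL1_superpose_sub_le [IsFiniteMeasure μ] {V : Submodule ℝ (Lp ℝ 2 μ × Y)}
    (hV : IsMarkov V)
    {β j : ℝ → ℝ} (hβ : IsNonlinearity β j) {ϑ₁ ϑ₂ : Lp ℝ 2 μ × Y} (h₁ : ϑ₁ ∈ V) (h₂ : ϑ₂ ∈ V)
    {g₁ g₂ : Lp ℝ 2 μ} {h : ℝ} (hh : 0 ≤ h)
    (he₁ : ∀ ψ ∈ V, inner ℝ (superpose hβ ϑ₁.1) ψ.1 + h * inner ℝ ϑ₁.2 ψ.2 = inner ℝ g₁ ψ.1)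
    (he₂ : ∀ ψ ∈ V, inner ℝ (superpose hβ ϑ₂.1) ψ.1 + h * inner ℝ ϑ₂.2 ψ.2 = inner ℝ g₂ ψ.1) :
    posL1 (superpose hβ ϑ₁.1 - superpose hβ ϑ₂.1) ≤ posL1 (g₁ - g₂) := by
  set z := superpose hβ ϑ₁.1 - superpose hβ ϑ₂.1 with hz
  set a := ϑ₁ - ϑ₂ with ha
  choose L hL using exists_lipschitzWith_smoothSign
  set ζ : ℕ → Lp ℝ 2 μ := fun k => (hL k).compLp (smoothSign_zero k) a.1 with hζ
  have hζx : ∀ k, ∀ᵐ x ∂μ, ζ k x = smoothSign k (a.1 x) := fun k =>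
    (hL k).coeFn_compLp (smoothSign_zero k) a.1
  -- The difference of the two resolvent equations is tested with a smooth sign of `ϑ₁ - ϑ₂`; the
  -- form contributes a nonnegative term, which is dropped.
  have h1 : ∀ k, inner ℝ z (ζ k) ≤ inner ℝ (g₁ - g₂) (ζ k) := by
    intro k
    have := hV.inner_compLp_nonneg (hL k) (smoothSign_zero k) (contDiff_smoothSign k)
      (smoothSign_monotone k) (V.sub_mem h₁ h₂) (x := g₁ - g₂ - z) hh (fun ψ hψ => by
        have e1 := he₁ ψ hψ
        have e2 := he₂ ψ hψ
        simp only [hz, inner_sub_left, Prod.snd_sub]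
        linarith)
    rw [inner_sub_left] at this
    linarith
  have h2 : ∀ k, ENNReal.ofReal (inner ℝ z (ζ k)) ≤ posL1 (g₁ - g₂) := fun k =>
    (ENNReal.ofReal_le_ofReal (h1 k)).trans (ofReal_inner_le_posL1 _ _ (by
      filter_upwards [hζx k] with x hx
      rw [hx]
      exact smoothSign_mem k _))
  have hzi : Integrable z μ := (Lp.memLp z).integrable one_le_two
  have h3 : Tendsto (fun k => inner ℝ z (ζ k)) atTop (𝓝 (∫ x, max (z x) 0 ∂μ)) := by
    simp only [inner_eq_integral]
    refine tendsto_integral_of_dominated_convergence (fun x => ‖z x‖)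
      (fun k => (integrable_mul_Lp z (ζ k)).1) hzi.norm (fun k => ?_) ?_
    · filter_upwards [hζx k] with x hx
      rw [hx, norm_mul, Real.norm_eq_abs (smoothSign _ _), abs_of_nonneg (smoothSign_mem k _).1]
      exact mul_le_of_le_one_right (norm_nonneg _) (smoothSign_mem k _).2
    · filter_upwards [ae_all_iff.2 hζx, Lp.coeFn_sub (superpose hβ ϑ₁.1) (superpose hβ ϑ₂.1),
        coeFn_superpose hβ ϑ₁.1, coeFn_superpose hβ ϑ₂.1, Lp.coeFn_sub ϑ₁.1 ϑ₂.1]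
        with x e1 e2 e3 e4 e5
      have e6 : z x = β (ϑ₁.1 x) - β (ϑ₂.1 x) := by rw [hz, e2, Pi.sub_apply, e3, e4]
      have e7 : a.1 x = ϑ₁.1 x - ϑ₂.1 x := by rw [ha, Prod.fst_sub, e5, Pi.sub_apply]
      simp only [e1]
      refine tendsto_mul_smoothSign (fun h => ?_) (fun h => ?_)
      · by_contra! h'
        have := hβ.mono (show ϑ₁.1 x ≤ ϑ₂.1 x by linarith)
        linarith
      · by_contra! h'
        have := hβ.mono (show ϑ₂.1 x ≤ ϑ₁.1 x by linarith)
        linarith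
  have h4 : posL1 z = ENNReal.ofReal (∫ x, max (z x) 0 ∂μ) := by
    rw [ofReal_integral_eq_lintegral_ofReal hzi.pos_part
      (Eventually.of_forall fun x => le_max_right _ _)]
    exact lintegral_congr fun x => by simp [ENNReal.ofReal_max]
  rw [h4]
  exact le_of_tendsto ((ENNReal.continuous_ofReal.tendsto _).comp h3)
    (Eventually.of_forall h2)

end Markov


/-! ### Comparison for abstract evolution equations -/

theorem setIntegral_Ioc_split {E : Type*} [NormedAddCommGroup E] [NormedSpace ℝ E] {φ : ℝ → E}
    (hφ : Integrable φ) {a b c : ℝ} (hab : a ≤ b) (hbc : b ≤ c) :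
    ∫ τ in Ioc a c, φ τ = (∫ τ in Ioc a b, φ τ) + ∫ τ in Ioc b c, φ τ := by
  rw [← Ioc_union_Ioc_eq_Ioc hab hbc, setIntegral_union (Ioc_disjoint_Ioc_of_le le_rfl)
    measurableSet_Ioc hφ.integrableOn hφ.integrableOn]

section Evolution

variable {α : Type*} [MeasurableSpace α] {μ : Measure α} [IsFiniteMeasure μ]
  {Y : Type*} [NormedAddCommGroup Y] [InnerProductSpace ℝ Y] [CompleteSpace Y] {β j : ℝ → ℝ}

/-- The equation `v' + L w = f`, `v(0) = v₀`, `v = β(w)`, integrated in time, on `(0,T)`. -/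
structure IsEvolution (V : Submodule ℝ (Lp ℝ 2 μ × Y)) (hβ : IsNonlinearity β j) (T : ℝ)
    (w : ℝ → Lp ℝ 2 μ × Y) (f : ℝ → Lp ℝ 2 μ) (v₀ : Lp ℝ 2 μ) : Prop where
  stronglyMeasurable : StronglyMeasurable fun t => (w t).2
  integrable : Integrable fun t => (w t).2
  integrable_source : Integrable f
  mem : ∀ᵐ t, t ∈ Ioo 0 T → w t ∈ V
  equation : ∀ᵐ t, t ∈ Ioo 0 T → ∀ ψ ∈ V,
    inner ℝ (superpose hβ (w t).1 - v₀) ψ.1 + inner ℝ (∫ τ in Ioc 0 t, (w τ).2) ψ.2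
      = inner ℝ (∫ τ in Ioc 0 t, f τ) ψ.1

/-- The implicit Euler scheme. -/
theorem exists_implicit_euler {V : Submodule ℝ (Lp ℝ 2 μ × Y)}
    (hV : IsClosed (V : Set (Lp ℝ 2 μ × Y))) {C : ℝ} (hC : ∀ a ∈ V, ‖a.1‖ ≤ C * ‖a.2‖)
    (hβ : IsNonlinearity β j) (v₀ : Lp ℝ 2 μ) (h : ℕ → ℝ) (F : ℕ → Lp ℝ 2 μ) :
    ∃ (z : ℕ → Lp ℝ 2 μ) (ϑ : ℕ → Lp ℝ 2 μ × Y), z 0 = v₀ ∧ ∀ k, 0 < h k →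
      ϑ (k + 1) ∈ V ∧ z (k + 1) = superpose hβ (ϑ (k + 1)).1 ∧ ∀ ψ ∈ V,
        inner ℝ (z (k + 1) - z k) ψ.1 + h k * inner ℝ (ϑ (k + 1)).2 ψ.2 = inner ℝ (F k) ψ.1 := by
  -- The resolvent is made total in the step size, with the irrelevant value `0` for `τ ≤ 0`, so
  -- that the scheme can be defined by recursion.
  have hR : ∀ (τ : ℝ) (g : Lp ℝ 2 μ), ∃ ϑ : Lp ℝ 2 μ × Y, 0 < τ → ϑ ∈ V ∧ ∀ ψ ∈ V,
      inner ℝ (superpose hβ ϑ.1) ψ.1 + τ * inner ℝ ϑ.2 ψ.2 = inner ℝ g ψ.1 := by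
    intro τ g
    by_cases hτ : 0 < τ
    · obtain ⟨ϑ, h1, h2⟩ := exists_resolvent hV hC (continuous_superpose hβ)
        (P := fun f => ∫ x, j (f x) ∂μ) (fun f => integral_nonneg fun x => hβ.prim_nonneg _)
        (integral_prim_sub_le hβ) hτ g
      exact ⟨ϑ, fun _ => ⟨h1, h2⟩⟩
    · exact ⟨0, fun h => absurd h hτ⟩
  choose R hR using hR
  let z : ℕ → Lp ℝ 2 μ := fun k => Nat.rec v₀ (fun k x => superpose hβ (R (h k) (x + F k)).1) k
  refine ⟨z, fun k => R (h (k - 1)) (z (k - 1) + F (k - 1)), rfl, fun k hk => ?_⟩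
  obtain ⟨h1, h2⟩ := hR (h k) (z k + F k) hk
  refine ⟨h1, rfl, fun ψ hψ => ?_⟩
  have h3 := h2 ψ hψ
  have h4 : z (k + 1) = superpose hβ (R (h k) (z k + F k)).1 := rfl
  rw [h4, inner_sub_left]
  rw [inner_add_left] at h3
  simp only [Nat.add_sub_cancel]
  linarith

/-- The implicit Euler scheme on a grid approximates a solution of the evolution equation at the
final point, in the norm dual to the energy norm. -/
theorem IsEvolution.exists_error_le {V : Submodule ℝ (Lp ℝ 2 μ × Y)} {hβ : IsNonlinearity β j}
    {T : ℝ} {w : ℝ → Lp ℝ 2 μ × Y} {f : ℝ → Lp ℝ 2 μ} {v₀ : Lp ℝ 2 μ}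
    (hw : IsEvolution V hβ T w f v₀) {n : ℕ} (hn : 0 < n) {t : ℕ → ℝ} (ht0 : t 0 = 0)
    (ht : ∀ k < n, t k < t (k + 1) ∧ 0 ≤ t k ∧ w (t (k + 1)) ∈ V ∧ ∀ ψ ∈ V,
      inner ℝ (superpose hβ (w (t (k + 1))).1 - v₀) ψ.1
        + inner ℝ (∫ τ in Ioc 0 (t (k + 1)), (w τ).2) ψ.2
      = inner ℝ (∫ τ in Ioc 0 (t (k + 1)), f τ) ψ.1)
    {z : ℕ → Lp ℝ 2 μ} {ϑ : ℕ → Lp ℝ 2 μ × Y} (hz0 : z 0 = v₀)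
    (hz : ∀ k < n, ϑ (k + 1) ∈ V ∧ z (k + 1) = superpose hβ (ϑ (k + 1)).1 ∧ ∀ ψ ∈ V,
        inner ℝ (z (k + 1) - z k) ψ.1 + (t (k + 1) - t k) * inner ℝ (ϑ (k + 1)).2 ψ.2
          = inner ℝ (∫ τ in Ioc (t k) (t (k + 1)), f τ) ψ.1)
    {ε : ℝ} (hε : ∑ k ∈ Finset.range n,
      ∫⁻ τ in Ioc (t k) (t (k + 1)), ‖(w τ).2 - (w (t (k + 1))).2‖ₑ ≤ ENNReal.ofReal ε)
    (hε0 : 0 ≤ ε) {ψ : Lp ℝ 2 μ × Y} (hψ : ψ ∈ V) :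
    |inner ℝ (z n - superpose hβ (w (t n)).1) ψ.1| ≤ ε * ‖ψ.2‖ := by
  -- At time zero the initial value itself is used: the equation says nothing about `w` at `0`.
  set x : ℕ → Lp ℝ 2 μ := fun k => if k = 0 then v₀ else superpose hβ (w (t k)).1 with hx
  have hxeq : ∀ k ≤ n, ∀ ψ ∈ V, inner ℝ (x k - v₀) ψ.1
        + inner ℝ (∫ τ in Ioc 0 (t k), (w τ).2) ψ.2
      = inner ℝ (∫ τ in Ioc 0 (t k), f τ) ψ.1 := by
    intro k hk ψ hψ
    rcases Nat.eq_zero_or_pos k with h | h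
    · subst h; simp [hx, ht0]
    · obtain ⟨k, rfl⟩ : ∃ l, k = l + 1 := ⟨k - 1, by omega⟩
      simpa [hx] using (ht k (by omega)).2.2.2 ψ hψ
  obtain ⟨E, hE, hEV⟩ := implicit_euler_error (V := V) (superpose_monotone hβ) (x := x) (z := z)
    (f := fun k => ∫ τ in Ioc (t k) (t (k + 1)), f τ) (a := fun k => w (t k)) (ϑ := ϑ)
    (I := fun k => ∫ τ in Ioc (t k) (t (k + 1)), (w τ).2) (h := fun k => t (k + 1) - t k)
    (by simp [hx, hz0]) n (fun k hk => (sub_pos.2 (ht k hk).1).le)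
    (fun k hk => ⟨(ht k hk).2.2.1, by simp [hx], fun ψ hψ => by
      have h1 := hxeq k (by omega) ψ hψ
      have h2 := hxeq (k + 1) hk ψ hψ
      rw [setIntegral_Ioc_split hw.integrable (ht k hk).2.1 (ht k hk).1.le,
        setIntegral_Ioc_split hw.integrable_source (ht k hk).2.1 (ht k hk).1.le] at h2
      simp only [inner_sub_left, inner_add_left] at h1 h2 ⊢
      linarith⟩) hz
  have hEε : ‖E‖ ≤ ε := by
    refine hE.trans ?_
    rw [← ENNReal.ofReal_le_ofReal_iff hε0, ENNReal.ofReal_sum_of_nonneg fun _ _ => norm_nonneg _]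
    refine le_trans (Finset.sum_le_sum fun k hk => ?_) hε
    have hk := Finset.mem_range.1 hk
    -- Written as the integral of a constant over the cell, the scheme's term turns the consistency
    -- error into an integrated oscillation.
    have h1 : (t (k + 1) - t k) • (w (t (k + 1))).2
        = ∫ τ in Ioc (t k) (t (k + 1)), (w (t (k + 1))).2 := by
      rw [setIntegral_const, measureReal_def, Real.volume_Ioc,
        ENNReal.toReal_ofReal (sub_pos.2 (ht k hk).1).le]
    rw [h1, ← integral_sub hw.integrable.integrableOn (integrable_const _), ofReal_norm]
    exact enorm_integral_le_lintegral_enorm _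
  have hxn : x n = superpose hβ (w (t n)).1 := by simp [hx, hn.ne']
  rw [← hxn, ← hEV ψ hψ]
  refine (abs_real_inner_le_norm _ _).trans ?_
  gcongr

/-- Both solutions are replaced by Euler schemes on one grid ending at `t₀`; the schemes are
compared step by step. Since approximation holds only in the dual energy norm, the conclusion is
tested with a fixed `ψ ∈ V`. The exceptional set of `t₀` does not depend on `ψ`. -/
theorem IsMarkov.comparison {V : Submodule ℝ (Lp ℝ 2 μ × Y)} (hM : IsMarkov V)
    (hV : IsClosed (V : Set (Lp ℝ 2 μ × Y))) {C : ℝ} (hC : ∀ a ∈ V, ‖a.1‖ ≤ C * ‖a.2‖)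
    (hβ : IsNonlinearity β j) {T : ℝ} (hT : 0 < T) {w₁ w₂ : ℝ → Lp ℝ 2 μ × Y}
    {f₁ f₂ : ℝ → Lp ℝ 2 μ} {v₁ v₂ : Lp ℝ 2 μ} (h₁ : IsEvolution V hβ T w₁ f₁ v₁)
    (h₂ : IsEvolution V hβ T w₂ f₂ v₂) :
    ∀ᵐ t₀ ∂(volume.restrict (Ioo 0 T)), ∀ ψ ∈ V, (∀ᵐ x ∂μ, 0 ≤ ψ.1 x ∧ ψ.1 x ≤ 1) →
      ENNReal.ofReal (inner ℝ (superpose hβ (w₁ t₀).1 - superpose hβ (w₂ t₀).1) ψ.1)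
        ≤ posL1 (v₁ - v₂) + ∫⁻ τ in Ioo 0 T, posL1 (f₁ τ - f₂ τ) := by
  have hgm : StronglyMeasurable fun t => ((w₁ t).2, (w₂ t).2) :=
    h₁.stronglyMeasurable.prodMk h₂.stronglyMeasurable
  -- The pair of gradients is treated as a single function, so that one grid serves both solutions.
  have hgi : Integrable fun t => ((w₁ t).2, (w₂ t).2) := h₁.integrable.prodMk h₂.integrable
  have hgrid := exists_grid hgm hgi
    (((h₁.mem.and h₁.equation).and (h₂.mem.and h₂.equation))) hT
  rw [ae_restrict_iff' measurableSet_Ioo] at hgrid ⊢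
  filter_upwards [hgrid] with t₀ hgrid ht₀ ψ hψ hψ1
  replace hgrid := hgrid ht₀
  set M := posL1 (v₁ - v₂) + ∫⁻ τ in Ioo 0 T, posL1 (f₁ τ - f₂ τ) with hMdef
  have key : ∀ ε : ℝ, 0 < ε →
      ENNReal.ofReal (inner ℝ (superpose hβ (w₁ t₀).1 - superpose hβ (w₂ t₀).1) ψ.1
        - 2 * ε * ‖ψ.2‖) ≤ M := by
    intro ε hε
    obtain ⟨n, t, hn, ht0, htn, ht, hs⟩ := hgrid (ENNReal.ofReal ε) (ENNReal.ofReal_pos.2 hε)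
    have htnn : ∀ k < n, 0 ≤ t k := by
      intro k hk
      rcases Nat.eq_zero_or_pos k with h | h
      · subst h; exact ht0.ge
      · obtain ⟨k, rfl⟩ : ∃ l, k = l + 1 := ⟨k - 1, by omega⟩
        exact (ht k (by omega)).2.1.1.le
    have htT : ∀ k < n, t (k + 1) ∈ Ioo 0 T := fun k hk =>
      ⟨(ht k hk).2.1.1, (ht k hk).2.1.2.trans_lt ht₀.2⟩
    obtain ⟨z₁, ϑ₁, hz₁0, hz₁⟩ := exists_implicit_euler hV hC hβ v₁ (fun k => t (k + 1) - t k)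
      (fun k => ∫ τ in Ioc (t k) (t (k + 1)), f₁ τ)
    obtain ⟨z₂, ϑ₂, hz₂0, hz₂⟩ := exists_implicit_euler hV hC hβ v₂ (fun k => t (k + 1) - t k)
      (fun k => ∫ τ in Ioc (t k) (t (k + 1)), f₂ τ)
    have hpos : ∀ k < n, 0 < t (k + 1) - t k := fun k hk => sub_pos.2 (ht k hk).1
    have e₁ := h₁.exists_error_le hn ht0 (fun k hk => ⟨(ht k hk).1, htnn k hk,
      (ht k hk).2.2.1.1 (htT k hk), (ht k hk).2.2.1.2 (htT k hk)⟩) hz₁0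
      (fun k hk => hz₁ k (hpos k hk)) (ε := ε) (le_trans (Finset.sum_le_sum fun k _ =>
        lintegral_mono fun τ => enorm_le_iff_norm_le.2 (norm_fst_le (((w₁ τ).2, (w₂ τ).2)
          - ((w₁ (t (k + 1))).2, (w₂ (t (k + 1))).2)))) hs.le) hε.le hψ
    have e₂ := h₂.exists_error_le hn ht0 (fun k hk => ⟨(ht k hk).1, htnn k hk,
      (ht k hk).2.2.2.1 (htT k hk), (ht k hk).2.2.2.2 (htT k hk)⟩) hz₂0
      (fun k hk => hz₂ k (hpos k hk)) (ε := ε) (le_trans (Finset.sum_le_sum fun k _ =>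
        lintegral_mono fun τ => enorm_le_iff_norm_le.2 (norm_snd_le (((w₁ τ).2, (w₂ τ).2)
          - ((w₁ (t (k + 1))).2, (w₂ (t (k + 1))).2)))) hs.le) hε.le hψ
    -- Iterated contraction: each step adds the positive part of the source difference on its cell.
    have hchain : ∀ k ≤ n, posL1 (z₁ k - z₂ k)
        ≤ posL1 (v₁ - v₂) + ∫⁻ τ in Ioc 0 (t k), posL1 (f₁ τ - f₂ τ) := by
      intro k
      induction k with
      | zero => intro _; simp [hz₁0, hz₂0]
      | succ k ih =>
        intro hk
        obtain ⟨a1, a2, a3⟩ := hz₁ k (hpos k hk)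
        obtain ⟨b1, b2, b3⟩ := hz₂ k (hpos k hk)
        have h5 := hM.posL1_superpose_sub_le hβ a1 b1 (hpos k hk).le
          (g₁ := z₁ k + ∫ τ in Ioc (t k) (t (k + 1)), f₁ τ)
          (g₂ := z₂ k + ∫ τ in Ioc (t k) (t (k + 1)), f₂ τ)
          (fun ψ hψ => by
            have := a3 ψ hψ
            rw [a2, inner_sub_left] at this
            rw [inner_add_left]; linarith)
          (fun ψ hψ => by
            have := b3 ψ hψ
            rw [b2, inner_sub_left] at this
            rw [inner_add_left]; linarith)
        rw [← a2, ← b2, add_sub_add_comm, ← integral_sub h₁.integrable_source.integrableOn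
          h₂.integrable_source.integrableOn] at h5
        rw [← Ioc_union_Ioc_eq_Ioc (htnn k hk) (ht k hk).1.le,
          lintegral_union measurableSet_Ioc (Ioc_disjoint_Ioc_of_le le_rfl), ← add_assoc]
        refine h5.trans ((posL1_add_le _ _).trans (add_le_add (ih (by omega)) ?_))
        exact posL1_setIntegral_le
          (h₁.integrable_source.integrableOn.sub h₂.integrable_source.integrableOn)
    have h6 : inner ℝ (superpose hβ (w₁ t₀).1 - superpose hβ (w₂ t₀).1) ψ.1 - 2 * ε * ‖ψ.2‖
        ≤ inner ℝ (z₁ n - z₂ n) ψ.1 := by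
      rw [htn, abs_le] at e₁ e₂
      have e₁ := e₁.1
      have e₂ := e₂.2
      simp only [inner_sub_left] at e₁ e₂ ⊢
      linarith
    refine (ENNReal.ofReal_le_ofReal h6).trans ((ofReal_inner_le_posL1 _ _ hψ1).trans
      ((hchain n le_rfl).trans ?_))
    rw [hMdef, htn]
    gcongr
    exact ht₀.2
  have hlim : Tendsto (fun ε : ℝ => ENNReal.ofReal (inner ℝ (superpose hβ (w₁ t₀).1
      - superpose hβ (w₂ t₀).1) ψ.1 - 2 * ε * ‖ψ.2‖)) (𝓝[>] 0)
      (𝓝 (ENNReal.ofReal (inner ℝ (superpose hβ (w₁ t₀).1 - superpose hβ (w₂ t₀).1) ψ.1))) := by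
    refine (ENNReal.continuous_ofReal.tendsto _).comp ?_
    have : ContinuousAt (fun ε : ℝ => inner ℝ (superpose hβ (w₁ t₀).1
      - superpose hβ (w₂ t₀).1) ψ.1 - 2 * ε * ‖ψ.2‖) 0 := by fun_prop
    simpa using this.tendsto.mono_left (nhdsWithin_le_nhds (s := Ioi 0))
  refine le_of_tendsto hlim ?_
  filter_upwards [self_mem_nhdsWithin] with ε hε using key ε hε

end Evolution


/-! ### Slices of measurable functions as `L²`-valued functions of time -/

section Slices

variable {α : Type*} [MeasurableSpace α] {μ : Measure α}

open scoped Classical in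
/-- The class of `f` in `L²`, or `0` if `f` is not square integrable. -/
noncomputable def lpOf (μ : Measure α) (f : α → ℝ) : Lp ℝ 2 μ :=
  if h : MemLp f 2 μ then h.toLp f else 0

theorem lpOf_of_memLp {f : α → ℝ} (h : MemLp f 2 μ) : lpOf μ f = h.toLp f := dif_pos h

theorem coeFn_lpOf {f : α → ℝ} (h : MemLp f 2 μ) : lpOf μ f =ᵐ[μ] f := by
  rw [lpOf_of_memLp h]; exact h.coeFn_toLp

theorem lpOf_congr {f g : α → ℝ} (h : f =ᵐ[μ] g) : lpOf μ f = lpOf μ g := by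
  by_cases hf : MemLp f 2 μ
  · have hg := hf.ae_eq h
    rw [lpOf_of_memLp hf, lpOf_of_memLp hg]
    exact (MemLp.toLp_eq_toLp_iff hf hg).2 h
  · have hg : ¬ MemLp g 2 μ := fun hg => hf (hg.ae_eq h.symm)
    simp [lpOf, hf, hg]

theorem edist_lpOf {f : α → ℝ} (h : MemLp f 2 μ) (c : Lp ℝ 2 μ) :
    edist (lpOf μ f) c = eLpNorm (fun x => f x - c x) 2 μ := by
  rw [Lp.edist_def]
  refine eLpNorm_congr_ae ?_
  filter_upwards [coeFn_lpOf h] with x hx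
  simp [hx]

theorem enorm_lpOf_sq_le (f : α → ℝ) : ‖lpOf μ f‖ₑ ^ 2 ≤ ∫⁻ x, ‖f x‖ₑ ^ 2 ∂μ := by
  by_cases hf : MemLp f 2 μ
  · rw [lpOf_of_memLp hf, Lp.enorm_toLp, ← ENNReal.rpow_natCast,
      eLpNorm_eq_lintegral_rpow_enorm_toReal two_ne_zero ENNReal.ofNat_ne_top, ← ENNReal.rpow_mul]
    simp
  · simp [lpOf, hf]

theorem inner_lpOf {f g : α → ℝ} (hf : MemLp f 2 μ) (hg : MemLp g 2 μ) :
    inner ℝ (lpOf μ f) (lpOf μ g) = ∫ x, f x * g x ∂μ := by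
  rw [inner_eq_integral]
  refine integral_congr_ae ?_
  filter_upwards [coeFn_lpOf hf, coeFn_lpOf hg] with x h1 h2
  rw [h1, h2]

/-- By second countability every open set is a countable union of balls, whose preimages are
sublevel sets of distance functions. -/
theorem measurable_of_measurable_edist {γ X : Type*} [MeasurableSpace γ] [PseudoEMetricSpace X]
    [SecondCountableTopology X] [MeasurableSpace X] [BorelSpace X] {u : γ → X}
    (hu : ∀ c, Measurable fun t => edist (u t) c) : Measurable u := by
  refine measurable_of_isOpen fun U hU => ?_
  have h1 : ∀ y : U, ∃ r : ℝ≥0∞, 0 < r ∧ Metric.eball (y : X) r ⊆ U := fun y => by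
    obtain ⟨r, hr, h⟩ := EMetric.mem_nhds_iff.1 (hU.mem_nhds y.2)
    exact ⟨r, hr, h⟩
  choose r hr hrU using h1
  obtain ⟨S, hS, h2⟩ := TopologicalSpace.isOpen_iUnion_countable
    (fun y : U => Metric.eball (y : X) (r y)) fun y => Metric.isOpen_eball
  have h3 : U = ⋃ y ∈ S, Metric.eball (y : X) (r y) := by
    rw [h2]
    refine Subset.antisymm (fun y hy => mem_iUnion.2 ⟨⟨y, hy⟩, Metric.mem_eball_self (hr _)⟩)
      (iUnion_subset hrU)
  rw [h3, preimage_iUnion₂]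
  exact MeasurableSet.biUnion hS fun y _ => measurableSet_lt (hu y) measurable_const

variable {ν : Measure ℝ} [SFinite μ]

/-- For a jointly measurable representative, the distance of a slice to a fixed element of `L²` is a
power of a parameter integral, measurable by Tonelli. Non-square-integrable slices form a measurable
set on which `lpOf` is `0`. -/
theorem aestronglyMeasurable_lpOf [SecondCountableTopology (Lp ℝ 2 μ)] {F : ℝ → α → ℝ}
    (hF : AEStronglyMeasurable (Function.uncurry F) (ν.prod μ)) :
    AEStronglyMeasurable (fun t => lpOf μ (F t)) ν := by
  classical
  borelize ↥(Lp ℝ 2 μ)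
  set G := hF.mk with hG
  have hGm : StronglyMeasurable G := hF.stronglyMeasurable_mk
  have hae : ∀ᵐ t ∂ν, F t =ᵐ[μ] fun x => G (t, x) := Measure.ae_ae_of_ae_prod hF.ae_eq_mk
  have hnorm : ∀ c : α → ℝ, StronglyMeasurable c →
      Measurable fun t => eLpNorm (fun x => G (t, x) - c x) 2 μ := by
    intro c hc
    simp only [eLpNorm_eq_lintegral_rpow_enorm_toReal two_ne_zero ENNReal.ofNat_ne_top]
    have h1 : StronglyMeasurable fun p : ℝ × α => G p - c p.2 :=
      hGm.sub (hc.comp_measurable measurable_snd)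
    have h2 : Measurable fun p : ℝ × α => ‖G p - c p.2‖ₑ ^ (2 : ℝ≥0∞).toReal :=
      h1.enorm.pow_const _
    exact (h2.lintegral_prod_right' (ν := μ)).pow_const _
  have hmem : MeasurableSet {t | MemLp (fun x => G (t, x)) 2 μ} := by
    have h1 : {t | MemLp (fun x => G (t, x)) 2 μ}
        = {t | eLpNorm (fun x => G (t, x) - 0) 2 μ < ⊤} := by
      ext t
      simp only [mem_ofPred_eq, sub_zero]
      exact ⟨fun h => h.2, fun h =>
        ⟨(hGm.comp_measurable measurable_prodMk_left).aestronglyMeasurable, h⟩⟩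
    rw [h1]
    exact measurableSet_lt (hnorm (fun _ => 0) stronglyMeasurable_const) measurable_const
  have hmeas : Measurable fun t => lpOf μ fun x => G (t, x) := by
    refine measurable_of_measurable_edist fun c => ?_
    have h1 : (fun t => edist (lpOf μ fun x => G (t, x)) c)
        = {t | MemLp (fun x => G (t, x)) 2 μ}.piecewise
          (fun t => eLpNorm (fun x => G (t, x) - c x) 2 μ) fun _ => edist 0 c := by
      ext t
      by_cases h : MemLp (fun x => G (t, x)) 2 μ
      · rw [piecewise_eq_of_mem _ _ _ (show t ∈ {t | MemLp (fun x => G (t, x)) 2 μ} from h),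
          edist_lpOf h]
      · rw [piecewise_eq_of_notMem _ _ _ (show t ∉ {t | MemLp (fun x => G (t, x)) 2 μ} from h),
          lpOf, dif_neg h]
    rw [h1]
    exact (hnorm c (Lp.stronglyMeasurable c)).piecewise hmem measurable_const
  refine (hmeas.stronglyMeasurable.aestronglyMeasurable).congr ?_
  filter_upwards [hae] with t ht using (lpOf_congr ht).symm

theorem memLp_lpOf [SecondCountableTopology (Lp ℝ 2 μ)] {F : ℝ → α → ℝ}
    (hF : AEStronglyMeasurable (Function.uncurry F) (ν.prod μ))
    (h : ∫⁻ t, ∫⁻ x, ‖F t x‖ₑ ^ 2 ∂μ ∂ν < ⊤) : MemLp (fun t => lpOf μ (F t)) 2 ν := by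
  refine ⟨aestronglyMeasurable_lpOf hF, ?_⟩
  rw [eLpNorm_lt_top_iff_lintegral_rpow_enorm_lt_top two_ne_zero ENNReal.ofNat_ne_top]
  refine lt_of_le_of_lt (lintegral_mono fun t => ?_) h
  have := enorm_lpOf_sq_le (μ := μ) (F t)
  simpa using this

theorem memLp_two_iff_lintegral {γ : Type*} [MeasurableSpace γ] {m : Measure γ} {f : γ → ℝ}
    (hf : AEStronglyMeasurable f m) : MemLp f 2 m ↔ ∫⁻ x, ‖f x‖ₑ ^ 2 ∂m < ⊤ := by
  have h := eLpNorm_lt_top_iff_lintegral_rpow_enorm_lt_top (f := f) (μ := m) two_ne_zero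
    ENNReal.ofNat_ne_top
  simp only [ENNReal.toReal_ofNat, ENNReal.rpow_ofNat] at h
  rw [← h]
  exact ⟨fun h => h.2, fun h => ⟨hf, h⟩⟩

end Slices

/-! ### The fundamental lemma for weak time derivatives with initial values -/

section Time

/-- Integration by parts against a primitive of an `L¹` function, through Fubini on the triangle `τ
≤ t`. -/
theorem integral_deriv_mul_primitive {T a₀ : ℝ} (hT : 0 < T) {b : ℝ → ℝ}
    (hb : IntegrableOn b (Ioo 0 T)) {η : ℝ → ℝ} (hη : ContDiff ℝ ∞ η)
    (hηc : HasCompactSupport η) (hηT : η T = 0) :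
    ∫ t in Ioo 0 T, (a₀ + ∫ τ in Ioc 0 t, b τ) * deriv η t
      = -(a₀ * η 0) - ∫ t in Ioo 0 T, b t * η t := by
  set ν := (volume : Measure ℝ).restrict (Ioo 0 T) with hν
  have hd : Continuous (deriv η) := hη.continuous_deriv (by simp)
  have hdi : Integrable (deriv η) ν :=
    (hd.integrable_of_hasCompactSupport hηc.deriv).restrict
  have hFTC : ∀ τ ∈ Ico 0 T, ∫ t in Ioo τ T, deriv η t = -η τ := by
    intro τ hτ
    rw [← integral_Ioc_eq_integral_Ioo, ← intervalIntegral.integral_of_le hτ.2.le,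
      intervalIntegral.integral_deriv_eq_sub (fun t _ => hη.differentiable (by simp) t)
        (hd.intervalIntegrable _ _), hηT, zero_sub]
  have hprod : Integrable (fun p : ℝ × ℝ => b p.2 * deriv η p.1) (ν.prod ν) := by
    have := hdi.mul_prod hb
    refine this.congr (Eventually.of_forall fun p => ?_)
    simp [mul_comm]
  set S : Set (ℝ × ℝ) := {p | p.2 ≤ p.1} with hS
  have hSm : MeasurableSet S := measurableSet_le measurable_snd measurable_fst
  have hprod2 := hprod.indicator hSm
  have h1 : ∀ t ∈ Ioo 0 T, (∫ τ in Ioc 0 t, b τ) * deriv η t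
      = ∫ τ, S.indicator (fun p : ℝ × ℝ => b p.2 * deriv η p.1) (t, τ) ∂ν := by
    intro t ht
    rw [← integral_mul_const, ← integral_indicator measurableSet_Ioc, hν,
      ← integral_indicator measurableSet_Ioo]
    congr 1
    ext τ
    simp only [indicator, mem_Ioc, mem_Ioo, hS, mem_ofPred_eq]
    by_cases h0 : 0 < τ <;> by_cases h1 : τ ≤ t <;> simp [h0, h1]
    intro h2
    linarith [ht.2]
  have h2 : ∀ τ ∈ Ioo 0 T, ∫ t, S.indicator (fun p : ℝ × ℝ => b p.2 * deriv η p.1) (t, τ) ∂ν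
      = -(b τ * η τ) := by
    intro τ hτ
    rw [← mul_neg, ← hFTC τ ⟨hτ.1.le, hτ.2⟩, hν, ← integral_indicator measurableSet_Ioo,
      ← integral_Ico_eq_integral_Ioo, ← integral_const_mul, ← integral_indicator measurableSet_Ico]
    congr 1
    ext t
    simp only [indicator, mem_Ico, mem_Ioo, hS, mem_ofPred_eq]
    by_cases h0 : τ ≤ t <;> by_cases h1 : t < T <;> simp [h0, h1]
    intro h2
    linarith [hτ.1]
  have h3 : ∫ t in Ioo 0 T, (∫ τ in Ioc 0 t, b τ) * deriv η t = -∫ t in Ioo 0 T, b t * η t := by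
    rw [setIntegral_congr_fun measurableSet_Ioo h1, integral_integral_swap (f := fun t τ =>
      S.indicator (fun p : ℝ × ℝ => b p.2 * deriv η p.1) (t, τ)) hprod2,
      setIntegral_congr_fun measurableSet_Ioo h2, integral_neg]
  have h4 : Integrable (fun t => (∫ τ in Ioc 0 t, b τ) * deriv η t) ν := by
    refine hprod2.integral_prod_left.congr ?_
    exact (ae_restrict_iff' measurableSet_Ioo).2 (Eventually.of_forall fun t ht => (h1 t ht).symm)
  simp only [add_mul]
  rw [integral_add (hdi.const_mul a₀) h4, h3, integral_const_mul, hFTC 0 ⟨le_rfl, hT⟩]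
  ring

/-- Test functions need not vanish at `0`, so their derivatives on `(0,T)` include every `θ ∈
C_c^∞(0,T)`, not only those of mean zero. Hence no additive constant is left free and `a₀` is the
initial value. -/
theorem ae_eq_primitive_of_weak {T a₀ : ℝ} (hT : 0 < T) {A b : ℝ → ℝ}
    (hA : IntegrableOn A (Ioo 0 T)) (hb : IntegrableOn b (Ioo 0 T))
    (h : ∀ η : ℝ → ℝ, ContDiff ℝ ∞ η → HasCompactSupport η → tsupport η ⊆ Iio T →
      -(∫ t in Ioo 0 T, A t * deriv η t) = (∫ t in Ioo 0 T, b t * η t) + a₀ * η 0) :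
    ∀ᵐ t, t ∈ Ioo 0 T → A t = a₀ + ∫ τ in Ioc 0 t, b τ := by
  set P : ℝ → ℝ := fun t => a₀ + ∫ τ in Ioc 0 t, b τ with hP
  have hbi : Integrable ((Ioo 0 T).indicator b) := (integrable_indicator_iff measurableSet_Ioo).2 hb
  have hPc : ContinuousOn P (Ioo 0 T) := by
    have h1 : Continuous fun t => ∫ τ in (0 : ℝ)..t, (Ioo 0 T).indicator b τ :=
      intervalIntegral.continuous_primitive (fun a c => hbi.intervalIntegrable) 0
    have h2 : ContinuousOn (fun t => a₀ + ∫ τ in (0 : ℝ)..t, (Ioo 0 T).indicator b τ) (Ioo 0 T) :=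
      (continuous_const.add h1).continuousOn
    refine h2.congr fun t ht => ?_
    simp only [hP]
    rw [intervalIntegral.integral_of_le ht.1.le]
    congr 1
    refine setIntegral_congr_fun measurableSet_Ioc fun τ hτ => ?_
    rw [indicator_of_mem (show τ ∈ Ioo 0 T from ⟨hτ.1, hτ.2.trans_lt ht.2⟩)]
  have hPl : LocallyIntegrableOn P (Ioo 0 T) := hPc.locallyIntegrableOn measurableSet_Ioo
  have hl : LocallyIntegrableOn (fun t => A t - P t) (Ioo 0 T) :=
    hA.locallyIntegrableOn.sub hPl
  have key := isOpen_Ioo.ae_eq_zero_of_integral_contDiff_smul_eq_zero hl (fun θ hθ hθc hθs => by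
    obtain ⟨c, hc0, hcT, hθ0⟩ : ∃ c, 0 < c ∧ c < T ∧ ∀ t, c ≤ t → θ t = 0 := by
      rcases (tsupport θ).eq_empty_or_nonempty with he | hne
      · exact ⟨T / 2, by linarith, by linarith, fun t _ =>
          image_eq_zero_of_notMem_tsupport (by simp [he])⟩
      · obtain ⟨c, hc, hmax⟩ := (show IsCompact (tsupport θ) from hθc).exists_isMaxOn hne
          continuous_id.continuousOn
        have hcT := (hθs hc)
        refine ⟨(c + T) / 2, by linarith [hcT.1], by linarith [hcT.2], fun t ht =>
          image_eq_zero_of_notMem_tsupport fun h' => ?_⟩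
        have : t ≤ c := hmax h'
        linarith [hcT.2]
    -- The primitive based at `T` vanishes from `c` on, hence near `T`; its value at `0` is
    -- arbitrary.
    set Θ : ℝ → ℝ := fun t => ∫ τ in T..t, θ τ with hΘ
    have hΘd : ∀ t, HasDerivAt Θ (θ t) t := fun t =>
      intervalIntegral.integral_hasDerivAt_right (hθ.continuous.intervalIntegrable _ _)
        (hθ.continuous.stronglyMeasurableAtFilter _ _) hθ.continuous.continuousAt
    have hΘs : ContDiff ℝ ∞ Θ := by
      rw [contDiff_infty_iff_deriv]
      refine ⟨fun t => (hΘd t).differentiableAt, ?_⟩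
      rwa [show deriv Θ = θ from funext fun t => (hΘd t).deriv]
    have hΘ0 : ∀ t, c ≤ t → Θ t = 0 := by
      intro t ht
      simp only [hΘ]
      refine intervalIntegral.integral_zero_ae (Eventually.of_forall fun τ hτ => hθ0 τ ?_)
      rcases uIoc_subset_uIcc hτ with ⟨h1, -⟩
      exact (le_min hcT.le ht).trans h1
    -- The cutoff equals `1` for `t ≥ 0` and `0` for `t ≤ -1`: it makes the support compact without
    -- changing the primitive on `(0,T)`.
    set η : ℝ → ℝ := fun t => Real.smoothTransition (t + 1) * Θ t with hη
    have hηs : ContDiff ℝ ∞ η :=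
      (Real.smoothTransition.contDiff.comp (contDiff_id.add contDiff_const)).mul hΘs
    have hηsupp : tsupport η ⊆ Icc (-1) c := by
      refine closure_minimal (fun t ht => ?_) isClosed_Icc
      by_contra h'
      refine ht ?_
      simp only [hη]
      rw [mem_Icc, not_and_or, not_le, not_le] at h'
      rcases h' with h' | h'
      · rw [Real.smoothTransition.zero_of_nonpos (by linarith), zero_mul]
      · rw [hΘ0 t h'.le, mul_zero]
    have hηc : HasCompactSupport η := isCompact_Icc.of_isClosed_subset (isClosed_tsupport _) hηsupp
    have hηT : tsupport η ⊆ Iio T := fun t ht => (hηsupp ht).2.trans_lt hcT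
    have hηd : ∀ t ∈ Ioo 0 T, deriv η t = θ t := by
      intro t ht
      have : η =ᶠ[𝓝 t] Θ := by
        filter_upwards [Ioi_mem_nhds ht.1] with τ hτ
        simp only [hη]
        rw [Real.smoothTransition.one_of_one_le (by linarith [mem_Ioi.1 hτ]), one_mul]
      rw [this.deriv_eq, (hΘd t).deriv]
    have e1 := h η hηs hηc hηT
    have e2 := integral_deriv_mul_primitive (a₀ := a₀) hT hb hηs hηc
      (image_eq_zero_of_notMem_tsupport fun h' => lt_irrefl T (hηT h'))
    have hdb : ∃ B, ∀ t, ‖deriv η t‖ ≤ B :=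
      (hηs.continuous_deriv (by simp)).bounded_above_of_compact_support hηc.deriv
    obtain ⟨B, hB⟩ := hdb
    have i1 : Integrable (fun t => A t * deriv η t) (volume.restrict (Ioo 0 T)) :=
      hA.mul_bdd (hηs.continuous_deriv (by simp)).aestronglyMeasurable
        (Eventually.of_forall hB)
    have hPi : Integrable P (volume.restrict (Ioo 0 T)) := by
      refine (Integrable.mono' (integrable_const (|a₀| + ∫ τ in Ioo 0 T, |b τ|))
        (hPc.aestronglyMeasurable measurableSet_Ioo) ?_)
      rw [ae_restrict_iff' measurableSet_Ioo]
      refine Eventually.of_forall fun t ht => ?_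
      refine (norm_add_le _ _).trans (add_le_add le_rfl ?_)
      refine (norm_integral_le_integral_norm _).trans ?_
      exact setIntegral_mono_set hb.norm (Eventually.of_forall fun _ => norm_nonneg _)
        (Ioc_subset_Ioo_right ht.2).eventuallyLE
    have i2 : Integrable (fun t => P t * deriv η t) (volume.restrict (Ioo 0 T)) :=
      hPi.mul_bdd (hηs.continuous_deriv (by simp)).aestronglyMeasurable
        (Eventually.of_forall hB)
    have e3 : ∫ t in Ioo 0 T, θ t * (A t - P t) = 0 := by
      have : ∀ t ∈ Ioo 0 T, θ t * (A t - P t) = A t * deriv η t - P t * deriv η t := by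
        intro t ht
        rw [hηd t ht]; ring
      rw [setIntegral_congr_fun measurableSet_Ioo this, integral_sub i1 i2, e2]
      linarith
    rw [← e3]
    simp only [smul_eq_mul]
    refine (setIntegral_eq_integral_of_forall_compl_eq_zero fun t ht => ?_).symm
    rw [image_eq_zero_of_notMem_tsupport fun h' => ht (hθs h'), zero_mul])
  filter_upwards [key] with t ht hT'
  exact sub_eq_zero.1 (ht hT')

end Time


/-! ### The energy of test functions -/

section Energy

variable {n : ℕ} {s : ℝ} {K : Rn n → Rn n → ℝ} {Ω : Set (Rn n)}

/-- The test functions `C_c^∞(Ω)`. -/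
structure IsTest (Ω : Set (Rn n)) (ζ : Rn n → ℝ) : Prop where
  contDiff : ContDiff ℝ ∞ ζ
  hasCompactSupport : HasCompactSupport ζ
  tsupport_subset : tsupport ζ ⊆ Ω

theorem IsTest.eq_zero {ζ : Rn n → ℝ} (hζ : IsTest Ω ζ) {x : Rn n} (hx : x ∉ Ω) : ζ x = 0 :=
  image_eq_zero_of_notMem_tsupport fun h => hx (hζ.tsupport_subset h)

theorem IsTest.comp {ζ : Rn n → ℝ} (hζ : IsTest Ω ζ) {G : ℝ → ℝ} (hG : ContDiff ℝ ∞ G)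
    (h0 : G 0 = 0) : IsTest Ω fun x => G (ζ x) :=
  ⟨hG.comp hζ.contDiff, hζ.hasCompactSupport.comp_left h0,
    (tsupport_comp_subset h0 ζ).trans hζ.tsupport_subset⟩

theorem IsTest.add {ζ ξ : Rn n → ℝ} (hζ : IsTest Ω ζ) (hξ : IsTest Ω ξ) :
    IsTest Ω fun x => ζ x + ξ x :=
  ⟨hζ.contDiff.add hξ.contDiff, hζ.hasCompactSupport.add hξ.hasCompactSupport,
    (tsupport_add ζ ξ).trans (union_subset hζ.tsupport_subset hξ.tsupport_subset)⟩

theorem IsTest.zero : IsTest Ω fun _ => 0 :=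
  ⟨contDiff_const, HasCompactSupport.zero, by simp [tsupport]⟩

/-- In polar coordinates the integrand is `r^{1-2s}` near zero and `r^{-1-2s}` at infinity; the two
ends use `s < 1` and `s > 0`. -/
theorem integrable_levy_weight (hn : 1 ≤ n) (hs : 0 < s) (hs1 : s < 1) :
    Integrable fun z : Rn n => min 1 (‖z‖ ^ 2) / ‖z‖ ^ ((n : ℝ) + 2 * s) := by
  have : Nonempty (Fin n) := ⟨⟨0, hn⟩⟩
  rw [integrable_fun_norm_addHaar volume
    (f := fun r : ℝ => min 1 (r ^ 2) / r ^ ((n : ℝ) + 2 * s)), finrank_euclideanSpace_fin,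
    ← Ioc_union_Ioi_eq_Ioi (zero_le_one (α := ℝ))]
  have hpow : ∀ y : ℝ, 0 < y → y ^ (n - 1) = y ^ ((n : ℝ) - 1) := fun y hy => by
    rw [← Real.rpow_natCast, Nat.cast_sub hn, Nat.cast_one]
  refine IntegrableOn.union ?_ ?_
  · have h1 : IntegrableOn (fun y : ℝ => y ^ (1 - 2 * s)) (Ioc 0 1) := by
      rw [integrableOn_Ioc_iff_integrableOn_Ioo,
        intervalIntegral.integrableOn_Ioo_rpow_iff one_pos]
      linarith
    refine h1.congr_fun (fun y hy => ?_) measurableSet_Ioc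
    have hy0 : 0 < y := hy.1
    simp only [smul_eq_mul]
    rw [min_eq_right (pow_le_one₀ hy0.le hy.2), hpow y hy0, ← Real.rpow_natCast y 2,
      ← Real.rpow_sub hy0, ← Real.rpow_add hy0]
    congr 1
    push_cast
    ring
  · have h1 : IntegrableOn (fun y : ℝ => y ^ (-1 - 2 * s)) (Ioi 1) :=
      integrableOn_Ioi_rpow_of_lt (by linarith) one_pos
    refine h1.congr_fun (fun y hy => ?_) measurableSet_Ioi
    have hy0 : 0 < y := one_pos.trans hy
    simp only [smul_eq_mul]
    rw [min_eq_left (one_le_pow₀ (le_of_lt hy)), hpow y hy0, mul_one_div, ← Real.rpow_sub hy0]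
    congr 1
    ring

/-- Boundedness and the Lipschitz property give `|ζ x - ζ y|² ≤ M min(1, |x-y|²)`, and the
difference vanishes unless `x` or `y` lies in the compact support. The double integral is thus at
most twice `M |supp ζ|` times the integral of the Lévy weight. -/
theorem IsTest.gagliardoSq_lt_top (hn : 1 ≤ n) (hs : 0 < s) (hs1 : s < 1) {ζ : Rn n → ℝ}
    (hζ : IsTest Ω ζ) : gagliardoSq s ζ < ⊤ := by
  obtain ⟨L, hL⟩ := hζ.contDiff.lipschitzWith_of_hasCompactSupport hζ.hasCompactSupport (by simp)
  obtain ⟨B, hB⟩ := hζ.contDiff.continuous.bounded_above_of_compact_support hζ.hasCompactSupport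
  set M : ℝ := max ((2 * B) ^ 2) ((L : ℝ) ^ 2) with hM
  have hM0 : 0 ≤ M := (sq_nonneg _).trans (le_max_left _ _)
  set S : Set (Rn n) := tsupport ζ with hS
  have hSm : MeasurableSet S := (isClosed_tsupport ζ).measurableSet
  have hSv : volume S < ⊤ := (show IsCompact S from hζ.hasCompactSupport).measure_lt_top
  set k : Rn n → ℝ := fun z => min 1 (‖z‖ ^ 2) / ‖z‖ ^ ((n : ℝ) + 2 * s) with hk
  have hk0 : ∀ z, 0 ≤ k z := fun z => by positivity
  set κ : Rn n → ℝ≥0∞ := fun z => ENNReal.ofReal (k z) with hκ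
  have hkm : Measurable κ := by
    simp only [hκ, hk]
    fun_prop
  set I : ℝ≥0∞ := ∫⁻ z, κ z with hI
  have hIt : I < ⊤ := (integrable_levy_weight hn hs hs1).lintegral_lt_top
  have hsq : ∀ x y, |ζ x - ζ y| ^ 2 ≤ M * min 1 (‖x - y‖ ^ 2) := by
    intro x y
    have h1 : |ζ x - ζ y| ≤ L * ‖x - y‖ := by
      simpa [dist_eq_norm] using hL.dist_le_mul x y
    have h2 : |ζ x - ζ y| ≤ 2 * B := by
      have h3 := hB x
      have h4 := hB y
      rw [Real.norm_eq_abs] at h3 h4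
      exact (abs_sub _ _).trans (by linarith)
    rw [mul_min_of_nonneg _ _ hM0, mul_one]
    refine le_min ((pow_le_pow_left₀ (abs_nonneg _) h2 2).trans (le_max_left _ _)) ?_
    calc |ζ x - ζ y| ^ 2 ≤ (L * ‖x - y‖) ^ 2 := pow_le_pow_left₀ (abs_nonneg _) h1 2
      _ = (L : ℝ) ^ 2 * ‖x - y‖ ^ 2 := by ring
      _ ≤ M * ‖x - y‖ ^ 2 := by gcongr; exact le_max_right _ _
  have hpt : ∀ x y, ENNReal.ofReal (|ζ x - ζ y| ^ 2 / ‖x - y‖ ^ ((n : ℝ) + 2 * s))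
      ≤ ENNReal.ofReal M * (S.indicator 1 x * κ (x - y))
        + ENNReal.ofReal M * (S.indicator 1 y * κ (x - y)) := by
    intro x y
    have h1 : ENNReal.ofReal (|ζ x - ζ y| ^ 2 / ‖x - y‖ ^ ((n : ℝ) + 2 * s))
        ≤ ENNReal.ofReal M * κ (x - y) := by
      simp only [hκ, hk]
      rw [← ENNReal.ofReal_mul hM0, ← mul_div_assoc]
      refine ENNReal.ofReal_le_ofReal ?_
      gcongr
      exact hsq x y
    by_cases hx : x ∈ S
    · refine h1.trans (le_trans ?_ le_self_add)
      simp [hx]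
    · by_cases hy : y ∈ S
      · refine h1.trans (le_trans ?_ le_add_self)
        simp [hy]
      · rw [image_eq_zero_of_notMem_tsupport hx, image_eq_zero_of_notMem_tsupport hy]
        simp
  have hm1 : Measurable fun p : Rn n × Rn n => S.indicator (1 : Rn n → ℝ≥0∞) p.1 * κ (p.1 - p.2) :=
    ((measurable_one.indicator hSm).comp measurable_fst).mul (hkm.comp (by fun_prop))
  have hm2 : Measurable fun p : Rn n × Rn n => S.indicator (1 : Rn n → ℝ≥0∞) p.2 * κ (p.1 - p.2) :=
    ((measurable_one.indicator hSm).comp measurable_snd).mul (hkm.comp (by fun_prop))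
  have e1 : ∫⁻ x, ∫⁻ y, S.indicator 1 x * κ (x - y) = volume S * I := by
    have : ∀ x : Rn n, ∫⁻ y, S.indicator 1 x * κ (x - y) = S.indicator 1 x * I := fun x => by
      rw [lintegral_const_mul _ (by fun_prop), lintegral_sub_left_eq_self]
    simp_rw [this]
    rw [lintegral_mul_const _ (measurable_one.indicator hSm), lintegral_indicator_one hSm]
  have e2 : ∫⁻ x, ∫⁻ y, S.indicator 1 y * κ (x - y) = volume S * I := by
    rw [lintegral_lintegral_swap hm2.aemeasurable]
    have : ∀ y : Rn n, ∫⁻ x, S.indicator 1 y * κ (x - y) = S.indicator 1 y * I := fun y => by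
      rw [lintegral_const_mul _ (by fun_prop), lintegral_sub_right_eq_self]
    simp_rw [this]
    rw [lintegral_mul_const _ (measurable_one.indicator hSm), lintegral_indicator_one hSm]
  unfold gagliardoSq
  refine lt_of_le_of_lt (lintegral_mono fun x => lintegral_mono fun y => hpt x y) ?_
  have e3 : ∀ x, ∫⁻ y, (ENNReal.ofReal M * (S.indicator 1 x * κ (x - y))
        + ENNReal.ofReal M * (S.indicator 1 y * κ (x - y)))
      = ENNReal.ofReal M * (∫⁻ y, S.indicator 1 x * κ (x - y))
        + ENNReal.ofReal M * ∫⁻ y, S.indicator 1 y * κ (x - y) := fun x => by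
    have a1 : Measurable fun y => S.indicator (1 : Rn n → ℝ≥0∞) x * κ (x - y) :=
      hm1.comp measurable_prodMk_left
    have a2 : Measurable fun y => S.indicator (1 : Rn n → ℝ≥0∞) y * κ (x - y) :=
      hm2.comp measurable_prodMk_left
    rw [lintegral_add_left (a1.const_mul _), lintegral_const_mul _ a1, lintegral_const_mul _ a2]
  simp_rw [e3]
  have b1 := hm1.lintegral_prod_right' (ν := volume)
  have b2 := hm2.lintegral_prod_right' (ν := volume)
  rw [lintegral_add_left (b1.const_mul _), lintegral_const_mul _ b1, lintegral_const_mul _ b2,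
    e1, e2]
  have : volume S * I < ⊤ := ENNReal.mul_lt_top hSv hIt
  exact ENNReal.add_lt_top.2 ⟨ENNReal.mul_lt_top ENNReal.ofReal_lt_top this,
    ENNReal.mul_lt_top ENNReal.ofReal_lt_top this⟩

theorem IsTest.memHs (hn : 1 ≤ n) (hs : 0 < s) (hs1 : s < 1) {ζ : Rn n → ℝ}
    (hζ : IsTest Ω ζ) : MemHs s ζ := by
  refine ⟨hζ.contDiff.continuous.aestronglyMeasurable, ENNReal.add_lt_top.2
    ⟨?_, hζ.gagliardoSq_lt_top hn hs hs1⟩⟩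
  have h : MemLp ζ 2 :=
    hζ.contDiff.continuous.memLp_of_hasCompactSupport hζ.hasCompactSupport
  have h1 := (memLp_two_iff_lintegral h.1).1 h
  refine lt_of_le_of_lt (le_of_eq (lintegral_congr fun x => ?_)) h1
  rw [← ofReal_norm, ← ENNReal.ofReal_pow (norm_nonneg _), Real.norm_eq_abs]

/-- The square root of the kernel of the bilinear form. -/
noncomputable def sqrtKernel (s : ℝ) (K : Rn n → Rn n → ℝ) (p : Rn n × Rn n) : ℝ :=
  √(K p.1 p.2 / ‖p.1 - p.2‖ ^ ((n : ℝ) + 2 * s))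

/-- The nonlocal gradient with `B_K(u,v) = ∫ (D u) (D v)`. -/
noncomputable def nlGrad (s : ℝ) (K : Rn n → Rn n → ℝ) (u : Rn n → ℝ) (p : Rn n × Rn n) : ℝ :=
  sqrtKernel s K p * (u p.1 - u p.2)

theorem IsKernel.nonneg (hK : IsKernel K) (x y : Rn n) : 0 ≤ K x y := by
  obtain ⟨l, L, hl, -, h⟩ := hK.elliptic
  exact hl.le.trans (h x y).1

theorem nlGrad_mul (hK : IsKernel K) (u v : Rn n → ℝ) (p : Rn n × Rn n) :
    nlGrad s K u p * nlGrad s K v p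
      = K p.1 p.2 * ((u p.1 - u p.2) * (v p.1 - v p.2) / ‖p.1 - p.2‖ ^ ((n : ℝ) + 2 * s)) := by
  have h : sqrtKernel s K p * sqrtKernel s K p = K p.1 p.2 / ‖p.1 - p.2‖ ^ ((n : ℝ) + 2 * s) :=
    Real.mul_self_sqrt (div_nonneg (hK.nonneg _ _) (by positivity))
  calc _ = sqrtKernel s K p * sqrtKernel s K p * ((u p.1 - u p.2) * (v p.1 - v p.2)) := by
        unfold nlGrad; ring
    _ = _ := by rw [h]; ring

theorem bilin_eq_integral (hK : IsKernel K) (u v : Rn n → ℝ) :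
    bilin s K u v = ∫ p, nlGrad s K u p * nlGrad s K v p :=
  integral_congr_ae (Eventually.of_forall fun p => (nlGrad_mul hK u v p).symm)

theorem nlGrad_add (u v : Rn n → ℝ) (p : Rn n × Rn n) :
    nlGrad s K (fun x => u x + v x) p = nlGrad s K u p + nlGrad s K v p := by
  unfold nlGrad; ring

theorem nlGrad_sub (u v : Rn n → ℝ) (p : Rn n × Rn n) :
    nlGrad s K (fun x => u x - v x) p = nlGrad s K u p - nlGrad s K v p := by
  unfold nlGrad; ring

theorem nlGrad_smul (c : ℝ) (u : Rn n → ℝ) (p : Rn n × Rn n) :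
    nlGrad s K (fun x => c * u x) p = c * nlGrad s K u p := by
  unfold nlGrad; ring

theorem aemeasurable_sqrtKernel (hK : IsKernel K) : AEMeasurable (sqrtKernel s K) := by
  have h1 : AEMeasurable (fun p : Rn n × Rn n => K p.1 p.2) := hK.aemeasurable
  have h2 : Measurable fun p : Rn n × Rn n => ‖p.1 - p.2‖ ^ ((n : ℝ) + 2 * s) := by fun_prop
  exact (h1.div h2.aemeasurable).sqrt

theorem aestronglyMeasurable_nlGrad (hK : IsKernel K) {u : Rn n → ℝ}
    (hu : AEStronglyMeasurable u) : AEStronglyMeasurable (nlGrad s K u) := by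
  refine (aemeasurable_sqrtKernel hK).aestronglyMeasurable.mul ?_
  exact (hu.comp_quasiMeasurePreserving Measure.quasiMeasurePreserving_fst).sub
    (hu.comp_quasiMeasurePreserving Measure.quasiMeasurePreserving_snd)

theorem nlGrad_congr {u v : Rn n → ℝ} (h : u =ᵐ[volume] v) :
    nlGrad s K u =ᵐ[volume] nlGrad s K v := by
  have h1 : ∀ᵐ p : Rn n × Rn n, u p.1 = v p.1 := Measure.quasiMeasurePreserving_fst.ae h
  have h2 : ∀ᵐ p : Rn n × Rn n, u p.2 = v p.2 := Measure.quasiMeasurePreserving_snd.ae h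
  filter_upwards [h1, h2] with p h1 h2
  simp only [nlGrad, h1, h2]

theorem enorm_nlGrad_sq (hK : IsKernel K) (u : Rn n → ℝ) (p : Rn n × Rn n) :
    ‖nlGrad s K u p‖ₑ ^ 2 = ENNReal.ofReal (K p.1 p.2 *
      (|u p.1 - u p.2| ^ 2 / ‖p.1 - p.2‖ ^ ((n : ℝ) + 2 * s))) := by
  rw [← ofReal_norm, ← ENNReal.ofReal_pow (norm_nonneg _), Real.norm_eq_abs, sq_abs, sq,
    nlGrad_mul hK, sq_abs, sq]

theorem gagliardoSq_eq_lintegral_prod {u : Rn n → ℝ} (hu : AEStronglyMeasurable u) :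
    gagliardoSq s u = ∫⁻ p : Rn n × Rn n,
      ENNReal.ofReal (|u p.1 - u p.2| ^ 2 / ‖p.1 - p.2‖ ^ ((n : ℝ) + 2 * s)) := by
  have hm : AEMeasurable fun p : Rn n × Rn n =>
      ENNReal.ofReal (|u p.1 - u p.2| ^ 2 / ‖p.1 - p.2‖ ^ ((n : ℝ) + 2 * s)) := by
    have h1 : AEStronglyMeasurable fun p : Rn n × Rn n => u p.1 - u p.2 :=
      (hu.comp_quasiMeasurePreserving Measure.quasiMeasurePreserving_fst).sub
        (hu.comp_quasiMeasurePreserving Measure.quasiMeasurePreserving_snd)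
    have h2 : Measurable fun p : Rn n × Rn n => ‖p.1 - p.2‖ ^ ((n : ℝ) + 2 * s) := by fun_prop
    exact ((h1.aemeasurable.abs.pow_const 2).div h2.aemeasurable).ennreal_ofReal
  rw [Measure.volume_eq_prod, lintegral_prod _ hm]
  rfl

theorem exists_lintegral_nlGrad_le (hK : IsKernel K) (s : ℝ) : ∃ C : ℝ, 0 ≤ C ∧
    ∀ u : Rn n → ℝ, AEStronglyMeasurable u →
      ∫⁻ p, ‖nlGrad s K u p‖ₑ ^ 2 ≤ ENNReal.ofReal C * gagliardoSq s u := by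
  obtain ⟨l, L, hl, hlL, h⟩ := hK.elliptic
  refine ⟨L, hl.le.trans hlL, fun u hu => ?_⟩
  rw [gagliardoSq_eq_lintegral_prod hu, ← lintegral_const_mul' _ _ ENNReal.ofReal_ne_top]
  refine lintegral_mono fun p => ?_
  rw [enorm_nlGrad_sq hK, ← ENNReal.ofReal_mul (hl.le.trans hlL)]
  refine ENNReal.ofReal_le_ofReal ?_
  gcongr
  exact (h _ _).2

theorem exists_gagliardoSq_le (hK : IsKernel K) (s : ℝ) : ∃ C : ℝ, 0 ≤ C ∧
    ∀ u : Rn n → ℝ, AEStronglyMeasurable u →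
      gagliardoSq s u ≤ ENNReal.ofReal C * ∫⁻ p, ‖nlGrad s K u p‖ₑ ^ 2 := by
  obtain ⟨l, L, hl, hlL, h⟩ := hK.elliptic
  refine ⟨l⁻¹, (inv_pos.2 hl).le, fun u hu => ?_⟩
  rw [gagliardoSq_eq_lintegral_prod hu, ← lintegral_const_mul' _ _ ENNReal.ofReal_ne_top]
  refine lintegral_mono fun p => ?_
  rw [enorm_nlGrad_sq hK, ← ENNReal.ofReal_mul (inv_pos.2 hl).le]
  refine ENNReal.ofReal_le_ofReal ?_
  rw [← mul_assoc]
  refine le_mul_of_one_le_left (by positivity) ?_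
  rw [inv_mul_eq_div, one_le_div hl]
  exact (h _ _).1

theorem MemHs.memLp {u : Rn n → ℝ} (hu : MemHs s u) : MemLp u 2 := by
  rw [memLp_two_iff_lintegral hu.1]
  refine lt_of_le_of_lt (le_of_eq ?_) (ENNReal.add_lt_top.1 hu.2).1
  refine lintegral_congr fun x => ?_
  rw [← ofReal_norm, ← ENNReal.ofReal_pow (norm_nonneg _), Real.norm_eq_abs]

theorem MemHs.memLp_nlGrad (hK : IsKernel K) {u : Rn n → ℝ} (hu : MemHs s u) :
    MemLp (nlGrad s K u) 2 := by
  rw [memLp_two_iff_lintegral (aestronglyMeasurable_nlGrad hK hu.1)]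
  obtain ⟨C, -, h⟩ := exists_lintegral_nlGrad_le hK s
  exact (h u hu.1).trans_lt (ENNReal.mul_lt_top ENNReal.ofReal_lt_top
    (ENNReal.add_lt_top.1 hu.2).2)

end Energy


/-! ### The energy space -/

section EnergySpace

variable {α : Type*} [MeasurableSpace α] {μ : Measure α}

theorem lpOf_add {f g : α → ℝ} (hf : MemLp f 2 μ) (hg : MemLp g 2 μ) :
    lpOf μ f + lpOf μ g = lpOf μ fun x => f x + g x := by
  rw [lpOf_of_memLp hf, lpOf_of_memLp hg, lpOf_of_memLp (f := fun x => f x + g x) (hf.add hg)]; rfl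

theorem lpOf_sub {f g : α → ℝ} (hf : MemLp f 2 μ) (hg : MemLp g 2 μ) :
    lpOf μ f - lpOf μ g = lpOf μ fun x => f x - g x := by
  rw [lpOf_of_memLp hf, lpOf_of_memLp hg, lpOf_of_memLp (f := fun x => f x - g x) (hf.sub hg)]; rfl

theorem lpOf_smul {f : α → ℝ} (hf : MemLp f 2 μ) (c : ℝ) :
    c • lpOf μ f = lpOf μ fun x => c * f x := by
  rw [lpOf_of_memLp hf, lpOf_of_memLp (hf.const_mul c)]; rfl

variable {n : ℕ} {s : ℝ} {K : Rn n → Rn n → ℝ} {Ω : Set (Rn n)}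

/-- The ambient space of the energy space: a function on `Ω` and its nonlocal gradient. -/
abbrev PairSpace (Ω : Set (Rn n)) : Type :=
  Lp ℝ 2 ((volume : Measure (Rn n)).restrict Ω) × Lp ℝ 2 (volume : Measure (Rn n × Rn n))

/-- A function on `Ω` together with its nonlocal gradient. -/
noncomputable def energyPair (s : ℝ) (K : Rn n → Rn n → ℝ) (Ω : Set (Rn n)) (u : Rn n → ℝ) :
    PairSpace Ω :=
  (lpOf _ u, lpOf _ (nlGrad s K u))

theorem energyPair_add (hK : IsKernel K) {u v : Rn n → ℝ} (hu : MemHs s u) (hv : MemHs s v) :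
    energyPair s K Ω u + energyPair s K Ω v = energyPair s K Ω fun x => u x + v x := by
  simp only [energyPair, Prod.mk_add_mk]
  rw [lpOf_add (hu.memLp.restrict Ω) (hv.memLp.restrict Ω),
    lpOf_add (hu.memLp_nlGrad hK) (hv.memLp_nlGrad hK)]
  simp only [← nlGrad_add]

theorem energyPair_sub (hK : IsKernel K) {u v : Rn n → ℝ} (hu : MemHs s u) (hv : MemHs s v) :
    energyPair s K Ω u - energyPair s K Ω v = energyPair s K Ω fun x => u x - v x := by
  simp only [energyPair, Prod.mk_sub_mk]
  rw [lpOf_sub (hu.memLp.restrict Ω) (hv.memLp.restrict Ω),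
    lpOf_sub (hu.memLp_nlGrad hK) (hv.memLp_nlGrad hK)]
  simp only [← nlGrad_sub]

theorem energyPair_smul (hK : IsKernel K) {u : Rn n → ℝ} (hu : MemHs s u) (c : ℝ) :
    c • energyPair s K Ω u = energyPair s K Ω fun x => c * u x := by
  simp only [energyPair, Prod.smul_mk]
  rw [lpOf_smul (hu.memLp.restrict Ω), lpOf_smul (hu.memLp_nlGrad hK)]
  simp only [← nlGrad_smul]

/-- The space of test functions. -/
noncomputable def testSpace (hn : 1 ≤ n) (hs : 0 < s) (hs1 : s < 1) (hK : IsKernel K)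
    (Ω : Set (Rn n)) : Submodule ℝ (PairSpace Ω) where
  carrier := {a | ∃ ζ, IsTest Ω ζ ∧ a = energyPair s K Ω ζ}
  add_mem' := by
    rintro _ _ ⟨ζ, hζ, rfl⟩ ⟨ξ, hξ, rfl⟩
    exact ⟨_, hζ.add hξ, energyPair_add hK (hζ.memHs hn hs hs1) (hξ.memHs hn hs hs1)⟩
  zero_mem' := ⟨_, IsTest.zero, by
    have h := energyPair_smul (Ω := Ω) hK ((IsTest.zero (Ω := Ω)).memHs hn hs hs1) 0
    rw [zero_smul] at h
    simpa using h⟩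
  smul_mem' := by
    rintro c _ ⟨ζ, hζ, rfl⟩
    exact ⟨_, hζ.comp (contDiff_const.mul contDiff_id) (by simp),
      energyPair_smul hK (hζ.memHs hn hs hs1) c⟩

/-- The space `H̃^s(Ω)`, as a closed subspace of the space of pairs. -/
noncomputable def energySpace (hn : 1 ≤ n) (hs : 0 < s) (hs1 : s < 1) (hK : IsKernel K)
    (Ω : Set (Rn n)) : Submodule ℝ (PairSpace Ω) :=
  (testSpace hn hs hs1 hK Ω).topologicalClosure

theorem isClosed_energySpace (hn : 1 ≤ n) (hs : 0 < s) (hs1 : s < 1) (hK : IsKernel K)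
    (Ω : Set (Rn n)) : IsClosed (energySpace hn hs hs1 hK Ω : Set (PairSpace Ω)) :=
  Submodule.isClosed_topologicalClosure _

theorem IsTest.mem_energySpace (hn : 1 ≤ n) (hs : 0 < s) (hs1 : s < 1) (hK : IsKernel K)
    {ζ : Rn n → ℝ} (hζ : IsTest Ω ζ) : energyPair s K Ω ζ ∈ energySpace hn hs hs1 hK Ω :=
  Submodule.le_topologicalClosure _ ⟨ζ, hζ, rfl⟩

theorem energySpace_subset_of_isClosed (hn : 1 ≤ n) (hs : 0 < s) (hs1 : s < 1) (hK : IsKernel K)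
    {S : Set (PairSpace Ω)} (hS : IsClosed S) (h : ∀ ζ, IsTest Ω ζ → energyPair s K Ω ζ ∈ S) :
    ∀ a ∈ energySpace hn hs hs1 hK Ω, a ∈ S := by
  intro a ha
  refine closure_minimal ?_ hS ha
  rintro _ ⟨ζ, hζ, rfl⟩
  exact h ζ hζ

theorem exists_test_near (hn : 1 ≤ n) (hs : 0 < s) (hs1 : s < 1) (hK : IsKernel K)
    {a : PairSpace Ω} (ha : a ∈ energySpace hn hs hs1 hK Ω) {η : ℝ} (hη : 0 < η) :
    ∃ ζ, IsTest Ω ζ ∧ ‖a - energyPair s K Ω ζ‖ ≤ η := by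
  obtain ⟨_, ⟨ζ, hζ, rfl⟩, h⟩ := Metric.mem_closure_iff.1
    (show a ∈ closure (testSpace hn hs hs1 hK Ω : Set (PairSpace Ω)) from ha) η hη
  rw [dist_eq_norm] at h
  exact ⟨ζ, hζ, h.le⟩

theorem norm_lt_of_enorm_sq_lt {E : Type*} [NormedAddCommGroup E] {a : E} {ε : ℝ} (hε : 0 < ε)
    (h : ‖a‖ₑ ^ 2 < ENNReal.ofReal (ε ^ 2)) : ‖a‖ < ε := by
  rw [← ofReal_norm, ← ENNReal.ofReal_pow (norm_nonneg _),
    ENNReal.ofReal_lt_ofReal_iff (by positivity)] at h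
  exact lt_of_pow_lt_pow_left₀ 2 hε.le h

theorem lintegral_enorm_sq_le_hsNormSq (u : Rn n → ℝ) : ∫⁻ x, ‖u x‖ₑ ^ 2 ≤ hsNormSq s u := by
  refine le_trans (le_of_eq (lintegral_congr fun x => ?_)) le_self_add
  rw [← ofReal_norm, ← ENNReal.ofReal_pow (norm_nonneg _), Real.norm_eq_abs]

theorem MemHsTilde.mem_energySpace (hn : 1 ≤ n) (hs : 0 < s) (hs1 : s < 1) (hK : IsKernel K)
    {u : Rn n → ℝ} (hu : MemHsTilde s Ω u) :
    energyPair s K Ω u ∈ energySpace hn hs hs1 hK Ω := by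
  refine Metric.mem_closure_iff.2 fun ε hε => ?_
  obtain ⟨C, hC, hCu⟩ := exists_lintegral_nlGrad_le hK s
  -- `C` is the upper ellipticity bound, so this budget brings both the `L²` part and the gradient
  -- part below `ε ^ 2`.
  obtain ⟨ζ, h1, h2, h3, h4⟩ := hu.2 (ENNReal.ofReal (ε ^ 2 / (C + 1)))
    (ENNReal.ofReal_pos.2 (by positivity))
  have hζ : IsTest Ω ζ := ⟨h1, h2, h3⟩
  have hζs := hζ.memHs hn hs hs1
  refine ⟨_, ⟨ζ, hζ, rfl⟩, ?_⟩
  rw [dist_eq_norm, energyPair_sub hK hu.1 hζs, Prod.norm_def]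
  have hle : ENNReal.ofReal (ε ^ 2 / (C + 1)) ≤ ENNReal.ofReal (ε ^ 2) :=
    ENNReal.ofReal_le_ofReal (div_le_self (by positivity) (by linarith))
  refine max_lt (norm_lt_of_enorm_sq_lt hε ?_) (norm_lt_of_enorm_sq_lt hε ?_)
  · refine (enorm_lpOf_sq_le _).trans_lt (lt_of_le_of_lt ?_ (h4.trans_le hle))
    exact (lintegral_mono' Measure.restrict_le_self le_rfl).trans
      (lintegral_enorm_sq_le_hsNormSq (s := s) _)
  · refine (enorm_lpOf_sq_le _).trans_lt ?_
    refine (hCu _ (hu.1.1.sub hζs.1)).trans_lt ?_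
    calc ENNReal.ofReal C * gagliardoSq s (fun x => u x - ζ x)
        ≤ ENNReal.ofReal (C + 1) * hsNormSq s (fun x => u x - ζ x) := by
          gcongr
          · linarith
          · exact le_add_self
      _ < ENNReal.ofReal (C + 1) * ENNReal.ofReal (ε ^ 2 / (C + 1)) :=
          ENNReal.mul_lt_mul_right (ENNReal.ofReal_pos.2 (by linarith)).ne'
            ENNReal.ofReal_ne_top h4
      _ = ENNReal.ofReal (ε ^ 2) := by
          rw [← ENNReal.ofReal_mul (by linarith)]
          congr 1
          field_simp

/-- Approximating test functions vanish off `Ω`, so the `L²` mass of `u` there is at most the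
approximation error. -/
theorem MemHsTilde.ae_eq_zero (hΩ : MeasurableSet Ω) {u : Rn n → ℝ} (hu : MemHsTilde s Ω u) :
    ∀ᵐ x, x ∉ Ω → u x = 0 := by
  set U : Rn n → ℝ≥0∞ := fun x => Ωᶜ.indicator (fun x => ‖u x‖ₑ ^ 2) x with hU
  have h0 : ∫⁻ x, U x = 0 := by
    refine le_antisymm (le_of_forall_pos_le_add fun δ hδ => ?_) zero_le
    obtain ⟨ζ, h1, h2, h3, h4⟩ := hu.2 δ hδ
    have hζ : IsTest Ω ζ := ⟨h1, h2, h3⟩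
    rw [zero_add]
    refine le_trans (lintegral_mono fun x => ?_) ((lintegral_enorm_sq_le_hsNormSq (s := s)
      (fun x => u x - ζ x)).trans h4.le)
    by_cases hx : x ∈ Ω
    · simp [hU, hx]
    · simp [hU, hx, hζ.eq_zero hx]
  have hUm : AEMeasurable U := (hu.1.1.enorm.pow_const 2).indicator hΩ.compl
  filter_upwards [(lintegral_eq_zero_iff' hUm).1 h0] with x hx hxΩ
  simpa [hU, hxΩ] using hx

/-- Pair each `x ∈ Ω` with `y` in a fixed ball away from `Ω`. There `ζ(y) = 0` and `|x-y|` is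
bounded, so this part of the Gagliardo integral alone controls the `L²` norm on `Ω`. -/
theorem exists_poincare (hn : 1 ≤ n) (hs : 0 < s) (hs1 : s < 1) (hK : IsKernel K)
    (hΩ : MeasurableSet Ω) (hΩb : Bornology.IsBounded Ω) :
    ∃ C : ℝ, ∀ a ∈ energySpace hn hs hs1 hK Ω, ‖a.1‖ ≤ C * ‖a.2‖ := by
  have : Nonempty (Fin n) := ⟨⟨0, hn⟩⟩
  obtain ⟨R, hR0, hR⟩ := hΩb.exists_pos_norm_le
  -- With `Ω` in the ball of radius `R`, every `y` in the unit ball about `p` satisfies `R + 1 < ‖y‖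
  -- < R + 3`, whence `0 < ‖x - y‖ ≤ 2 * R + 3`.
  obtain ⟨p, hp⟩ := exists_norm_eq (Rn n) (show 0 ≤ R + 2 by linarith)
  set d : ℝ := (n : ℝ) + 2 * s with hd
  have hd0 : 0 < d := by positivity
  set c : ℝ := ((2 * R + 3) ^ d)⁻¹ with hc
  have hc0 : 0 < c := by positivity
  set v : ℝ≥0∞ := volume (Metric.ball p 1) with hv
  have hv0 : 0 < v := Metric.measure_ball_pos _ _ one_pos
  have hvt : v < ⊤ := measure_ball_lt_top
  obtain ⟨C, hC0, hC⟩ := exists_gagliardoSq_le hK s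
  have hgag : ∀ ζ, IsTest Ω ζ →
      (∫⁻ x in Ω, ‖ζ x‖ₑ ^ 2) * (ENNReal.ofReal c * v) ≤ gagliardoSq s ζ := by
    intro ζ hζ
    rw [← lintegral_mul_const _ (by
      exact hζ.contDiff.continuous.measurable.enorm.pow_const 2)]
    unfold gagliardoSq
    refine le_trans ?_ (setLIntegral_le_lintegral Ω _)
    refine setLIntegral_mono' hΩ fun x hx => ?_
    refine le_trans ?_ (setLIntegral_le_lintegral (Metric.ball p 1) _)
    rw [← mul_assoc, ← setLIntegral_const]
    refine setLIntegral_mono' measurableSet_ball fun y hy => ?_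
    have h1 := hR x hx
    have h2 : ‖y - p‖ < 1 := by simpa [dist_eq_norm] using hy
    have h3 : R + 1 < ‖y‖ := by
      have := norm_sub_norm_le p y
      rw [norm_sub_rev] at this; linarith
    have h4 : ‖y‖ < R + 3 := by
      have := norm_sub_norm_le y p
      linarith
    have hyΩ : y ∉ Ω := fun h => by
      have := hR y h; linarith
    have h5 : 0 < ‖x - y‖ := norm_pos_iff.2 (sub_ne_zero.2 fun h => hyΩ (h ▸ hx))
    have h6 : ‖x - y‖ ≤ 2 * R + 3 := (norm_sub_le _ _).trans (by linarith)
    rw [hζ.eq_zero hyΩ, sub_zero, ← ofReal_norm, ← ENNReal.ofReal_pow (norm_nonneg _),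
      ← ENNReal.ofReal_mul (by positivity), Real.norm_eq_abs, hc, ← div_eq_mul_inv]
    refine ENNReal.ofReal_le_ofReal ?_
    gcongr
  set κ : ℝ := C / (c * v.toReal) with hκ
  have hvr : 0 < v.toReal := ENNReal.toReal_pos hv0.ne' hvt.ne
  have hκ0 : 0 ≤ κ := by positivity
  refine ⟨√κ, energySpace_subset_of_isClosed hn hs hs1 hK
    (S := {a | ‖a.1‖ ≤ √κ * ‖a.2‖}) (isClosed_le (by fun_prop) (by fun_prop)) fun ζ hζ => ?_⟩
  have hζs := hζ.memHs hn hs hs1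
  have e1 := (hgag ζ hζ).trans (hC ζ hζs.1)
  have e2 : ∫⁻ x in Ω, ‖ζ x‖ₑ ^ 2 = ENNReal.ofReal (‖(energyPair s K Ω ζ).1‖ ^ 2) := by
    simp only [energyPair]
    rw [ENNReal.ofReal_pow (norm_nonneg _), ofReal_norm, lpOf_of_memLp (hζs.memLp.restrict Ω),
      Lp.enorm_toLp, ← ENNReal.rpow_natCast,
      eLpNorm_eq_lintegral_rpow_enorm_toReal two_ne_zero ENNReal.ofNat_ne_top, ← ENNReal.rpow_mul]
    simp
  have e3 : ∫⁻ p, ‖nlGrad s K ζ p‖ₑ ^ 2 = ENNReal.ofReal (‖(energyPair s K Ω ζ).2‖ ^ 2) := by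
    simp only [energyPair]
    rw [ENNReal.ofReal_pow (norm_nonneg _), ofReal_norm, lpOf_of_memLp (hζs.memLp_nlGrad hK),
      Lp.enorm_toLp, ← ENNReal.rpow_natCast,
      eLpNorm_eq_lintegral_rpow_enorm_toReal two_ne_zero ENNReal.ofNat_ne_top, ← ENNReal.rpow_mul]
    simp
  rw [e2, e3, ← ENNReal.ofReal_toReal hvt.ne, ← ENNReal.ofReal_mul hc0.le,
    ← ENNReal.ofReal_mul (by positivity), ← ENNReal.ofReal_mul hC0,
    ENNReal.ofReal_le_ofReal_iff (by positivity)] at e1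
  change ‖(energyPair s K Ω ζ).1‖ ≤ √κ * ‖(energyPair s K Ω ζ).2‖
  rw [← pow_le_pow_iff_left₀ (norm_nonneg _) (by positivity) two_ne_zero, mul_pow,
    Real.sq_sqrt hκ0, hκ, div_mul_eq_mul_div, le_div_iff₀ (by positivity)]
  exact e1

/-- Smooth `G` with `G 0 = 0` preserves test functions, which are dense. Monotonicity of `G` makes
`(ζ x - ζ y)(G(ζ x) - G(ζ y))` pointwise nonnegative, and its Lipschitz bound passes to the nonlocal
gradient. -/
theorem isMarkov_energySpace (hn : 1 ≤ n) (hs : 0 < s) (hs1 : s < 1) (hK : IsKernel K)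
    (Ω : Set (Rn n)) : IsMarkov (energySpace hn hs hs1 hK Ω) := by
  intro G L hL h0 hG hm a ha η hη
  obtain ⟨ζ, hζ, hη'⟩ := exists_test_near hn hs hs1 hK ha hη
  have hζG := hζ.comp hG h0
  have hζs := hζ.memHs hn hs hs1
  have hζGs := hζG.memHs hn hs hs1
  refine ⟨_, hζ.mem_energySpace hn hs hs1 hK, _, hζG.mem_energySpace hn hs hs1 hK, hη', ?_, ?_, ?_⟩
  · refine Lp.ext ?_
    filter_upwards [hL.coeFn_compLp h0 (energyPair s K Ω ζ).1, coeFn_lpOf (hζs.memLp.restrict Ω),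
      coeFn_lpOf (hζGs.memLp.restrict Ω)] with x h1 h2 h3
    rw [h1, Function.comp_apply]
    simp only [energyPair]
    rw [h2, h3]
  · simp only [energyPair]
    rw [inner_lpOf (hζs.memLp_nlGrad hK) (hζGs.memLp_nlGrad hK)]
    refine integral_nonneg fun p => ?_
    rw [Pi.zero_apply, nlGrad_mul hK]
    refine mul_nonneg (hK.nonneg _ _) (div_nonneg ?_ (by positivity))
    rcases le_total (ζ p.1) (ζ p.2) with h | h
    · exact mul_nonneg_of_nonpos_of_nonpos (sub_nonpos.2 h) (sub_nonpos.2 (hm h))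
    · exact mul_nonneg (sub_nonneg.2 h) (sub_nonneg.2 (hm h))
  · refine Lp.norm_le_mul_norm_of_ae_le_mul ?_
    filter_upwards [coeFn_lpOf (hζs.memLp_nlGrad hK), coeFn_lpOf (hζGs.memLp_nlGrad hK)]
      with p h1 h2
    simp only [energyPair]
    rw [h1, h2]
    simp only [nlGrad, norm_mul]
    rw [mul_left_comm]
    gcongr
    simpa [dist_eq_norm] using hL.dist_le_mul (ζ p.1) (ζ p.2)

end EnergySpace


/-! ### The power nonlinearity -/

section Power

theorem Phi_neg (p t : ℝ) : Phi p (-t) = -Phi p t := by simp [Phi]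

theorem Phi_zero (p : ℝ) : Phi p 0 = 0 := by simp [Phi]

theorem Phi_of_nonneg {p : ℝ} (hp : 0 < p) {t : ℝ} (ht : 0 ≤ t) : Phi p t = t ^ p := by
  rcases ht.eq_or_lt with rfl | ht
  · rw [Phi_zero, Real.zero_rpow hp.ne']
  · rw [Phi, abs_of_pos ht, Real.rpow_sub_one ht.ne', div_mul_cancel₀ _ ht.ne']

theorem abs_Phi {p : ℝ} (hp : 0 < p) (t : ℝ) : |Phi p t| = |t| ^ p := by
  rw [← Phi_of_nonneg hp (abs_nonneg t), Phi, Phi, abs_mul, abs_abs,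
    abs_of_nonneg (Real.rpow_nonneg (abs_nonneg t) _)]

theorem Phi_monotone {p : ℝ} (hp : 0 < p) : Monotone (Phi p) := by
  refine monotone_of_odd_of_monotoneOn_nonneg (Phi_neg p) fun a ha b hb hab => ?_
  rw [Phi_of_nonneg hp ha, Phi_of_nonneg hp hb]
  exact Real.rpow_le_rpow ha hab hp.le

theorem Phi_inv_Phi {m : ℝ} (hm : 0 < m) (t : ℝ) : Phi m⁻¹ (Phi m t) = t := by
  have h : ∀ t, 0 ≤ t → Phi m⁻¹ (Phi m t) = t := fun t ht => by
    rw [Phi_of_nonneg hm ht, Phi_of_nonneg (inv_pos.2 hm) (by positivity),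
      Real.rpow_rpow_inv ht hm.ne']
  rcases le_total 0 t with ht | ht
  · exact h t ht
  · have := h (-t) (by linarith)
    rw [Phi_neg, Phi_neg] at this
    linarith

theorem continuous_Phi {p : ℝ} (hp : 1 < p) : Continuous (Phi p) := by
  unfold Phi
  exact (continuous_abs.rpow_const fun _ => Or.inr (by linarith)).mul continuous_id

/-- For equal signs this is subadditivity of `t ↦ t^p`. For opposite signs each of the two terms is
at most `|a - b|^p`, whence the factor `2`. -/
theorem abs_Phi_sub_le {p : ℝ} (hp : 0 < p) (hp1 : p ≤ 1) (a b : ℝ) :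
    |Phi p a - Phi p b| ≤ 2 * |a - b| ^ p := by
  wlog hab : b ≤ a generalizing a b
  · rw [abs_sub_comm, abs_sub_comm a]
    exact this b a (le_of_not_ge hab)
  have hpos : ∀ a b, 0 ≤ b → b ≤ a → Phi p a - Phi p b ≤ (a - b) ^ p := by
    intro a b hb hab
    rw [Phi_of_nonneg hp hb, Phi_of_nonneg hp (hb.trans hab)]
    have := Real.rpow_add_le_add_rpow hb (sub_nonneg.2 hab) hp.le hp1
    rw [add_sub_cancel] at this
    linarith
  rw [abs_of_nonneg (sub_nonneg.2 (Phi_monotone hp hab)), abs_of_nonneg (sub_nonneg.2 hab)]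
  have hnn : 0 ≤ (a - b) ^ p := Real.rpow_nonneg (sub_nonneg.2 hab) _
  rcases le_total 0 b with hb | hb
  · linarith [hpos a b hb hab]
  · rcases le_total 0 a with ha | ha
    · have h1 : Phi p a ≤ (a - b) ^ p := by
        rw [Phi_of_nonneg hp ha]
        exact Real.rpow_le_rpow ha (by linarith) hp.le
      have h2 : Phi p (-b) ≤ (a - b) ^ p := by
        rw [Phi_of_nonneg hp (by linarith)]
        exact Real.rpow_le_rpow (by linarith) (by linarith) hp.le
      rw [Phi_neg] at h2
      linarith
    · have := hpos (-b) (-a) (by linarith) (by linarith)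
      rw [Phi_neg, Phi_neg, neg_sub_neg, neg_sub_neg] at this
      linarith

theorem isNonlinearity_Phi {p : ℝ} (hp : 0 < p) (hp1 : p < 1) :
    IsNonlinearity (Phi p) fun r => |r| ^ (1 + p) / (1 + p) where
  mono := Phi_monotone hp
  zero := Phi_zero p
  modulus := by
    intro δ hδ
    -- The threshold with `2 r^p = δ`: below it the Hölder bound is at most `δ`, above it the bound
    -- is linear because `|a - b|^{p-1} ≤ r^{p-1}`.
    set r := (δ / 2) ^ p⁻¹ with hr
    have hr0 : 0 < r := by positivity
    have hrp : r ^ p = δ / 2 := Real.rpow_inv_rpow (by positivity) hp.ne'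
    refine ⟨2 * r ^ (p - 1), by positivity, fun a b => (abs_Phi_sub_le hp hp1.le a b).trans ?_⟩
    rcases le_total |a - b| r with h | h
    · have h1 : |a - b| ^ p ≤ δ / 2 := hrp ▸ Real.rpow_le_rpow (abs_nonneg _) h hp.le
      have h2 : 0 ≤ 2 * r ^ (p - 1) * |a - b| := by positivity
      linarith
    · have hab : 0 < |a - b| := hr0.trans_le h
      have h1 : |a - b| ^ p = |a - b| ^ (p - 1) * |a - b| := by
        rw [Real.rpow_sub_one hab.ne', div_mul_cancel₀ _ hab.ne']
      have h2 : |a - b| ^ (p - 1) ≤ r ^ (p - 1) :=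
        Real.rpow_le_rpow_of_nonpos hr0 h (by linarith)
      rw [h1]
      nlinarith [mul_le_mul_of_nonneg_right h2 hab.le]
  measurable_prim := by fun_prop
  prim_nonneg a := by positivity
  prim_zero := by simp [Real.zero_rpow (show 1 + p ≠ 0 by linarith)]
  prim_sub_le a b := by
    -- Convexity of the primitive in the form of Young's inequality for `|b|` and `|a|^p`.
    have hpq : (1 + p).HolderConjugate ((1 + p) / p) := by
      rw [Real.holderConjugate_iff]
      refine ⟨by linarith, ?_⟩
      field_simp
    have h1 := Real.young_inequality_of_nonneg (abs_nonneg b)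
      (Real.rpow_nonneg (abs_nonneg a) p) hpq
    rw [← Real.rpow_mul (abs_nonneg a), mul_div_cancel₀ _ hp.ne'] at h1
    have h2 : Phi p a * b ≤ |b| * |a| ^ p := by
      refine (le_abs_self _).trans (le_of_eq ?_)
      rw [abs_mul, abs_Phi hp, mul_comm]
    have h3 : Phi p a * a = |a| ^ (1 + p) := by
      rw [Phi, mul_assoc, ← abs_mul_abs_self a]
      rcases (abs_nonneg a).eq_or_lt with h | h
      · rw [← h]; simp [Real.zero_rpow (show 1 + p ≠ 0 by linarith)]
      · rw [Real.rpow_sub_one h.ne', add_comm, Real.rpow_add_one h.ne']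
        field_simp
    have h4 : |a| ^ (1 + p) = |a| ^ (1 + p) / (1 + p) + |a| ^ (1 + p) / ((1 + p) / p) := by
      field_simp
    rw [mul_sub, h3]
    linarith

end Power

/-! ### The integral of the positive part by duality with test functions -/

section Duality

variable {n : ℕ} {Ω : Set (Rn n)}

theorem exists_isTest_one_on {U k : Set (Rn n)} (hU : IsOpen U) (hk : IsClosed k) (hkU : k ⊆ U)
    (hUb : Bornology.IsBounded U) : ∃ ζ, IsTest U ζ ∧ (∀ x, ζ x ∈ Icc (0 : ℝ) 1) ∧
      ∀ x ∈ k, ζ x = 1 := by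
  obtain ⟨f, h0, h1, h⟩ := exists_contMDiffMap_zero_one_nhds_of_isClosed (n := (⊤ : ℕ∞))
    (modelWithCornersSelf ℝ (Rn n))
    hU.isClosed_compl hk (disjoint_compl_left_iff_subset.2 hkU)
  have hsupp : tsupport f ⊆ U := by
    intro x hx
    by_contra hxU
    have h2 : ∀ᶠ y in 𝓝 x, f y = 0 := h0.filter_mono (nhds_le_nhdsSet hxU)
    exact (notMem_tsupport_iff_eventuallyEq.2 h2) hx
  refine ⟨f, ⟨f.contMDiff.contDiff, ?_, hsupp⟩, h, fun x hx => h1.self_of_nhdsSet x hx⟩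
  exact Metric.isCompact_of_isClosed_isBounded (isClosed_tsupport _) (hUb.subset hsupp)

/-- The indicator of `A = {g > 0}` in `Ω` is approximated by a cutoff that is `1` on a compact `k ⊆
A` and supported in a slightly larger open set `U`. The errors live on `A \ k` and `U \ k`, which
have small measure, so absolute continuity of `∫ |g|` makes them at most `ε / 2` each. -/
theorem posL1_le_of_forall_isTest (hΩ : IsOpen Ω) (hΩb : Bornology.IsBounded Ω)
    {g : Lp ℝ 2 ((volume : Measure (Rn n)).restrict Ω)} {M : ℝ≥0∞}
    (h : ∀ ζ, IsTest Ω ζ → (∀ x, ζ x ∈ Icc (0 : ℝ) 1) →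
      ENNReal.ofReal (∫ x in Ω, g x * ζ x) ≤ M) : posL1 g ≤ M := by
  have hΩv : volume Ω < ⊤ := hΩb.measure_lt_top
  have : IsFiniteMeasure ((volume : Measure (Rn n)).restrict Ω) := ⟨by simpa using hΩv⟩
  have hgi : Integrable g (volume.restrict Ω) := (Lp.memLp g).integrable one_le_two
  set A : Set (Rn n) := Ω ∩ {x | 0 < g x} with hA
  have hAm : MeasurableSet A := hΩ.measurableSet.inter
    (measurableSet_lt measurable_const (Lp.stronglyMeasurable g).measurable)
  refine ENNReal.le_of_forall_pos_le_add fun ε hε _ => ?_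
  obtain ⟨δ, hδ, hsmall⟩ := exists_pos_setLIntegral_lt_of_measure_lt
    (f := fun x => ‖g x‖ₑ) (μ := volume.restrict Ω) hgi.2.ne (ε := (ε : ℝ≥0∞) / 2)
    (ENNReal.half_pos (by exact_mod_cast hε.ne')).ne'
  obtain ⟨k, hkA, hk, hkδ⟩ := hAm.exists_isCompact_sdiff_lt
    ((measure_mono inter_subset_left).trans_lt hΩv).ne hδ.ne'
  obtain ⟨U, hkU, hU, hUδ⟩ := k.exists_isOpen_lt_add (μ := volume)
    (hk.measure_lt_top (μ := volume)).ne hδ.ne'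
  have hkΩ : k ⊆ Ω := hkA.trans inter_subset_left
  obtain ⟨ζ, hζ, hζ01, hζ1⟩ := exists_isTest_one_on (hU.inter hΩ) hk.isClosed
    (subset_inter hkU hkΩ) (hΩb.subset inter_subset_right)
  have hζΩ : IsTest Ω ζ := ⟨hζ.1, hζ.2, hζ.3.trans inter_subset_right⟩
  have hUk : volume (U \ k) < δ := by
    rw [measure_sdiff hkU hk.measurableSet.nullMeasurableSet hk.measure_lt_top.ne]
    exact ENNReal.sub_lt_of_lt_add (measure_mono hkU) (by rwa [add_comm] at hUδ)
  have hpt : ∀ x ∈ Ω, ENNReal.ofReal (g x) ≤ ENNReal.ofReal (g x * ζ x)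
      + ((A \ k).indicator (fun x => ‖g x‖ₑ) x) := by
    intro x hx
    by_cases hxk : x ∈ k
    · simp [hζ1 x hxk]
    · by_cases hxA : 0 < g x
      · rw [indicator_of_mem (show x ∈ A \ k from ⟨⟨hx, hxA⟩, hxk⟩)]
        refine le_trans ?_ le_add_self
        rw [← ofReal_norm]
        exact ENNReal.ofReal_le_ofReal (le_abs_self _)
      · rw [ENNReal.ofReal_of_nonpos (not_lt.1 hxA)]
        exact zero_le
  have hζm : Measurable ζ := hζ.contDiff.continuous.measurable
  have hgζ : Integrable (fun x => g x * ζ x) (volume.restrict Ω) :=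
    hgi.mul_bdd (c := 1) hζm.aestronglyMeasurable (Eventually.of_forall fun x => by
      rw [Real.norm_eq_abs, abs_of_nonneg (hζ01 x).1]; exact (hζ01 x).2)
  have hneg : ∫⁻ x in Ω, ENNReal.ofReal (g x * ζ x)
      ≤ ENNReal.ofReal (∫ x in Ω, g x * ζ x) + ∫⁻ x in U \ k, ‖g x‖ₑ ∂(volume.restrict Ω) := by
    have e1 : ∫⁻ x in Ω, ENNReal.ofReal (g x * ζ x)
        = ENNReal.ofReal (∫ x in Ω, max (g x * ζ x) 0) := by
      rw [ofReal_integral_eq_lintegral_ofReal hgζ.pos_part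
        (Eventually.of_forall fun x => le_max_right _ _)]
      exact lintegral_congr fun x => by simp [ENNReal.ofReal_max]
    have e2 : ∫ x in Ω, max (g x * ζ x) 0
        = (∫ x in Ω, g x * ζ x) + ∫ x in Ω, max (-(g x * ζ x)) 0 := by
      have hi : Integrable (fun x => max (-(g x * ζ x)) 0) (volume.restrict Ω) :=
        hgζ.neg.pos_part
      rw [← integral_add hgζ hi]
      refine integral_congr_ae (Eventually.of_forall fun x => ?_)
      simp only
      rcases le_total (g x * ζ x) 0 with h | h
      · rw [max_eq_right h, max_eq_left (by linarith)]; ring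
      · rw [max_eq_left h, max_eq_right (by linarith)]; ring
    rw [e1, e2]
    refine ENNReal.ofReal_add_le.trans (add_le_add le_rfl ?_)
    refine (ofReal_integral_le _).trans ?_
    rw [← lintegral_indicator (hU.measurableSet.diff hk.measurableSet)]
    refine setLIntegral_mono' hΩ.measurableSet fun x hx => ?_
    by_cases hxUk : x ∈ U \ k
    · rw [indicator_of_mem hxUk, ← ofReal_norm]
      refine ENNReal.ofReal_le_ofReal (max_le ?_ (norm_nonneg _))
      refine (neg_le_abs _).trans ?_
      rw [abs_mul, abs_of_nonneg (hζ01 x).1]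
      exact mul_le_of_le_one_right (abs_nonneg _) (hζ01 x).2
    · have h0 : 0 ≤ g x * ζ x := by
        by_cases hxk : x ∈ k
        · exact mul_nonneg (hkA hxk).2.le (hζ01 x).1
        · rw [hζ.eq_zero fun h => hxUk ⟨h.1, hxk⟩, mul_zero]
      rw [max_eq_right (by linarith)]
      simp
  have hs1 : ∫⁻ x in A \ k, ‖g x‖ₑ ∂(volume.restrict Ω) < (ε : ℝ≥0∞) / 2 :=
    hsmall _ ((Measure.restrict_apply_le _ _).trans_lt hkδ)
  have hs2 : ∫⁻ x in U \ k, ‖g x‖ₑ ∂(volume.restrict Ω) < (ε : ℝ≥0∞) / 2 :=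
    hsmall _ ((Measure.restrict_apply_le _ _).trans_lt hUk)
  calc posL1 g ≤ ∫⁻ x in Ω, (ENNReal.ofReal (g x * ζ x)
      + ((A \ k).indicator (fun x => ‖g x‖ₑ) x)) := setLIntegral_mono' hΩ.measurableSet hpt
    _ = (∫⁻ x in Ω, ENNReal.ofReal (g x * ζ x)) + ∫⁻ x in A \ k, ‖g x‖ₑ ∂(volume.restrict Ω) := by
        rw [lintegral_add_left' hgζ.1.aemeasurable.ennreal_ofReal,
          lintegral_indicator (hAm.diff hk.measurableSet)]
    _ ≤ (M + (ε : ℝ≥0∞) / 2) + (ε : ℝ≥0∞) / 2 := by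
        refine add_le_add (hneg.trans (add_le_add (h ζ hζΩ hζ01) hs2.le)) hs1.le
    _ = M + ε := by rw [add_assoc, ENNReal.add_halves]

end Duality


/-! ### Exterior values as a bounded source -/

section Exterior

variable {n : ℕ} {s : ℝ} {K : Rn n → Rn n → ℝ} {Ω : Set (Rn n)}

/-- The source `-L_K a` in `Ω` of a function `a` supported in the exterior of `Ω`. -/
noncomputable def extSource (s : ℝ) (K : Rn n → Rn n → ℝ) (Ω : Set (Rn n)) (a : Rn n → ℝ)
    (y : Rn n) : ℝ :=
  2 * ∫ x in exterior Ω, K y x * (a x / ‖x - y‖ ^ ((n : ℝ) + 2 * s))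

theorem measurableSet_exterior : MeasurableSet (exterior Ω) :=
  isClosed_closure.measurableSet.compl

/-- A bound for the kernel between `Ω` and a compact subset of the exterior of `Ω`. -/
theorem exists_kernel_bound (hs : 0 < s) (hK : IsKernel K) {S : Set (Rn n)} (hS : IsCompact S)
    (hSΩ : S ⊆ exterior Ω) : ∃ B : ℝ, 0 ≤ B ∧ ∀ y ∈ Ω, ∀ x ∈ S, ∀ c : ℝ,
      |K y x * (c / ‖x - y‖ ^ ((n : ℝ) + 2 * s))| ≤ B * |c| := by
  obtain ⟨l, L, hl, hlL, h⟩ := hK.elliptic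
  -- The compact set keeps a positive distance `r` from the closure of `Ω`, so the singularity of
  -- the kernel is never met.
  obtain ⟨r, hr, hrd⟩ := Metric.exists_pos_forall_lt_edist hS (isClosed_closure (s := Ω))
    (subset_compl_iff_disjoint_right.1 hSΩ)
  have hr' : (0 : ℝ) < r := hr
  set d : ℝ := (n : ℝ) + 2 * s with hd
  have hd0 : 0 < d := by positivity
  refine ⟨L / (r : ℝ) ^ d, div_nonneg (hl.le.trans hlL) (by positivity), fun y hy x hx c => ?_⟩
  have h1 : (r : ℝ) < ‖x - y‖ := by
    have := hrd x hx y (subset_closure hy)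
    rw [edist_dist, ← ENNReal.ofReal_coe_nnreal, ENNReal.ofReal_lt_ofReal_iff_of_nonneg hr'.le,
      dist_eq_norm] at this
    exact this
  rw [abs_mul, abs_of_nonneg (hK.nonneg _ _), abs_div, abs_of_nonneg (by positivity :
    (0 : ℝ) ≤ ‖x - y‖ ^ d), div_mul_eq_mul_div, ← mul_div_assoc]
  have := (h y x).2
  have hL0 : 0 ≤ L := hl.le.trans hlL
  gcongr

theorem aestronglyMeasurable_kernel_slice (hK : IsKernel K) :
    ∀ᵐ y : Rn n, AEStronglyMeasurable (fun x => K y x) := by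
  have h : AEStronglyMeasurable (Function.uncurry K) ((volume : Measure (Rn n)).prod volume) :=
    hK.aemeasurable.aestronglyMeasurable
  exact h.prodMk_left

theorem integrable_extSource_integrand (hs : 0 < s) (hK : IsKernel K) {S : Set (Rn n)}
    (hS : IsCompact S) (hSΩ : S ⊆ exterior Ω) {a : Rn n → ℝ} (ha : AEStronglyMeasurable a)
    {A : ℝ} (haA : ∀ x, |a x| ≤ A) (haS : ∀ x ∉ S, a x = 0) :
    ∀ᵐ y : Rn n, y ∈ Ω → Integrable fun x => K y x * (a x / ‖x - y‖ ^ ((n : ℝ) + 2 * s)) := by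
  obtain ⟨B, hB0, hB⟩ := exists_kernel_bound hs hK hS hSΩ
  filter_upwards [aestronglyMeasurable_kernel_slice hK] with y hKy hy
  have hm : AEStronglyMeasurable (fun x => K y x * (a x / ‖x - y‖ ^ ((n : ℝ) + 2 * s))) := by
    refine hKy.mul (ha.div₀ ?_)
    exact (Measurable.pow_const (by fun_prop) _).aestronglyMeasurable
  have hi : Integrable (S.indicator fun _ => B * A) :=
    (integrable_indicator_iff hS.measurableSet).2 (integrableOn_const hS.measure_lt_top.ne)
  refine hi.mono' hm (Eventually.of_forall fun x => ?_)
  by_cases hx : x ∈ S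
  · rw [indicator_of_mem hx]
    exact (hB y hy x hx (a x)).trans (by gcongr; exact haA x)
  · rw [indicator_of_notMem hx, haS x hx]
    simp

theorem exists_extSource_bound (hs : 0 < s) (hK : IsKernel K) {S : Set (Rn n)}
    (hS : IsCompact S) (hSΩ : S ⊆ exterior Ω) (A : ℝ) : ∃ B : ℝ, ∀ a : Rn n → ℝ,
      (∀ x, |a x| ≤ A) → (∀ x ∉ S, a x = 0) → ∀ y ∈ Ω, |extSource s K Ω a y| ≤ B := by
  obtain ⟨B, hB0, hB⟩ := exists_kernel_bound hs hK hS hSΩ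
  refine ⟨2 * (B * A * (volume.restrict (exterior Ω)).real S), fun a haA haS y hy => ?_⟩
  unfold extSource
  rw [abs_mul, abs_two]
  gcongr
  have e1 : ∫ x in exterior Ω, K y x * (a x / ‖x - y‖ ^ ((n : ℝ) + 2 * s))
      = ∫ x in S, K y x * (a x / ‖x - y‖ ^ ((n : ℝ) + 2 * s)) ∂(volume.restrict (exterior Ω)) := by
    refine (setIntegral_eq_integral_of_forall_compl_eq_zero fun x hx => ?_).symm
    rw [haS x hx]; simp
  rw [e1, ← Real.norm_eq_abs]
  refine norm_setIntegral_le_of_norm_le_const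
    ((Measure.restrict_apply_le _ _).trans_lt hS.measure_lt_top) fun x hx => ?_
  exact (hB y hy x hx (a x)).trans (by gcongr; exact haA x)

/-- Since `a ζ = 0`, the product of differences is `-a(y)ζ(x) - a(x)ζ(y)`. The two terms have equal
integrals by symmetry of `K`, which explains the factor `2` in `extSource`; Fubini applies because
the kernel is bounded on the product of the supports. -/
theorem bilin_exterior (hΩ : MeasurableSet Ω) (hs : 0 < s) (hK : IsKernel K) {S : Set (Rn n)}
    (hS : IsCompact S) (hSΩ : S ⊆ exterior Ω) {a : Rn n → ℝ} (ha : AEStronglyMeasurable a)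
    {A : ℝ} (haA : ∀ x, |a x| ≤ A) (haS : ∀ x ∉ S, a x = 0) {ζ : Rn n → ℝ} (hζ : IsTest Ω ζ) :
    bilin s K a ζ = -∫ y in Ω, extSource s K Ω a y * ζ y := by
  set d : ℝ := (n : ℝ) + 2 * s with hd
  set k : Rn n × Rn n → ℝ := fun p => K p.1 p.2 * (a p.2 / ‖p.2 - p.1‖ ^ d) * ζ p.1 with hk
  have hΩS : ∀ x ∈ Ω, a x = 0 := fun x hx => haS x fun h => hSΩ h (subset_closure hx)
  obtain ⟨B, hB0, hB⟩ := exists_kernel_bound hs hK hS hSΩ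
  obtain ⟨Z, hZ⟩ := hζ.contDiff.continuous.bounded_above_of_compact_support hζ.hasCompactSupport
  have hζm : AEStronglyMeasurable ζ := hζ.contDiff.continuous.aestronglyMeasurable
  have hZc : IsCompact (tsupport ζ) := hζ.hasCompactSupport
  have hkm : AEStronglyMeasurable k := by
    refine AEStronglyMeasurable.mul (hK.aemeasurable.aestronglyMeasurable.mul
      (AEStronglyMeasurable.div₀ ?_ ?_)) ?_
    · exact ha.comp_quasiMeasurePreserving Measure.quasiMeasurePreserving_snd
    · exact (Measurable.pow_const (by fun_prop) _).aestronglyMeasurable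
    · exact hζm.comp_quasiMeasurePreserving Measure.quasiMeasurePreserving_fst
  have hki : Integrable k := by
    have hi : Integrable ((tsupport ζ ×ˢ S).indicator fun _ => B * A * Z) := by
      refine (integrable_indicator_iff (hZc.measurableSet.prod hS.measurableSet)).2
        (integrableOn_const ?_)
      exact (hZc.prod hS).measure_lt_top.ne
    refine hi.mono' hkm (Eventually.of_forall fun p => ?_)
    by_cases hp : p ∈ tsupport ζ ×ˢ S
    · rw [indicator_of_mem hp]
      simp only [hk, norm_mul]
      have h1 := hB p.1 (hζ.tsupport_subset hp.1) p.2 hp.2 (a p.2)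
      rw [abs_mul] at h1
      have hA0 : 0 ≤ A := (abs_nonneg _).trans (haA p.2)
      refine mul_le_mul ?_ (hZ _) (norm_nonneg _) (by positivity)
      exact h1.trans (by gcongr; exact haA _)
    · rw [indicator_of_notMem hp]
      rw [mem_prod, not_and_or] at hp
      rcases hp with hp | hp
      · simp [hk, image_eq_zero_of_notMem_tsupport hp]
      · simp [hk, haS _ hp]
  have hks : Integrable fun p : Rn n × Rn n => k p.swap := hki.swap
  have e1 : bilin s K a ζ = ∫ p, -(k p + k p.swap) := by
    refine integral_congr_ae (Eventually.of_forall fun p => ?_)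
    have h1 : ∀ x, a x * ζ x = 0 := fun x => by
      by_cases hx : x ∈ Ω
      · rw [hΩS x hx, zero_mul]
      · rw [hζ.eq_zero hx, mul_zero]
    have h2 : (a p.1 - a p.2) * (ζ p.1 - ζ p.2) = -(a p.2 * ζ p.1) - a p.1 * ζ p.2 := by
      linear_combination h1 p.1 + h1 p.2
    simp only [hk, Prod.fst_swap, Prod.snd_swap]
    rw [h2, hK.symm p.2 p.1, norm_sub_rev p.2 p.1]
    ring
  have e2 : ∫ p : Rn n × Rn n, k p.swap = ∫ p, k p := integral_prod_swap k
  have e3 : ∫ p, k p = ∫ y, ∫ x, k (y, x) := integral_prod k hki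
  rw [e1, integral_neg, integral_add hki hks, e2, e3]
  have e4 : ∀ y, ∫ x, k (y, x) = Ω.indicator (fun y => extSource s K Ω a y * ζ y / 2) y := by
    intro y
    by_cases hy : y ∈ Ω
    · rw [indicator_of_mem hy]
      simp only [hk, extSource]
      rw [integral_mul_const, setIntegral_eq_integral_of_forall_compl_eq_zero]
      · ring
      · intro x hx
        rw [haS x fun h => hx (hSΩ h)]; simp
    · rw [indicator_of_notMem hy]
      simp [hk, hζ.eq_zero hy]
  simp_rw [e4]
  rw [integral_indicator hΩ, integral_div]
  ring

theorem aestronglyMeasurable_extSource (hK : IsKernel K) {a : ℝ → Rn n → ℝ}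
    (ha : Measurable (Function.uncurry a)) {ν : Measure ℝ} :
    AEStronglyMeasurable (Function.uncurry fun t => extSource s K Ω (a t))
      (ν.prod (volume.restrict Ω)) := by
  have hKm : AEMeasurable (Function.uncurry K) ((volume : Measure (Rn n)).prod volume) :=
    hK.aemeasurable
  -- `K` is only a.e. measurable; a measurable representative gives the same integral for a.e. `y`.
  set K' := hKm.mk with hK'
  have hm : Measurable fun q : (ℝ × Rn n) × Rn n =>
      K' (q.1.2, q.2) * (a q.1.1 q.2 / ‖q.2 - q.1.2‖ ^ ((n : ℝ) + 2 * s)) := by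
    refine (hKm.measurable_mk.comp (by fun_prop)).mul (Measurable.div ?_ ?_)
    · exact ha.comp (g := Function.uncurry a) (f := fun q : (ℝ × Rn n) × Rn n => (q.1.1, q.2))
        (by fun_prop)
    · exact Measurable.pow_const (by fun_prop) _
  have hs := hm.stronglyMeasurable.integral_prod_right' (ν := volume.restrict (exterior Ω))
  refine (hs.const_mul 2).aestronglyMeasurable.congr ?_
  have h1 : ∀ᵐ y : Rn n, ∀ᵐ x : Rn n, Function.uncurry K (y, x) = K' (y, x) :=
    Measure.ae_ae_of_ae_prod hKm.ae_eq_mk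
  have h2 : ∀ᵐ p ∂(ν.prod (volume.restrict Ω)), ∀ᵐ x : Rn n,
      Function.uncurry K (p.2, x) = K' (p.2, x) :=
    Measure.quasiMeasurePreserving_snd.ae (ae_restrict_of_ae h1)
  filter_upwards [h2] with p hp
  simp only [Function.uncurry, extSource]
  congr 1
  refine integral_congr_ae ?_
  filter_upwards [ae_restrict_of_ae hp] with x hx
  rw [← hx]
  rfl

/-- The kernel is nonnegative, so the positive part passes inside the integral, and its upper bound
`L` then yields the constant `2 * L`. -/
theorem ofReal_extSource_sub_le (hs : 0 < s) {L : ℝ} (hK : IsKernel K)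
    (hL : ∀ x y, K x y ≤ L) (hL0 : 0 ≤ L) {S₁ S₂ : Set (Rn n)}
    (hS₁ : IsCompact S₁) (hSΩ₁ : S₁ ⊆ exterior Ω) (hS₂ : IsCompact S₂) (hSΩ₂ : S₂ ⊆ exterior Ω)
    {a₁ a₂ : Rn n → ℝ} (ha₁ : AEStronglyMeasurable a₁) (ha₂ : AEStronglyMeasurable a₂)
    {A₁ A₂ : ℝ} (haA₁ : ∀ x, |a₁ x| ≤ A₁) (haS₁ : ∀ x ∉ S₁, a₁ x = 0) (haA₂ : ∀ x, |a₂ x| ≤ A₂)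
    (haS₂ : ∀ x ∉ S₂, a₂ x = 0) :
    ∀ᵐ y : Rn n, y ∈ Ω → ENNReal.ofReal (extSource s K Ω a₁ y - extSource s K Ω a₂ y)
      ≤ ENNReal.ofReal (2 * L) * ∫⁻ x in exterior Ω, ENNReal.ofReal (a₁ x - a₂ x)
        / ENNReal.ofReal (‖x - y‖ ^ ((n : ℝ) + 2 * s)) := by
  filter_upwards [integrable_extSource_integrand hs hK hS₁ hSΩ₁ ha₁ haA₁ haS₁,
    integrable_extSource_integrand hs hK hS₂ hSΩ₂ ha₂ haA₂ haS₂] with y h1 h2 hy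
  unfold extSource
  rw [← mul_sub, ← integral_sub (h1 hy).integrableOn (h2 hy).integrableOn,
    ENNReal.ofReal_mul zero_le_two, ENNReal.ofReal_mul zero_le_two, mul_assoc,
    ← lintegral_const_mul' _ _ ENNReal.ofReal_ne_top]
  refine mul_le_mul_right ((ofReal_integral_le _).trans ?_) _
  refine setLIntegral_mono' measurableSet_exterior fun x hx => ?_
  have hxy : 0 < ‖x - y‖ :=
    norm_pos_iff.2 (sub_ne_zero.2 fun h => hx (subset_closure (h ▸ hy)))
  rw [← ENNReal.ofReal_div_of_pos (by positivity), ← ENNReal.ofReal_mul hL0, ← mul_sub, ← sub_div]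
  rcases le_total (a₁ x - a₂ x) 0 with h | h
  · rw [ENNReal.ofReal_of_nonpos]
    · exact zero_le
    · exact mul_nonpos_of_nonneg_of_nonpos (hK.nonneg _ _) (div_nonpos_of_nonpos_of_nonneg h
        (by positivity))
  · refine ENNReal.ofReal_le_ofReal ?_
    gcongr
    exact hL _ _

end Exterior


/-! ### Weak solutions as solutions of the abstract evolution equation -/

section Reduction

variable {n : ℕ} {s T m : ℝ} {K : Rn n → Rn n → ℝ} {Ω : Set (Rn n)}

theorem superpose_lpOf {α : Type*} [MeasurableSpace α] {μ : Measure α} [IsFiniteMeasure μ]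
    {β j : ℝ → ℝ} (hβ : IsNonlinearity β j) {f : α → ℝ} (hf : MemLp f 2 μ) :
    superpose hβ (lpOf μ f) = lpOf μ fun x => β (f x) := by
  refine Lp.ext ?_
  filter_upwards [coeFn_superpose hβ (lpOf μ f), coeFn_lpOf hf, coeFn_lpOf (hβ.memLp_comp hf)]
    with x h1 h2 h3
  rw [h1, h2, h3]

theorem secondCountable_Lp {α : Type*} [MeasurableSpace α]
    [MeasurableSpace.CountablyGenerated α] (μ : Measure α) [SFinite μ] :
    SecondCountableTopology (Lp ℝ 2 μ) :=
  haveI : Fact ((2 : ℝ≥0∞) ≠ ⊤) := ⟨ENNReal.ofNat_ne_top⟩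
  inferInstance

theorem isFiniteMeasure_restrict (hΩb : Bornology.IsBounded Ω) :
    IsFiniteMeasure ((volume : Measure (Rn n)).restrict Ω) :=
  ⟨by simpa using hΩb.measure_lt_top⟩

theorem MemL2Cyl.lintegral_lt_top {F : ℝ → Rn n → ℝ} (hF : MemL2Cyl T Ω F) :
    ∫⁻ t in Ioo 0 T, ∫⁻ x in Ω, ‖F t x‖ₑ ^ 2 < ⊤ := by
  have h := (memLp_two_iff_lintegral hF.1).1 hF
  rwa [cylMeasure, lintegral_prod _ (hF.1.enorm.pow_const 2)] at h

theorem MemL2Cyl.ae_memLp {F : ℝ → Rn n → ℝ} (hF : MemL2Cyl T Ω F) :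
    ∀ᵐ t ∂(volume.restrict (Ioo 0 T)), MemLp (F t) 2 (volume.restrict Ω) := by
  have h0 : AEMeasurable (fun p : ℝ × Rn n => ‖Function.uncurry F p‖ₑ ^ 2)
      ((volume.restrict (Ioo 0 T)).prod (volume.restrict Ω)) := hF.1.enorm.pow_const 2
  have h1 : AEStronglyMeasurable (Function.uncurry F)
      ((volume.restrict (Ioo 0 T)).prod (volume.restrict Ω)) := hF.1
  filter_upwards [ae_lt_top' h0.lintegral_prod_right' hF.lintegral_lt_top.ne, h1.prodMk_left]
    with t h2 h3
  exact (memLp_two_iff_lintegral h3).2 h2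

theorem MemL2Cyl.memLp_slices {F : ℝ → Rn n → ℝ} (hF : MemL2Cyl T Ω F) :
    MemLp (fun t => lpOf (volume.restrict Ω) (F t)) 2 (volume.restrict (Ioo 0 T)) :=
  haveI := secondCountable_Lp ((volume : Measure (Rn n)).restrict Ω)
  memLp_lpOf hF.1 hF.lintegral_lt_top

theorem IsTest.memLp {ζ : Rn n → ℝ} (hζ : IsTest Ω ζ) : MemLp ζ 2 :=
  hζ.contDiff.continuous.memLp_of_hasCompactSupport hζ.hasCompactSupport

theorem hasCompactSupport_mul {η : ℝ → ℝ} (hη : HasCompactSupport η) {ζ : Rn n → ℝ}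
    (hζ : HasCompactSupport ζ) : HasCompactSupport fun p : ℝ × Rn n => η p.1 * ζ p.2 := by
  refine HasCompactSupport.intro (IsCompact.prod hη hζ) fun p hp => ?_
  by_cases h : p.1 ∈ tsupport η
  · rw [image_eq_zero_of_notMem_tsupport fun h' => hp ⟨h, h'⟩, mul_zero]
  · rw [image_eq_zero_of_notMem_tsupport h, zero_mul]

theorem cylMeasure_eq_restrict (T : ℝ) (A : Set (Rn n)) :
    cylMeasure T A = (volume : Measure (ℝ × Rn n)).restrict (Ioo 0 T ×ˢ A) :=
  Measure.prod_restrict _ _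

theorem MemL2Cyl.integral_mul_test {F : ℝ → Rn n → ℝ} (hF : MemL2Cyl T Ω F) {η : ℝ → ℝ}
    (hη : Continuous η) (hηc : HasCompactSupport η) {ζ : Rn n → ℝ} (hζ : IsTest Ω ζ) :
    ∫ p, F p.1 p.2 * (η p.1 * ζ p.2) ∂(cylMeasure T Ω)
      = ∫ t in Ioo 0 T, inner ℝ (lpOf (volume.restrict Ω) (F t)) (lpOf _ ζ) * η t := by
  have h1 : MemLp (fun p : ℝ × Rn n => η p.1 * ζ p.2) 2 (cylMeasure T Ω) := by
    rw [cylMeasure_eq_restrict]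
    have h0 : Continuous fun p : ℝ × Rn n => η p.1 * ζ p.2 :=
      (hη.comp continuous_fst).mul (hζ.contDiff.continuous.comp continuous_snd)
    exact (h0.memLp_of_hasCompactSupport
      (hasCompactSupport_mul hηc hζ.hasCompactSupport)).restrict _
  have h2 : Integrable (fun p : ℝ × Rn n => F p.1 p.2 * (η p.1 * ζ p.2)) (cylMeasure T Ω) :=
    MemLp.integrable_mul hF h1
  rw [cylMeasure] at h2 ⊢
  rw [integral_prod _ h2]
  refine integral_congr_ae ?_
  filter_upwards [hF.ae_memLp] with t ht
  rw [inner_lpOf ht (hζ.memLp.restrict Ω), ← integral_mul_const]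
  exact integral_congr_ae (Eventually.of_forall fun x => by simp only; ring)

theorem MemL2Hs.memL2Cyl {w : ℝ → Rn n → ℝ} (hw : MemL2Hs s T w) (Ω : Set (Rn n)) :
    MemL2Cyl T Ω w := by
  have h1 : AEStronglyMeasurable (Function.uncurry w) (cylMeasure T Ω) := by
    refine hw.1.mono_measure ?_
    rw [cylMeasure_eq_restrict, cylMeasure_eq_restrict]
    exact Measure.restrict_mono (prod_mono le_rfl (subset_univ _)) le_rfl
  refine (memLp_two_iff_lintegral h1).2 ?_
  rw [cylMeasure, lintegral_prod _ (by rw [cylMeasure] at h1; exact h1.enorm.pow_const 2)]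
  refine lt_of_le_of_lt (lintegral_mono fun t => ?_) hw.2.2
  exact (setLIntegral_le_lintegral Ω _).trans (lintegral_enorm_sq_le_hsNormSq _)

theorem MemL2Hs.memLp_nlGrad (hK : IsKernel K) {w : ℝ → Rn n → ℝ} (hw : MemL2Hs s T w) :
    MemLp (fun t => lpOf (volume : Measure (Rn n × Rn n)) (nlGrad s K (w t))) 2
      (volume.restrict (Ioo 0 T)) := by
  obtain ⟨C, hC, h⟩ := exists_lintegral_nlGrad_le hK s
  have hm : AEStronglyMeasurable (Function.uncurry w)
      ((volume.restrict (Ioo 0 T)).prod (volume : Measure (Rn n))) := by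
    have := hw.1
    rwa [cylMeasure, Measure.restrict_univ] at this
  -- The maps `(t, (x, y)) ↦ (t, x)` and `(t, (x, y)) ↦ (t, y)` pull null sets back to null sets, so
  -- joint measurability of `w` passes to both terms of the gradient.
  have q1 : Measure.QuasiMeasurePreserving (fun q : ℝ × (Rn n × Rn n) => (q.1, q.2.1))
      ((volume.restrict (Ioo 0 T)).prod (volume : Measure (Rn n × Rn n)))
      ((volume.restrict (Ioo 0 T)).prod (volume : Measure (Rn n))) :=
    Measure.quasiMeasurePreserving_fst.comp
      (measurePreserving_prodAssoc _ _ _).symm.quasiMeasurePreserving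
  have q2 : Measure.QuasiMeasurePreserving (fun q : ℝ × (Rn n × Rn n) => (q.1, q.2.2))
      ((volume.restrict (Ioo 0 T)).prod (volume : Measure (Rn n × Rn n)))
      ((volume.restrict (Ioo 0 T)).prod (volume : Measure (Rn n))) :=
    q1.comp ((MeasurePreserving.id _).prod
      (Measure.measurePreserving_swap (μ := (volume : Measure (Rn n)))
        (ν := (volume : Measure (Rn n))))).quasiMeasurePreserving
  have := secondCountable_Lp (volume : Measure (Rn n × Rn n))
  refine memLp_lpOf ?_ ?_
  · refine AEStronglyMeasurable.mul ?_ ((hm.comp_quasiMeasurePreserving q1).sub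
      (hm.comp_quasiMeasurePreserving q2))
    exact (aemeasurable_sqrtKernel hK).aestronglyMeasurable.comp_quasiMeasurePreserving
      Measure.quasiMeasurePreserving_snd
  · calc _ ≤ ∫⁻ t in Ioo 0 T, ENNReal.ofReal C * hsNormSq s (w t) := by
          refine lintegral_mono_ae ?_
          filter_upwards [hw.2.1] with t ht
          refine (h _ ht.1).trans ?_
          gcongr
          exact le_add_self
      _ = ENNReal.ofReal C * ∫⁻ t in Ioo 0 T, hsNormSq s (w t) :=
          lintegral_const_mul' _ _ ENNReal.ofReal_ne_top
      _ < ⊤ := ENNReal.mul_lt_top ENNReal.ofReal_lt_top hw.2.2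

/-- `Φ^m` of the exterior value, extended by zero to all times. -/
noncomputable def extValue (m T : ℝ) (φ : ℝ → Rn n → ℝ) (t : ℝ) (x : Rn n) : ℝ :=
  (Icc 0 T).indicator (fun t => Phi m (φ t x)) t

theorem extValue_of_mem {φ : ℝ → Rn n → ℝ} {t : ℝ} (ht : t ∈ Ioo 0 T) (x : Rn n) :
    extValue m T φ t x = Phi m (φ t x) :=
  indicator_of_mem (Ioo_subset_Icc_self ht) _

theorem measurable_extValue (hm : 1 < m) {φ : ℝ → Rn n → ℝ} (hφ : MemCcExterior T Ω φ) :
    Measurable (Function.uncurry (extValue m T φ)) := by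
  classical
  have h1 : ContinuousOn (fun p : ℝ × Rn n => Phi m (Function.uncurry φ p)) (Icc 0 T ×ˢ univ) :=
    (continuous_Phi hm).comp_continuousOn hφ.1
  have h2 := h1.measurable_piecewise (g := fun _ => 0) continuousOn_const
    (measurableSet_Icc.prod MeasurableSet.univ)
  have h3 : Function.uncurry (extValue m T φ) = (Icc 0 T ×ˢ univ).piecewise
      (fun p : ℝ × Rn n => Phi m (Function.uncurry φ p)) fun _ => 0 := by
    ext p
    by_cases ht : p.1 ∈ Icc 0 T
    · rw [piecewise_eq_of_mem _ _ _ (show p ∈ Icc 0 T ×ˢ univ from ⟨ht, mem_univ _⟩)]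
      exact indicator_of_mem ht fun t => Phi m (φ t p.2)
    · rw [piecewise_eq_of_notMem _ _ _ fun h => ht h.1]
      exact indicator_of_notMem ht fun t => Phi m (φ t p.2)
  rw [h3]
  exact h2

theorem exists_extValue_bound (hm : 1 < m) {φ : ℝ → Rn n → ℝ} (hφ : MemCcExterior T Ω φ) :
    ∃ S : Set (Rn n), IsCompact S ∧ S ⊆ exterior Ω ∧ ∃ A : ℝ, ∀ t,
      (∀ x, |extValue m T φ t x| ≤ A) ∧ ∀ x ∉ S, extValue m T φ t x = 0 := by
  obtain ⟨S, hS, hSΩ, h0⟩ := hφ.2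
  have h1 : ContinuousOn (fun p : ℝ × Rn n => Phi m (Function.uncurry φ p)) (Icc 0 T ×ˢ S) :=
    ((continuous_Phi hm).comp_continuousOn hφ.1).mono (prod_mono le_rfl (subset_univ _))
  obtain ⟨A, hA⟩ := (isCompact_Icc.prod hS).exists_bound_of_continuousOn h1
  have hz : ∀ t, ∀ x ∉ S, extValue m T φ t x = 0 := fun t x hx => by
    by_cases ht : t ∈ Icc 0 T
    · rw [extValue, indicator_of_mem ht, h0 t ht x hx, Phi_zero]
    · exact indicator_of_notMem ht _
  refine ⟨S, hS, hSΩ, |A|, fun t => ⟨fun x => ?_, hz t⟩⟩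
  by_cases hx : x ∈ S
  · by_cases ht : t ∈ Icc 0 T
    · rw [extValue, indicator_of_mem ht]
      exact (hA (t, x) ⟨ht, hx⟩).trans (le_abs_self A)
    · rw [extValue, indicator_of_notMem ht, abs_zero]
      exact abs_nonneg _
  · rw [hz t x hx, abs_zero]
    exact abs_nonneg _

theorem memL2Cyl_extSource (hΩ : MeasurableSet Ω) (hΩb : Bornology.IsBounded Ω) (hs : 0 < s)
    (hm : 1 < m) (hK : IsKernel K) {φ : ℝ → Rn n → ℝ} (hφ : MemCcExterior T Ω φ) :
    MemL2Cyl T Ω fun t => extSource s K Ω (extValue m T φ t) := by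
  have := isFiniteMeasure_restrict hΩb
  obtain ⟨S, hS, hSΩ, A, hA⟩ := exists_extValue_bound hm hφ
  obtain ⟨B, hB⟩ := exists_extSource_bound hs hK hS hSΩ A
  unfold MemL2Cyl cylMeasure
  refine MemLp.of_bound (aestronglyMeasurable_extSource hK (measurable_extValue hm hφ)) B ?_
  have h : ∀ᵐ p ∂((volume.restrict (Ioo 0 T)).prod ((volume : Measure (Rn n)).restrict Ω)),
      p.2 ∈ Ω := Measure.quasiMeasurePreserving_snd.ae (ae_restrict_mem hΩ)
  filter_upwards [h] with p hp
  exact hB _ (hA p.1).1 (hA p.1).2 p.2 hp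

end Reduction


/-! ### Transformation of the weak formulation to zero exterior values -/

section Equation

variable {n : ℕ} {s T m : ℝ} {K : Rn n → Rn n → ℝ} {Ω : Set (Rn n)}
  {F φ u : ℝ → Rn n → ℝ} {u₀ : Rn n → ℝ}

theorem MemCcExterior.eq_zero_of_mem (hφ : MemCcExterior T Ω φ) {t : ℝ} (ht : t ∈ Ioo 0 T)
    {x : Rn n} (hx : x ∈ Ω) : φ t x = 0 := by
  obtain ⟨S, -, hS, h⟩ := hφ.2
  exact h t (Ioo_subset_Icc_self ht) x fun h' => hS h' (subset_closure hx)

/-- Rewriting `u` in this form on `Ω` exhibits it as `β(w)` with `w ∈ L²(Ω_T)`, from which its own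
square integrability follows. -/
theorem MemCcExterior.eq_Phi_inv (hm : 1 < m) (hφ : MemCcExterior T Ω φ) {t : ℝ}
    (ht : t ∈ Ioo 0 T) {x : Rn n} (hx : x ∈ Ω) :
    Phi m⁻¹ (Phi m (u t x - φ t x)) = u t x := by
  rw [Phi_inv_Phi (by linarith), hφ.eq_zero_of_mem ht hx, sub_zero]

/-- Splitting of the pressure into a part vanishing outside `Ω` and the exterior value. -/
theorem MemCcExterior.Phi_eq_add (hm : 1 < m) (hΩ : MeasurableSet Ω) (hφ : MemCcExterior T Ω φ)
    {t : ℝ} (ht : t ∈ Ioo 0 T) (hu : MemHsTilde s Ω fun x => Phi m (u t x - φ t x)) :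
    (fun x => Phi m (u t x)) =ᵐ[volume]
      fun x => Phi m (u t x - φ t x) + extValue m T φ t x := by
  filter_upwards [hu.ae_eq_zero hΩ] with x hx
  rw [extValue_of_mem ht]
  by_cases h : x ∈ Ω
  · rw [hφ.eq_zero_of_mem ht h, sub_zero, Phi_zero, add_zero]
  · have h1 := hx h
    have h2 : u t x - φ t x = 0 := by
      -- Outside `Ω` the pressure of `u - φ` vanishes, and injectivity of `Φ^m` gives `u = φ`.
      rw [← Phi_inv_Phi (show 0 < m by linarith) (u t x - φ t x), h1, Phi_zero]
    rw [h1, zero_add, sub_eq_zero.1 h2]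

theorem bilin_smul_right (u v : Rn n → ℝ) (c : ℝ) :
    bilin s K u (fun x => c * v x) = bilin s K u v * c := by
  unfold bilin
  rw [← integral_mul_const]
  refine integral_congr_ae (Eventually.of_forall fun p => ?_)
  simp only
  ring

/-- The weak formulation, tested with products. -/
theorem IsWeakSolution.equation_mul [IsFiniteMeasure ((volume : Measure (Rn n)).restrict Ω)]
    (hΩ : MeasurableSet Ω) (hm : 1 < m) (hd : IsAdmissibleData s T Ω (Phi m) F φ u₀)
    (hu : IsWeakSolution s T Ω K (Phi m) F φ u₀ u)
    (hu' : MemL2Cyl T Ω fun t x => Phi m⁻¹ (Phi m (u t x - φ t x)))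
    (hu₀ : MemLp u₀ 2 (volume.restrict Ω)) {η : ℝ → ℝ} (hη : ContDiff ℝ ∞ η)
    (hηc : HasCompactSupport η) (hηT : tsupport η ⊆ Iio T) {ζ : Rn n → ℝ} (hζ : IsTest Ω ζ) :
    -(∫ t in Ioo 0 T, inner ℝ (lpOf (volume.restrict Ω)
          fun x => Phi m⁻¹ (Phi m (u t x - φ t x))) (lpOf _ ζ) * deriv η t)
        + ∫ t in Ioo 0 T, bilin s K (fun x => Phi m (u t x)) ζ * η t
      = (∫ t in Ioo 0 T, inner ℝ (lpOf (volume.restrict Ω) (F t)) (lpOf _ ζ) * η t)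
        + inner ℝ (lpOf (volume.restrict Ω) u₀) (lpOf _ ζ) * η 0 := by
  have hsupp : tsupport (Function.uncurry fun t x => η t * ζ x) ⊆ tsupport η ×ˢ tsupport ζ := by
    refine closure_minimal (fun p hp => ⟨subset_tsupport _ ?_, subset_tsupport _ ?_⟩)
      ((isClosed_tsupport η).prod (isClosed_tsupport ζ))
    · exact left_ne_zero_of_mul hp
    · exact right_ne_zero_of_mul hp
  have h := hu.equation (fun t x => η t * ζ x)
    ((hη.comp contDiff_fst).mul (hζ.contDiff.comp contDiff_snd))
    (hasCompactSupport_mul hηc hζ.hasCompactSupport)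
    (hsupp.trans (prod_mono hηT hζ.tsupport_subset))
  have e1 : ∫ p, u p.1 p.2 * deriv (fun τ => η τ * ζ p.2) p.1 ∂(cylMeasure T Ω)
      = ∫ p, Phi m⁻¹ (Phi m (u p.1 p.2 - φ p.1 p.2)) * (deriv η p.1 * ζ p.2)
          ∂(cylMeasure T Ω) := by
    rw [cylMeasure_eq_restrict]
    refine setIntegral_congr_fun (measurableSet_Ioo.prod hΩ) fun p hp => ?_
    rw [hd.ext_cont.eq_Phi_inv hm hp.1 hp.2, deriv_mul_const_field]
  rw [e1, hu'.integral_mul_test (hη.continuous_deriv (by simp)) hηc.deriv hζ,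
    hd.source.integral_mul_test hη.continuous hηc hζ] at h
  rw [inner_lpOf hu₀ (hζ.memLp.restrict Ω), ← integral_mul_const]
  simp only [bilin_smul_right] at h
  rw [h]
  congr 1
  exact integral_congr_ae (Eventually.of_forall fun x => by simp only; ring)

/-- The part `w` is kept as an energy pairing, while the exterior part `a` moves to the right-hand
side as a source. -/
theorem bilin_eq_inner_sub (hn : 1 ≤ n) (hs : 0 < s) (hs1 : s < 1)
    (hΩ : MeasurableSet Ω) (hK : IsKernel K) {v w a : Rn n → ℝ}
    (hw : MemHs s w) (ha : MemHs s a) (hv : v =ᵐ[volume] fun x => w x + a x)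
    {S : Set (Rn n)} (hS : IsCompact S) (hSΩ : S ⊆ exterior Ω) {A : ℝ} (haA : ∀ x, |a x| ≤ A)
    (haS : ∀ x ∉ S, a x = 0) (hq : MemLp (extSource s K Ω a) 2 (volume.restrict Ω))
    {ζ : Rn n → ℝ} (hζ : IsTest Ω ζ) :
    bilin s K v ζ = inner ℝ (lpOf volume (nlGrad s K w)) (lpOf _ (nlGrad s K ζ))
      - inner ℝ (lpOf (volume.restrict Ω) (extSource s K Ω a)) (lpOf _ ζ) := by
  have hζg := (hζ.memHs hn hs hs1).memLp_nlGrad hK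
  rw [inner_lpOf (hw.memLp_nlGrad hK) hζg, inner_lpOf hq (hζ.memLp.restrict Ω), sub_eq_add_neg,
    ← bilin_exterior hΩ hs hK hS hSΩ ha.1 haA haS hζ, bilin_eq_integral hK, bilin_eq_integral hK]
  refine Eq.trans (integral_congr_ae ?_)
    (integral_add (MemLp.integrable_mul (hw.memLp_nlGrad hK) hζg)
      (MemLp.integrable_mul (ha.memLp_nlGrad hK) hζg))
  filter_upwards [nlGrad_congr (s := s) (K := K) hv] with p hp
  rw [hp, nlGrad_add]
  exact add_mul _ _ _

theorem Phi_inv_isNonlinearity (hm : 1 < m) :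
    IsNonlinearity (Phi m⁻¹) fun r => |r| ^ (1 + m⁻¹) / (1 + m⁻¹) :=
  isNonlinearity_Phi (inv_pos.2 (by linarith)) (inv_lt_one_of_one_lt₀ hm)

theorem MemL2Cyl.comp_nonlinearity [IsFiniteMeasure ((volume : Measure (Rn n)).restrict Ω)]
    {β j : ℝ → ℝ} (hβ : IsNonlinearity β j) {w : ℝ → Rn n → ℝ} (hw : MemL2Cyl T Ω w) :
    MemL2Cyl T Ω fun t x => β (w t x) := by
  have : IsFiniteMeasure (cylMeasure T Ω) := by unfold cylMeasure; infer_instance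
  exact hβ.memLp_comp hw

/-- The equation integrated in time, for a fixed test function. -/
theorem IsWeakSolution.ae_equation [IsFiniteMeasure ((volume : Measure (Rn n)).restrict Ω)]
    (hn : 1 ≤ n) (hs : 0 < s) (hs1 : s < 1) (hT : 0 < T) (hm : 1 < m) (hΩ : MeasurableSet Ω)
    (hΩb : Bornology.IsBounded Ω) (hK : IsKernel K)
    (hd : IsAdmissibleData s T Ω (Phi m) F φ u₀) (hu : IsWeakSolution s T Ω K (Phi m) F φ u₀ u)
    {ζ : Rn n → ℝ} (hζ : IsTest Ω ζ) :
    ∀ᵐ t, t ∈ Ioo 0 T →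
      inner ℝ (lpOf (volume.restrict Ω) fun x => Phi m⁻¹ (Phi m (u t x - φ t x))) (lpOf _ ζ)
        = inner ℝ (lpOf (volume.restrict Ω) u₀) (lpOf _ ζ)
          + ∫ τ in Ioc 0 t, (inner ℝ (lpOf (volume.restrict Ω) (F τ)
              + lpOf _ (extSource s K Ω (extValue m T φ τ))) (lpOf _ ζ)
            - inner ℝ (lpOf volume (nlGrad s K fun x => Phi m (u τ x - φ τ x)))
                (lpOf _ (nlGrad s K ζ))) := by
  have hW := hu.exterior_value
  have hu' := (hW.1.memL2Cyl Ω).comp_nonlinearity (Phi_inv_isNonlinearity hm)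
  have hu₀ : MemLp u₀ 2 (volume.restrict Ω) := hd.init_bounded.mono_exponent le_top
  have hq := memL2Cyl_extSource (T := T) hΩ hΩb hs hm hK hd.ext_cont
  have iu := (hu'.memLp_slices.integrable one_le_two).inner_const (𝕜 := ℝ)
    (lpOf (volume.restrict Ω) ζ)
  have iF := (hd.source.memLp_slices.integrable one_le_two).inner_const (𝕜 := ℝ)
    (lpOf (volume.restrict Ω) ζ)
  have iq := (hq.memLp_slices.integrable one_le_two).inner_const (𝕜 := ℝ)
    (lpOf (volume.restrict Ω) ζ)
  have iG := ((hW.1.memLp_nlGrad hK).integrable one_le_two).inner_const (𝕜 := ℝ)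
    (lpOf volume (nlGrad s K ζ))
  refine ae_eq_primitive_of_weak hT iu ?_ fun η hη hηc hηT => ?_
  · simp only [inner_add_left]
    exact (iF.add iq).sub iG
  · have h := hu.equation_mul hΩ hm hd hu' hu₀ hη hηc hηT hζ
    obtain ⟨S, hS, hSΩ, A, hA⟩ := exists_extValue_bound hm hd.ext_cont
    have e1 : ∫ t in Ioo 0 T, bilin s K (fun x => Phi m (u t x)) ζ * η t
        = ∫ t in Ioo 0 T, (inner ℝ (lpOf volume (nlGrad s K fun x => Phi m (u t x - φ t x)))
            (lpOf _ (nlGrad s K ζ))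
          - inner ℝ (lpOf (volume.restrict Ω) (extSource s K Ω (extValue m T φ t))) (lpOf _ ζ))
            * η t := by
      refine integral_congr_ae ?_
      filter_upwards [hW.2, hd.ext_sobolev.2.1, hq.ae_memLp, ae_restrict_mem measurableSet_Ioo]
        with t h1 h2 h3 ht
      have h4 : extValue m T φ t = fun x => Phi m (φ t x) := funext fun x => extValue_of_mem ht x
      rw [bilin_eq_inner_sub hn hs hs1 hΩ hK h1.1 (h4 ▸ h2)
        (hd.ext_cont.Phi_eq_add hm hΩ ht h1) hS hSΩ (hA t).1 (hA t).2 h3 hζ]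
    obtain ⟨B, hB⟩ := hη.continuous.bounded_above_of_compact_support hηc
    have hb : ∀ {g : ℝ → ℝ}, Integrable g (volume.restrict (Ioo 0 T)) →
        Integrable (fun t => g t * η t) (volume.restrict (Ioo 0 T)) := fun hg =>
      hg.mul_bdd hη.continuous.aestronglyMeasurable (Eventually.of_forall hB)
    rw [e1] at h
    have e2 : ∫ t in Ioo 0 T, (inner ℝ (lpOf (volume.restrict Ω) (F t)
              + lpOf _ (extSource s K Ω (extValue m T φ t))) (lpOf _ ζ)
            - inner ℝ (lpOf volume (nlGrad s K fun x => Phi m (u t x - φ t x)))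
                (lpOf _ (nlGrad s K ζ))) * η t
        = (∫ t in Ioo 0 T, inner ℝ (lpOf (volume.restrict Ω) (F t)) (lpOf _ ζ) * η t)
          - ∫ t in Ioo 0 T, (inner ℝ (lpOf volume (nlGrad s K fun x => Phi m (u t x - φ t x)))
            (lpOf _ (nlGrad s K ζ))
          - inner ℝ (lpOf (volume.restrict Ω) (extSource s K Ω (extValue m T φ t))) (lpOf _ ζ))
            * η t := by
      refine Eq.trans (integral_congr_ae (Eventually.of_forall fun t => ?_))
        (integral_sub (hb iF) (hb (iG.sub iq)))
      simp only [inner_add_left]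
      ring
    rw [e2]
    linarith

end Equation


/-! ### Comparison of weak solutions -/

section Comparison

variable {n : ℕ} {s T m : ℝ} {K : Rn n → Rn n → ℝ} {Ω : Set (Rn n)}

theorem inner_setIntegral {E : Type*} [NormedAddCommGroup E] [InnerProductSpace ℝ E]
    [CompleteSpace E] {g : ℝ → E} {S : Set ℝ} (hg : IntegrableOn g S) (c : E) :
    inner ℝ (∫ t in S, g t) c = ∫ t in S, inner ℝ (g t) c := by
  rw [real_inner_comm, ← integral_inner hg]
  simp only [real_inner_comm]

/-- For a fixed test function the integrated equation holds outside a null set of times. A countable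
dense set of test pairs and continuity in `ψ` give one null set valid for the whole energy space. -/
theorem IsWeakSolution.exists_isEvolution
    [IsFiniteMeasure ((volume : Measure (Rn n)).restrict Ω)]
    (hn : 1 ≤ n) (hs : 0 < s) (hs1 : s < 1) (hT : 0 < T) (hm : 1 < m) (hΩ : MeasurableSet Ω)
    (hΩb : Bornology.IsBounded Ω) (hK : IsKernel K) {F φ u : ℝ → Rn n → ℝ} {u₀ : Rn n → ℝ}
    (hd : IsAdmissibleData s T Ω (Phi m) F φ u₀) (hu : IsWeakSolution s T Ω K (Phi m) F φ u₀ u) :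
    ∃ (w : ℝ → PairSpace Ω) (f : ℝ → Lp ℝ 2 ((volume : Measure (Rn n)).restrict Ω)),
      IsEvolution (energySpace hn hs hs1 hK Ω) (Phi_inv_isNonlinearity hm) T w f (lpOf _ u₀) ∧
      (∀ᵐ t ∂(volume.restrict (Ioo 0 T)),
        superpose (Phi_inv_isNonlinearity hm) (w t).1 =ᵐ[volume.restrict Ω] u t) ∧
      ∀ᵐ t ∂(volume.restrict (Ioo 0 T)), f t =ᵐ[volume.restrict Ω]
        fun x => F t x + extSource s K Ω (extValue m T φ t) x := by
  set hβ := Phi_inv_isNonlinearity hm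
  have hW := hu.exterior_value
  have hq := memL2Cyl_extSource (T := T) hΩ hΩb hs hm hK hd.ext_cont
  have hG := hW.1.memLp_nlGrad hK
  have hf := (hd.source.memLp_slices.integrable one_le_two).add
    (hq.memLp_slices.integrable one_le_two)
  set G := fun t => lpOf (volume : Measure (Rn n × Rn n))
    (nlGrad s K fun x => Phi m (u t x - φ t x)) with hGdef
  set f₀ := fun t => lpOf ((volume : Measure (Rn n)).restrict Ω) (F t)
    + lpOf _ (extSource s K Ω (extValue m T φ t)) with hf₀
  have hGi : Integrable (hG.1.mk G) (volume.restrict (Ioo 0 T)) :=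
    (hG.integrable one_le_two).congr hG.1.ae_eq_mk
  have hI : ∀ t ∈ Ioo 0 T, Ioc 0 t ⊆ Ioo 0 T := fun t ht => Ioc_subset_Ioo_right ht.2
  have hslice : ∀ᵐ t, t ∈ Ioo 0 T → superpose hβ (lpOf (volume.restrict Ω)
      fun x => Phi m (u t x - φ t x))
        = lpOf (volume.restrict Ω) fun x => Phi m⁻¹ (Phi m (u t x - φ t x)) := by
    rw [← ae_restrict_iff' measurableSet_Ioo]
    filter_upwards [hW.2] with t ht
    exact superpose_lpOf hβ (ht.1.memLp.restrict Ω)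
  -- The gradient is replaced by a strongly measurable representative, and gradient and source are
  -- extended by zero outside `(0,T)`.
  refine ⟨fun t => (lpOf _ fun x => Phi m (u t x - φ t x), (Ioo 0 T).indicator (hG.1.mk G) t),
    (Ioo 0 T).indicator f₀, ⟨?_, ?_, ?_, ?_, ?_⟩, ?_, ?_⟩
  · exact hG.1.stronglyMeasurable_mk.indicator measurableSet_Ioo
  · exact (integrable_indicator_iff measurableSet_Ioo).2 hGi
  · exact (integrable_indicator_iff measurableSet_Ioo).2 hf
  · rw [← ae_restrict_iff' measurableSet_Ioo]
    filter_upwards [hW.2, hG.1.ae_eq_mk, ae_restrict_mem measurableSet_Ioo] with t h1 h2 ht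
    rw [indicator_of_mem ht, ← h2]
    exact h1.mem_energySpace hn hs hs1 hK
  · have := secondCountable_Lp ((volume : Measure (Rn n)).restrict Ω)
    have := secondCountable_Lp (volume : Measure (Rn n × Rn n))
    -- `D` is chosen among the test pairs, since only for these is the equation available.
    obtain ⟨D, hDsub, hDc, hDd⟩ := (TopologicalSpace.IsSeparable.of_separableSpace
      {a : PairSpace Ω | ∃ ζ, IsTest Ω ζ ∧ a = energyPair s K Ω ζ}).exists_countable_dense_subset
    have hD : ∀ᵐ t, ∀ ψ ∈ D, t ∈ Ioo 0 T →
        inner ℝ (lpOf (volume.restrict Ω) fun x => Phi m⁻¹ (Phi m (u t x - φ t x))) ψ.1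
          = inner ℝ (lpOf (volume.restrict Ω) u₀) ψ.1
            + ∫ τ in Ioc 0 t, (inner ℝ (f₀ τ) ψ.1 - inner ℝ (G τ) ψ.2) := by
      rw [ae_ball_iff hDc]
      intro ψ hψ
      obtain ⟨ζ, hζ, rfl⟩ := hDsub hψ
      exact hu.ae_equation hn hs hs1 hT hm hΩ hΩb hK hd hζ
    filter_upwards [hD, hslice] with t h1 h2 ht
    refine energySpace_subset_of_isClosed hn hs hs1 hK (S := {ψ | inner ℝ (superpose hβ
        (lpOf (volume.restrict Ω) fun x => Phi m (u t x - φ t x)) - lpOf _ u₀) ψ.1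
        + inner ℝ (∫ τ in Ioc 0 t, (Ioo 0 T).indicator (hG.1.mk G) τ) ψ.2
      = inner ℝ (∫ τ in Ioc 0 t, (Ioo 0 T).indicator f₀ τ) ψ.1})
      (isClosed_eq (by fun_prop) (by fun_prop)) ?_
    have hsub : closure D ⊆ {ψ : PairSpace Ω | inner ℝ (superpose hβ
        (lpOf (volume.restrict Ω) fun x => Phi m (u t x - φ t x)) - lpOf _ u₀) ψ.1
        + inner ℝ (∫ τ in Ioc 0 t, (Ioo 0 T).indicator (hG.1.mk G) τ) ψ.2
      = inner ℝ (∫ τ in Ioc 0 t, (Ioo 0 T).indicator f₀ τ) ψ.1} := by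
      refine closure_minimal (fun ψ hψ => ?_) (isClosed_eq (by fun_prop) (by fun_prop))
      have hfi : IntegrableOn f₀ (Ioc 0 t) := IntegrableOn.mono_set hf (hI t ht)
      have hGi' : IntegrableOn G (Ioc 0 t) :=
        IntegrableOn.mono_set (hG.integrable one_le_two) (hI t ht)
      have e1 : ∫ τ in Ioc 0 t, (Ioo 0 T).indicator (hG.1.mk G) τ = ∫ τ in Ioc 0 t, G τ := by
        refine integral_congr_ae ?_
        filter_upwards [ae_restrict_of_ae_restrict_of_subset (hI t ht) hG.1.ae_eq_mk,
          ae_restrict_mem measurableSet_Ioc] with τ h3 hτ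
        rw [indicator_of_mem (hI t ht hτ), h3]
      have e2 : ∫ τ in Ioc 0 t, (Ioo 0 T).indicator f₀ τ = ∫ τ in Ioc 0 t, f₀ τ :=
        setIntegral_congr_fun measurableSet_Ioc fun τ hτ => indicator_of_mem (hI t ht hτ) _
      have h3 := h1 ψ hψ ht
      rw [integral_sub (hfi.inner_const _) (hGi'.inner_const _), ← inner_setIntegral hfi,
        ← inner_setIntegral hGi'] at h3
      rw [mem_ofPred_eq, e1, e2, h2 ht, inner_sub_left, h3]
      ring
    exact fun ζ hζ => hsub (hDd ⟨ζ, hζ, rfl⟩)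
  · filter_upwards [ae_restrict_of_ae hslice, (hW.1.memL2Cyl Ω).comp_nonlinearity hβ |>.ae_memLp,
      ae_restrict_mem measurableSet_Ioo] with t h1 h2 ht
    rw [h1 ht]
    filter_upwards [coeFn_lpOf h2, ae_restrict_mem hΩ] with x h3 hx
    rw [h3, hd.ext_cont.eq_Phi_inv hm ht hx]
  · filter_upwards [hd.source.ae_memLp, hq.ae_memLp, ae_restrict_mem measurableSet_Ioo]
      with t h1 h2 ht
    rw [indicator_of_mem ht]
    filter_upwards [Lp.coeFn_add (lpOf (volume.restrict Ω) (F t))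
      (lpOf _ (extSource s K Ω (extValue m T φ t))), coeFn_lpOf h1, coeFn_lpOf h2] with x h3 h4 h5
    simp only [hf₀]
    rw [h3, Pi.add_apply, h4, h5]

theorem lintegral_posL1_source_le [IsFiniteMeasure ((volume : Measure (Rn n)).restrict Ω)]
    (hs : 0 < s) (hm : 1 < m) (hΩ : MeasurableSet Ω) (hK : IsKernel K) {L : ℝ}
    (hL : ∀ x y, K x y ≤ L) (hL0 : 0 ≤ L) {F₁ F₂ φ₁ φ₂ : ℝ → Rn n → ℝ}
    (hF₁ : MemL2Cyl T Ω F₁) (hF₂ : MemL2Cyl T Ω F₂)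
    (hφ₁ : MemCcExterior T Ω φ₁) (hφ₂ : MemCcExterior T Ω φ₂)
    {f₁ f₂ : ℝ → Lp ℝ 2 ((volume : Measure (Rn n)).restrict Ω)}
    (hf₁ : ∀ᵐ t ∂(volume.restrict (Ioo 0 T)), f₁ t =ᵐ[volume.restrict Ω]
        fun x => F₁ t x + extSource s K Ω (extValue m T φ₁ t) x)
    (hf₂ : ∀ᵐ t ∂(volume.restrict (Ioo 0 T)), f₂ t =ᵐ[volume.restrict Ω]
        fun x => F₂ t x + extSource s K Ω (extValue m T φ₂ t) x) :
    ∫⁻ t in Ioo 0 T, posL1 (f₁ t - f₂ t) ≤ posPartIntCyl T Ω F₁ F₂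
      + ENNReal.ofReal (2 * L) * exteriorPosPartInt s T Ω
        (fun t x => Phi m (φ₁ t x)) (fun t x => Phi m (φ₂ t x)) := by
  obtain ⟨S₁, hS₁, hSΩ₁, A₁, hA₁⟩ := exists_extValue_bound hm hφ₁
  obtain ⟨S₂, hS₂, hSΩ₂, A₂, hA₂⟩ := exists_extValue_bound hm hφ₂
  have hmF : AEMeasurable (fun p : ℝ × Rn n => ENNReal.ofReal (F₁ p.1 p.2 - F₂ p.1 p.2))
      ((volume.restrict (Ioo 0 T)).prod (volume.restrict Ω)) :=
    (hF₁.1.sub hF₂.1).aemeasurable.ennreal_ofReal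
  have hmP : AEMeasurable (fun t => posPartInt Ω (F₁ t) (F₂ t)) (volume.restrict (Ioo 0 T)) :=
    hmF.lintegral_prod_right'
  unfold posPartIntCyl exteriorPosPartInt
  rw [← lintegral_const_mul' _ _ ENNReal.ofReal_ne_top, ← lintegral_add_left' hmP]
  refine lintegral_mono_ae ?_
  have hmt : ∀ᵐ t ∂(volume.restrict (Ioo 0 T)),
      AEMeasurable (fun x => ENNReal.ofReal (F₁ t x - F₂ t x)) (volume.restrict Ω) := by
    filter_upwards [hF₁.ae_memLp, hF₂.ae_memLp] with t h1 h2
    exact (h1.1.sub h2.1).aemeasurable.ennreal_ofReal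
  filter_upwards [hf₁, hf₂, hmt, ae_restrict_mem measurableSet_Ioo] with t h1 h2 h3 ht
  unfold posL1 posPartInt
  rw [← lintegral_const_mul' _ _ ENNReal.ofReal_ne_top, ← lintegral_add_left' h3]
  have ha₁ : AEStronglyMeasurable (extValue m T φ₁ t) :=
    ((measurable_extValue hm hφ₁).comp measurable_prodMk_left).aestronglyMeasurable
  have ha₂ : AEStronglyMeasurable (extValue m T φ₂ t) :=
    ((measurable_extValue hm hφ₂).comp measurable_prodMk_left).aestronglyMeasurable
  refine lintegral_mono_ae ?_
  filter_upwards [h1, h2, Lp.coeFn_sub (f₁ t) (f₂ t), ae_restrict_mem hΩ,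
    ae_restrict_of_ae (ofReal_extSource_sub_le hs hK hL hL0 hS₁ hSΩ₁ hS₂ hSΩ₂ ha₁ ha₂
      (hA₁ t).1 (hA₁ t).2 (hA₂ t).1 (hA₂ t).2)] with y h1 h2 h3 hy h4
  rw [h3, Pi.sub_apply, h1, h2, add_sub_add_comm]
  refine ENNReal.ofReal_add_le.trans (add_le_add le_rfl ?_)
  simpa only [extValue_of_mem ht] using h4 hy

theorem IsWeakSolution.comparison (hn : 1 ≤ n) (hs : 0 < s) (hs1 : s < 1) (hT : 0 < T)
    (hm : 1 < m) (hΩ : IsOpen Ω) (hΩb : Bornology.IsBounded Ω) (hK : IsKernel K) {L : ℝ}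
    (hL : ∀ x y, K x y ≤ L) (hL0 : 0 ≤ L) {F₁ F₂ φ₁ φ₂ u₁ u₂ : ℝ → Rn n → ℝ} {v₁ v₂ : Rn n → ℝ}
    (hd₁ : IsAdmissibleData s T Ω (Phi m) F₁ φ₁ v₁)
    (hd₂ : IsAdmissibleData s T Ω (Phi m) F₂ φ₂ v₂)
    (hu₁ : IsWeakSolution s T Ω K (Phi m) F₁ φ₁ v₁ u₁)
    (hu₂ : IsWeakSolution s T Ω K (Phi m) F₂ φ₂ v₂ u₂) :
    ∀ᵐ t₀ ∂(volume.restrict (Ioo 0 T)), posPartInt Ω (u₁ t₀) (u₂ t₀)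
      ≤ posPartIntCyl T Ω F₁ F₂ + posPartInt Ω v₁ v₂ + ENNReal.ofReal (2 * L) *
        exteriorPosPartInt s T Ω (fun t x => Phi m (φ₁ t x)) (fun t x => Phi m (φ₂ t x)) := by
  have := isFiniteMeasure_restrict hΩb
  have hΩm := hΩ.measurableSet
  obtain ⟨w₁, f₁, hw₁, hwu₁, hf₁⟩ := hu₁.exists_isEvolution hn hs hs1 hT hm hΩm hΩb hK hd₁
  obtain ⟨w₂, f₂, hw₂, hwu₂, hf₂⟩ := hu₂.exists_isEvolution hn hs hs1 hT hm hΩm hΩb hK hd₂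
  obtain ⟨C, hC⟩ := exists_poincare hn hs hs1 hK hΩm hΩb
  have hv₁ : MemLp v₁ 2 (volume.restrict Ω) := hd₁.init_bounded.mono_exponent le_top
  have hv₂ : MemLp v₂ 2 (volume.restrict Ω) := hd₂.init_bounded.mono_exponent le_top
  have e1 : posL1 (lpOf (volume.restrict Ω) v₁ - lpOf _ v₂) = posPartInt Ω v₁ v₂ := by
    refine lintegral_congr_ae ?_
    filter_upwards [Lp.coeFn_sub (lpOf (volume.restrict Ω) v₁) (lpOf _ v₂), coeFn_lpOf hv₁,
      coeFn_lpOf hv₂] with x h1 h2 h3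
    rw [h1, Pi.sub_apply, h2, h3]
  filter_upwards [hwu₁, hwu₂, (isMarkov_energySpace hn hs hs1 hK Ω).comparison
    (isClosed_energySpace hn hs hs1 hK Ω) hC (Phi_inv_isNonlinearity hm) hT hw₁ hw₂]
    with t h1 h2 h3
  have e2 : posPartInt Ω (u₁ t) (u₂ t) = posL1 (superpose (Phi_inv_isNonlinearity hm) (w₁ t).1
      - superpose (Phi_inv_isNonlinearity hm) (w₂ t).1) := by
    refine lintegral_congr_ae ?_
    filter_upwards [Lp.coeFn_sub (superpose (Phi_inv_isNonlinearity hm) (w₁ t).1)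
      (superpose (Phi_inv_isNonlinearity hm) (w₂ t).1), h1, h2] with x h4 h5 h6
    rw [h4, Pi.sub_apply, h5, h6]
  rw [e2]
  -- The abstract comparison is only against elements of the energy space with values in `[0,1]`;
  -- test functions of this kind suffice.
  refine posL1_le_of_forall_isTest hΩ hΩb fun ζ hζ hζ1 => ?_
  have hζm := hζ.memLp.restrict Ω
  have h4 := h3 _ (hζ.mem_energySpace hn hs hs1 hK) (by
    filter_upwards [coeFn_lpOf hζm] with x hx
    simp only [energyPair]
    rw [hx]
    exact hζ1 x)
  have e3 : ∀ g : Lp ℝ 2 ((volume : Measure (Rn n)).restrict Ω),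
      inner ℝ g (energyPair s K Ω ζ).1 = ∫ x in Ω, g x * ζ x := fun g => by
    rw [inner_eq_integral]
    refine integral_congr_ae ?_
    filter_upwards [coeFn_lpOf hζm] with x hx
    simp only [energyPair]
    rw [hx]
  rw [e3, e1] at h4
  refine h4.trans ((add_le_add le_rfl (lintegral_posL1_source_le hs hm hΩm hK hL hL0
    hd₁.source hd₂.source hd₁.ext_cont hd₂.ext_cont hf₁ hf₂)).trans (le_of_eq ?_))
  ring

end Comparison

end NPME

/-! ### The comparison principle -/

theorem mainTheorem5 (n : ℕ) (hn : 1 ≤ n) (Ω : Set (NPME.Rn n)) (hΩ : NPME.IsBoundedLipschitz Ω)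
    (T s m : ℝ) (hT : 0 < T) (hs : 0 < s) (hs1 : s < 1) (hm : 1 < m)
    (K : NPME.Rn n → NPME.Rn n → ℝ) (hK : NPME.IsKernel K) :
    ∃ C : ℝ, 0 < C ∧
      -- the regularizations, the data and the solutions of the two problems
      ∀ (Φε : ℝ → ℝ → ℝ) (F φ : Fin 2 → ℝ → NPME.Rn n → ℝ) (u₀ : Fin 2 → NPME.Rn n → ℝ)
        (u : Fin 2 → ℝ → NPME.Rn n → ℝ),
      NPME.IsRegularization m Φε →
      (∀ j, NPME.IsAdmissibleData s T Ω (NPME.Phi m) (F j) (φ j) (u₀ j)) →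
      (∀ j, NPME.IsWeakSolution s T Ω K (NPME.Phi m) (F j) (φ j) (u₀ j) (u j)) →
      -- the data and the solutions of the regularized problems
      (∃ (Fε φε : Fin 2 → ℝ → ℝ → NPME.Rn n → ℝ) (u₀ε : Fin 2 → ℝ → NPME.Rn n → ℝ)
          (uε : Fin 2 → ℝ → ℝ → NPME.Rn n → ℝ),
        (∀ j, ∀ᶠ ε in 𝓝[>] (0 : ℝ),
          NPME.IsAdmissibleData s T Ω (Φε ε) (Fε j ε) (φε j ε) (u₀ε j ε)) ∧
        (∀ j, ∀ᶠ ε in 𝓝[>] (0 : ℝ), NPME.MemH1L2 T Ω (uε j ε) ∧ NPME.MemL2Hs s T (uε j ε)) ∧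
        liminf (fun ε => NPME.posPartIntCyl T Ω (Fε 0 ε) (Fε 1 ε)) (𝓝[>] 0)
          ≤ NPME.posPartIntCyl T Ω (F 0) (F 1) ∧
        liminf (fun ε => NPME.exteriorPosPartInt s T Ω
            (fun t x => Φε ε (φε 0 ε t x)) (fun t x => Φε ε (φε 1 ε t x))) (𝓝[>] 0)
          ≤ NPME.exteriorPosPartInt s T Ω
            (fun t x => NPME.Phi m (φ 0 t x)) (fun t x => NPME.Phi m (φ 1 t x)) ∧
        (∀ j, Tendsto (fun ε => ∫⁻ x in Ω, ‖u₀ε j ε x - u₀ j x‖ₑ) (𝓝[>] 0) (𝓝 0)) ∧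
        (∀ j, NPME.TendstoWeakL1 T Ω (uε j) (u j)) ∧
        (∀ j, ∀ᶠ ε in 𝓝[>] (0 : ℝ),
          NPME.IsWeakSolution s T Ω K (Φε ε) (Fε j ε) (φε j ε) (u₀ε j ε) (uε j ε))) →
      ∀ᵐ t₀ ∂(volume.restrict (Ioo 0 T)),
        NPME.posPartInt Ω (u 0 t₀) (u 1 t₀)
          ≤ ENNReal.ofReal C *
            (NPME.posPartIntCyl T Ω (F 0) (F 1) + NPME.posPartInt Ω (u₀ 0) (u₀ 1)
              + NPME.exteriorPosPartInt s T Ω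
                  (fun t x => NPME.Phi m (φ 0 t x)) (fun t x => NPME.Phi m (φ 1 t x))) := by
  obtain ⟨l, L, hl, hlL, hKb⟩ := hK.elliptic
  -- The source and initial terms carry the constant `1`, the exterior term carries `2 * L` with `L`
  -- the upper ellipticity bound of `K`.
  refine ⟨max 1 (2 * L), lt_max_of_lt_left one_pos, fun Φε F φ u₀ u _ hd hu _ => ?_⟩
  filter_upwards [(hu 0).comparison hn hs hs1 hT hm hΩ.isOpen hΩ.isBounded hK
    (fun x y => (hKb x y).2) (hl.le.trans hlL) (hd 0) (hd 1) (hu 1)] with t ht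
  refine ht.trans ?_
  have h1 : (1 : ℝ≥0∞) ≤ ENNReal.ofReal (max 1 (2 * L)) := by
    rw [← ENNReal.ofReal_one]
    exact ENNReal.ofReal_le_ofReal (le_max_left _ _)
  rw [mul_add (ENNReal.ofReal (max 1 (2 * L)))]
  exact add_le_add (le_mul_of_one_le_left' h1)
    (mul_le_mul_left (ENNReal.ofReal_le_ofReal (le_max_right _ _)) _)
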